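/- **Setting.** For $\varphi\in\mathbb R$ put $e(\varphi)=(\sin\varphi,\cos\varphi)$. Let $\Omega$ be the cavity bounded by $\mathcal I=[0,1]\times\{0\}$ and a broken line from $(0,0)$ to $(1,0)$ in the upper half-plane. A billiard particle starts at $(\xi,0)$, $0<\xi<1$, with velocity $e(\varphi)$, $|\varphi|<\pi/2$, is reflected elastically from the sides of the broken line, and returns to $\mathcal I$ with a velocity $-e(\varphi_\Omega(\varphi,\xi))$, $|\varphi_\Omega|<\pi/2$ (this is defined for almost all $(\varphi,\xi)$). Put $$\mathcal F(\Omega)=\frac38\int_{-\pi/2}^{\pi/2}\int_0^1\bigl(1+\cos(\varphi_\Omega(\varphi,\xi)-\varphi)\bigr)\cos\varphi\,d\xi\,d\varphi .$$ A right triangle $ABC$ with hypotenuse $AC$ is *canonical* if $B$ lies above $AC$ and the median from $B$ is vertical. For $0<\Psi\le\pi/2$, consider the circular arc of angular size $2\Psi$ in the half-plane $x_2\ge0$ with endpoints $(0,0)$, $(1,0)$; its point with parameter $\alpha\in[-\Psi,\Psi]$ is $\frac1{2\sin\Psi}(\sin\Psi+\sin\alpha,\ \cos\alpha-\cos\Psi)$.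 For $\Psi=0$ the arc is the segment $\mathcal I$. Divide the arc into finitely many small arcs by points ordered from left to right, and replace each small arc by the two legs of the canonical triangle whose hypotenuse is its chord. The broken line obtained is called a *canonical line* of the arc. *Pseudo-billiard on the arc* ($0<\Psi\le\pi/2$). A particle of unit mass starts at $(\xi,0)$ with velocity $e(\varphi)$. When a piece with velocity $e(\theta)$ hits the arc at the point $\alpha$, then: if $|\sin\theta|<\cos(\theta-\alpha)$, it splits into a splinter of relative mass $|\sin\theta|/\cos(\theta-\alpha)$ with velocity $-e(\pm\frac\pi2+\alpha-\theta)$ and a splinter with the remaining mass and velocity $-e(\theta)$; otherwise the whole piece gets the velocity $-e(\pm\frac\pi2+\alpha-\theta)$; the sign $\pm$ is that of $\sin\theta$. Let $m_i$ be the masses of the splinters that finally return to $\mathcal I$, let $-e(\varphi_i^+)$ be their final velocities, and put $$\mathcal F_{\mathrm{ps}}(\Psi)=\frac38\int_{-\pi/2}^{\pi/2}\int_0^1\sum_i m_i\bigl(1+\cos(\varphi_i^+-\varphi)\bigr)\cos\varphi\,d\xi\,d\varphi .$$ **Theorem.** For $0<\Psi\le\pi/2$ let $$\mathcal F(\Psi)=1+\frac16\sin^2\Psi+\frac{2\sqrt2\,\sin\frac\Psi2-2\sin^4\frac\Psi2-\Psi}{\sin\Psi}.$$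 1. For every fixed $\Psi\in(0,\pi/2]$ one has $\mathcal F_{\mathrm{ps}}(\Psi)=\mathcal F(\Psi)$, and the values $\mathcal F(\Omega)$ for the cavities $\Omega$ under the canonical lines of the arc tend to $\mathcal F(\Psi)$ as the mesh (the largest difference of first coordinates of neighbouring division points) tends to $0$. Moreover, $|\mathcal F(\Omega)-\mathcal F(\Psi)|=O(\delta)$ as $\delta\to0^+$, where $\delta$ is the maximal length of a small arc; the constant depends on $\Psi$ only. 2. For $\Psi=0$ the values $\mathcal F(\Omega)$ tend to $\sqrt2$ as the mesh tends to $0$, and $\lim_{\Psi\to0^+}\mathcal F(\Psi)=\sqrt2$; accordingly one puts $\mathcal F(0)=\sqrt2$. 3. The maximum of $\mathcal F(\Psi)$ over $0\le\Psi\le\pi/2$ is attained at exactly one point $\Psi_0$, and $|\Psi_0-0.6835|<10^{-4}$, $|\mathcal F(\Psi_0)-1.445209|<5\cdot10^{-7}$. -/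

import Mathlib

noncomputable section

/-- The unit vector whose clockwise angle from the vertical direction `(0, 1)` is `φ`. -/
def heading (φ : ℝ) : ℝ × ℝ := (Real.sin φ, Real.cos φ)

/-- The Euclidean scalar product of the plane. -/
def dot (u v : ℝ × ℝ) : ℝ := u.1 * v.1 + u.2 * v.2

/-- Orthogonal reflection of the vector `u` in the line spanned by `d` (for `d ≠ 0`): the elastic
reflection law at a wall with direction `d`. -/
def mirror (d u : ℝ × ℝ) : ℝ × ℝ := (2 * dot u d / dot d d) • d - u

/-- The broken line with vertices `x 0, x 1, …, x m`. -/
def brokenLine (m : ℕ) (x : ℕ → ℝ × ℝ) : Set (ℝ × ℝ) :=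
  {q | ∃ k < m, q ∈ segment ℝ (x k) (x (k + 1))}

/-- Starting from `p` with velocity `u`, the particle flies freely during the time interval
`(0, t)` inside the cavity bounded by the broken line and the interval `[0, 1] × {0}`. -/
def FreeFlight (m : ℕ) (x : ℕ → ℝ × ℝ) (p u : ℝ × ℝ) (t : ℝ) : Prop :=
  0 < t ∧ ∀ s : ℝ, 0 < s → s < t → 0 < (p + s • u).2 ∧ p + s • u ∉ brokenLine m x

/-- `ReturnsTo m x p u w`: the billiard particle that leaves `p` with velocity `u`, after finitely
many elastic reflections at interior points of the sides of the broken line, comes back to the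
open interval `(0, 1) × {0}`, its velocity at that moment being `w`. -/
inductive ReturnsTo (m : ℕ) (x : ℕ → ℝ × ℝ) : ℝ × ℝ → ℝ × ℝ → ℝ × ℝ → Prop
  | arrive (p u : ℝ × ℝ) (t : ℝ) (hfree : FreeFlight m x p u t)
      (h0 : (p + t • u).2 = 0) (h1 : (p + t • u).1 ∈ Set.Ioo (0 : ℝ) 1) :
      ReturnsTo m x p u u
  | bounce (p u w : ℝ × ℝ) (t : ℝ) (k : ℕ) (hk : k < m) (hfree : FreeFlight m x p u t)
      (hit : p + t • u ∈ openSegment ℝ (x k) (x (k + 1)))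
      (hnext : ReturnsTo m x (p + t • u) (mirror (x (k + 1) - x k) u) w) :
      ReturnsTo m x p u w

open Classical in
/-- The angle `φ⁺ ∈ (-π/2, π/2)` such that the particle that starts at `(ξ, 0)` with velocity
`(sin φ, cos φ)` returns to `[0, 1] × {0}` with velocity `-(sin φ⁺, cos φ⁺)`
(set to `0` for the exceptional particles that do not return or hit a vertex). -/
def exitAngle (m : ℕ) (x : ℕ → ℝ × ℝ) (φ ξ : ℝ) : ℝ :=
  if h : ∃ ψ : ℝ, ψ ∈ Set.Ioo (-(Real.pi / 2)) (Real.pi / 2) ∧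
      ReturnsTo m x (ξ, 0) (heading φ) (-heading ψ) then h.choose else 0

/-- The normalized resistance of the cavity between `[0, 1] × {0}` and the broken line. -/
def resistance (m : ℕ) (x : ℕ → ℝ × ℝ) : ℝ :=
  3 / 8 * ∫ φ in (-(Real.pi / 2))..(Real.pi / 2), ∫ ξ in (0 : ℝ)..1,
    (1 + Real.cos (exitAngle m x φ ξ - φ)) * Real.cos φ

/-- The vertex `B` of the canonical right triangle with hypotenuse `a c`: it lies above the
midpoint of the hypotenuse at the distance of half the length of the hypotenuse, so that the
triangle is right-angled at `B` and the median from `B` is vertical. -/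
def canonicalApex (a c : ℝ × ℝ) : ℝ × ℝ :=
  ((a.1 + c.1) / 2,
    (a.2 + c.2) / 2 + Real.sqrt ((c.1 - a.1) ^ 2 + (c.2 - a.2) ^ 2) / 2)

/-- The vertices of the canonical line over `p 0, p 1, …`: the even ones are the points `p i`, and
between `p i` and `p (i + 1)` there is the apex of the canonical triangle with these endpoints. -/
def canonicalLine (p : ℕ → ℝ × ℝ) (k : ℕ) : ℝ × ℝ :=
  if k % 2 = 0 then p (k / 2) else canonicalApex (p (k / 2)) (p (k / 2 + 1))

/-- The point with angular parameter `α` on the circle that contains the arc of angular size `2Ψ`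
in the upper half-plane with endpoints `(0, 0)` and `(1, 0)`; the arc is `-Ψ ≤ α ≤ Ψ`, from left
to right, and its outward normal at the point `α` is `heading α`. -/
def arcPoint (Ψ α : ℝ) : ℝ × ℝ :=
  ((Real.sin Ψ + Real.sin α) / (2 * Real.sin Ψ), (Real.cos α - Real.cos Ψ) / (2 * Real.sin Ψ))

/-- `lo = a 0 < a 1 < … < a n = hi`. -/
def IsPartition (lo hi : ℝ) (n : ℕ) (a : ℕ → ℝ) : Prop :=
  a 0 = lo ∧ a n = hi ∧ ∀ i < n, a i < a (i + 1)

/-- The ray from `p` with direction `heading θ` meets the arc at the point with parameter `α`. -/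
def HitsArc (Ψ : ℝ) (p : ℝ × ℝ) (θ α : ℝ) : Prop :=
  α ∈ Set.Ioo (-Ψ) Ψ ∧ ∃ t : ℝ, 0 < t ∧ p + t • heading θ = arcPoint Ψ α

open Classical in
/-- Pseudo-billiard in the circular segment. A particle of unit mass leaves `p` with velocity
`heading θ`. When a (piece of a) particle with velocity `heading θ` hits the arc at `α`, then
* if `|sin θ| < cos (θ - α)`, it splits into a splinter of relative mass
  `|sin θ| / cos (θ - α)` with velocity `-heading (±π/2 + α - θ)` and a splinter with the
  remaining mass and with velocity `-heading θ`;
* otherwise the whole piece gets the velocity `-heading (±π/2 + α - θ)`;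
the sign `±` being that of `sin θ`. A piece whose ray does not meet the arc leaves through
`[0, 1] × {0}`. The value of `splinterSum Ψ g r p θ` is the sum `∑ mᵢ g(φᵢ⁺)` over the pieces that
leave after exactly `r` reflections, where `mᵢ` is the mass and `-heading φᵢ⁺` is the final
velocity (and `-heading ψ = heading (ψ + π)`). -/
def splinterSum (Ψ : ℝ) (g : ℝ → ℝ) : ℕ → ℝ × ℝ → ℝ → ℝ
  | 0, p, θ => if ∃ α, HitsArc Ψ p θ α then 0 else g (θ - Real.pi)
  | r + 1, p, θ =>
      if h : ∃ α, HitsArc Ψ p θ α then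
        let α := h.choose
        let q := arcPoint Ψ α
        let ψ := (if 0 < Real.sin θ then Real.pi / 2 else -(Real.pi / 2)) + α - θ
        if |Real.sin θ| < Real.cos (θ - α) then
          |Real.sin θ| / Real.cos (θ - α) * splinterSum Ψ g r q (ψ + Real.pi) +
            (1 - |Real.sin θ| / Real.cos (θ - α)) * splinterSum Ψ g r q (θ + Real.pi)
        else splinterSum Ψ g r q (ψ + Real.pi)
      else 0

/-- The resistance functional computed with the pseudo-billiard in the segment of angular size
`2Ψ` instead of a billiard: `3/8 ∬ ∑ᵢ mᵢ (1 + cos (φᵢ⁺ - φ)) cos φ dξ dφ`. -/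
def pseudoResistance (Ψ : ℝ) : ℝ :=
  3 / 8 * ∫ φ in (-(Real.pi / 2))..(Real.pi / 2), ∫ ξ in (0 : ℝ)..1,
    (∑' r : ℕ, splinterSum Ψ (fun ψ => 1 + Real.cos (ψ - φ)) r (ξ, 0) φ) * Real.cos φ

/-- The explicit limit resistance, for `0 < Ψ ≤ π/2`. -/
def limitResistance (Ψ : ℝ) : ℝ :=
  1 + 1 / 6 * Real.sin Ψ ^ 2 +
    (2 * Real.sqrt 2 * Real.sin (Ψ / 2) - 2 * Real.sin (Ψ / 2) ^ 4 - Ψ) / Real.sin Ψ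

end

/-! ### Conservation of speed and determinism of the billiard. -/

noncomputable section

/-! A canonical triangle acts as a right-angled mirror. In coordinates along its legs each
reflection changes one sign. Hence a particle with heading `θ` that enters through a hypotenuse with
normal angle `α` either meets both legs and goes back along `-heading θ`, or meets one leg and
leaves along `-heading (±π/2 + α - θ)`. For uniformly distributed entry points the second event has
probability `|sin θ| / cos (θ - α)`, or `1` when this ratio exceeds `1`. This is the splitting law
of the pseudo-billiard; the instances needed are `scatter_right`, `scatter_double` and
`scatter_left`.

By symmetry one may take `0 < φ < π/2`, and it is convenient to measure the deficit `1 - cos (φ⁺ -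
φ)`. Particles reflected from both legs have deficit `0`. A particle reflected once near the point
`α` returns to the axis at once if `α + Ψ ≤ 2φ`, with deficit about `1 + sin (α - 2φ)`. Otherwise,
by the inscribed angle theorem, it meets the arc again near `α - 2φ`. There it is reflected from one
leg wherever it enters the triangle, and it leaves at an angle close to `-φ`, with deficit about `1
- cos 2φ`; no third impact occurs (`leaves_second`). Since `dξ` is proportional to `cos (φ - α) dα`,
the deficit averaged over the starting points tends to an integral of `limitDensity`.

If all angular steps are at most `η`, a chord of step `Δ` contributes an error `O(η Δ)`, except near
four critical parameters, where the chords have total angular length `O(η)` (`abs_chord_le`).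
Summation and integration over `φ` give the linear rate in `abs_resistance_sub_le`. For the
pseudo-billiard the same integral comes out exactly by a change of variables
(`pseudoResistance_eq`), and Fubini's theorem evaluates it (`limitResistance_eq`). On a segment
nothing is approximate, so every canonical line has resistance exactly `√2`.

For the maximum, the derivative of the limit is `sin Ψ` times `slopeFactor Ψ`, and `slopeFactor` is
strictly decreasing on `(0, π/2]`. A sign change between `0.6834` and `0.6836`, certified by Taylor
polynomials with rational error bounds, locates its only zero. -/

lemma mirror_dot_self (d u : ℝ × ℝ) : dot (mirror d u) (mirror d u) = dot u u := by
  simp only [mirror, dot, Prod.fst_sub, Prod.snd_sub, Prod.smul_fst, Prod.smul_snd, smul_eq_mul]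
  by_cases h : d.1 * d.1 + d.2 * d.2 = 0
  · simp [h]
  · set c := 2 * (u.1 * d.1 + u.2 * d.2) / (d.1 * d.1 + d.2 * d.2) with hc
    have h' : c * (d.1 * d.1 + d.2 * d.2) = 2 * (u.1 * d.1 + u.2 * d.2) := div_mul_cancel₀ _ h
    linear_combination c * h'

lemma ReturnsTo.dot_self {m : ℕ} {x : ℕ → ℝ × ℝ} {p u w : ℝ × ℝ} (h : ReturnsTo m x p u w) :
    dot w w = dot u u := by
  induction h with
  | arrive => rfl
  | bounce p u w t k hk hfree hit hnext ih => rw [ih, mirror_dot_self]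

lemma ReturnsTo.snd_neg {m : ℕ} {x : ℕ → ℝ × ℝ} {p u w : ℝ × ℝ} (h : ReturnsTo m x p u w) :
    w.2 < 0 := by
  induction h with
  | arrive p u t hfree h0 h1 =>
    obtain ⟨ht, hs⟩ := hfree
    have := (hs (t / 2) (by linarith) (by linarith)).1
    simp only [Prod.snd_add, Prod.smul_snd, smul_eq_mul] at this h0
    by_contra hu
    push Not at hu
    nlinarith
  | bounce p u w t k hk hfree hit hnext ih => exact ih

/-- The particle may pass through `q`: it lies above the axis and not on the broken line. -/
def FreePoint (m : ℕ) (x : ℕ → ℝ × ℝ) (q : ℝ × ℝ) : Prop :=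
  0 < q.2 ∧ q ∉ brokenLine m x

lemma FreeFlight.trans {m : ℕ} {x : ℕ → ℝ × ℝ} {p u : ℝ × ℝ} {t t' : ℝ}
    (h : FreeFlight m x p u t) (hq : FreePoint m x (p + t • u))
    (h' : FreeFlight m x (p + t • u) u t') : FreeFlight m x p u (t + t') := by
  refine ⟨add_pos h.1 h'.1, fun s hs hst => ?_⟩
  rcases lt_trichotomy s t with hlt | rfl | hgt
  · exact h.2 s hs hlt
  · exact hq
  · have := h'.2 (s - t) (by linarith) (by linarith)
    rwa [add_assoc, ← add_smul, add_sub_cancel] at this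

/-- A flight followed by a return is a return. -/
lemma FreeFlight.returnsTo {m : ℕ} {x : ℕ → ℝ × ℝ} {p u w : ℝ × ℝ} {t : ℝ}
    (h : FreeFlight m x p u t) (hq : FreePoint m x (p + t • u))
    (hr : ReturnsTo m x (p + t • u) u w) : ReturnsTo m x p u w := by
  have key : ∀ t' : ℝ, p + t • u + t' • u = p + (t + t') • u := fun t' => by
    rw [add_assoc, ← add_smul]
  cases hr with
  | arrive _ _ t' hfree h0 h1 =>
    rw [key] at h0 h1
    exact .arrive p u (t + t') (h.trans hq hfree) h0 h1
  | bounce _ _ _ t' k hk hfree hit hnext =>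
    rw [key] at hit hnext
    exact .bounce p u w (t + t') k hk (h.trans hq hfree) hit hnext

lemma mem_openSegment_iff_of_fst_lt {a c q : ℝ × ℝ} (h : a.1 < c.1) :
    q ∈ openSegment ℝ a c ↔
      (q.1 - a.1) * (c.2 - a.2) = (q.2 - a.2) * (c.1 - a.1) ∧ a.1 < q.1 ∧ q.1 < c.1 := by
  rw [openSegment_eq_image']
  constructor
  · rintro ⟨s, ⟨h0, h1⟩, rfl⟩
    simp only [Prod.fst_add, Prod.snd_add, Prod.smul_fst, Prod.smul_snd, Prod.fst_sub,
      Prod.snd_sub, smul_eq_mul]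
    refine ⟨by ring, by nlinarith, by nlinarith⟩
  · rintro ⟨h0, h1, h2⟩
    have hd : 0 < c.1 - a.1 := by linarith
    refine ⟨(q.1 - a.1) / (c.1 - a.1), ⟨div_pos (by linarith) hd, ?_⟩, ?_⟩
    · rw [div_lt_one hd]; linarith
    · ext
      · simp only [Prod.fst_add, Prod.smul_fst, Prod.fst_sub, smul_eq_mul]
        field_simp
        ring
      · simp only [Prod.snd_add, Prod.smul_snd, Prod.snd_sub, smul_eq_mul]
        field_simp
        linarith

lemma fst_le_of_lt {m : ℕ} {x : ℕ → ℝ × ℝ} (hx : ∀ k < m, (x k).1 < (x (k + 1)).1)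
    {i j : ℕ} (hij : i ≤ j) (hj : j ≤ m) : (x i).1 ≤ (x j).1 := by
  induction j, hij using Nat.le_induction with
  | base => exact le_rfl
  | succ j hij ih => exact (ih (by omega)).trans (hx j (by omega)).le

/-- The broken line is a graph over the first axis, so its open sides lie over disjoint intervals.
-/
lemma openSegment_index_unique {m : ℕ} {x : ℕ → ℝ × ℝ}
    (hx : ∀ k < m, (x k).1 < (x (k + 1)).1) {i j : ℕ} (hi : i < m) (hj : j < m) {q : ℝ × ℝ}
    (h1 : q ∈ openSegment ℝ (x i) (x (i + 1))) (h2 : q ∈ openSegment ℝ (x j) (x (j + 1))) :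
    i = j := by
  rw [mem_openSegment_iff_of_fst_lt (hx _ ‹_›)] at h1 h2
  rcases lt_trichotomy i j with h | h | h
  · have := fst_le_of_lt hx (i := i + 1) (j := j) h hj.le
    linarith
  · exact h
  · have := fst_le_of_lt hx (i := j + 1) (j := i) h hi.le
    linarith

lemma mem_brokenLine_of_openSegment {m : ℕ} {x : ℕ → ℝ × ℝ} {k : ℕ} (hk : k < m) {q : ℝ × ℝ}
    (hq : q ∈ openSegment ℝ (x k) (x (k + 1))) : q ∈ brokenLine m x :=
  ⟨k, hk, openSegment_subset_segment _ _ _ hq⟩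

/-- The billiard is deterministic. -/
lemma ReturnsTo.unique {m : ℕ} {x : ℕ → ℝ × ℝ} (hx : ∀ k < m, (x k).1 < (x (k + 1)).1)
    (hy : ∀ k < m, ∀ q ∈ openSegment ℝ (x k) (x (k + 1)), 0 < q.2) {p u w w' : ℝ × ℝ}
    (h : ReturnsTo m x p u w) (h' : ReturnsTo m x p u w') : w = w' := by
  induction h with
  | arrive p u t hfree h0 h1 =>
    cases h' with
    | arrive => rfl
    | bounce _ _ _ t' k hk hfree' hit hnext =>
      exfalso
      -- If the two flights had different durations, the longer one would pass through the endpoint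
      -- of the shorter one, which lies on a wall or on the axis.
      rcases lt_trichotomy t t' with h | h | h
      · exact absurd (hfree'.2 t hfree.1 h).1 (by rw [h0]; exact lt_irrefl _)
      · subst h
        have := hy k hk _ hit
        linarith
      · exact (hfree.2 t' hfree'.1 h).2 (mem_brokenLine_of_openSegment hk hit)
  | bounce p u w t k hk hfree hit hnext ih =>
    cases h' with
    | arrive _ _ t' hfree' h0 h1 =>
      exfalso
      rcases lt_trichotomy t' t with h | h | h
      · exact absurd (hfree.2 t' hfree'.1 h).1 (by rw [h0]; exact lt_irrefl _)
      · subst h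
        have := hy k hk _ hit
        linarith
      · exact (hfree'.2 t hfree.1 h).2 (mem_brokenLine_of_openSegment hk hit)
    | bounce _ _ _ t' k' hk' hfree' hit' hnext' =>
      have ht : t = t' := by
        rcases lt_trichotomy t t' with h | h | h
        · exact absurd (mem_brokenLine_of_openSegment hk hit) (hfree'.2 t hfree.1 h).2
        · exact h
        · exact absurd (mem_brokenLine_of_openSegment hk' hit') (hfree.2 t' hfree'.1 h).2
      subst ht
      obtain rfl := openSegment_index_unique hx hk hk' hit hit'
      exact ih hnext'

lemma dot_heading (α β : ℝ) : dot (heading α) (heading β) = Real.cos (α - β) := by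
  simp only [dot, heading, Real.cos_sub]
  ring

lemma exists_heading_of_dot_self {w : ℝ × ℝ} (h : dot w w = 1) (h2 : 0 < w.2) :
    Real.arcsin w.1 ∈ Set.Ioo (-(Real.pi / 2)) (Real.pi / 2) ∧ heading (Real.arcsin w.1) = w := by
  have h' : w.1 * w.1 + w.2 * w.2 = 1 := h
  have h1 : -1 < w.1 := by nlinarith
  have h3 : w.1 < 1 := by nlinarith
  refine ⟨⟨Real.neg_pi_div_two_lt_arcsin.2 h1, Real.arcsin_lt_pi_div_two.2 h3⟩, ?_⟩
  ext
  · exact Real.sin_arcsin h1.le h3.le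
  · simp only [heading, Real.cos_arcsin]
    rw [show 1 - w.1 ^ 2 = w.2 ^ 2 by nlinarith, Real.sqrt_sq h2.le]

lemma heading_injOn : Set.InjOn heading (Set.Ioo (-(Real.pi / 2)) (Real.pi / 2)) := by
  intro a ha b hb hab
  have h1 : Real.sin a = Real.sin b := congrArg Prod.fst hab
  exact Real.injOn_sin (Set.Ioo_subset_Icc_self ha) (Set.Ioo_subset_Icc_self hb) h1

/-- Determinism replaces the chosen angle in `exitAngle` by an explicit function of the final
velocity, which is what measurability needs. -/
lemma exitAngle_eq {m : ℕ} {x : ℕ → ℝ × ℝ} (hx : ∀ k < m, (x k).1 < (x (k + 1)).1)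
    (hy : ∀ k < m, ∀ q ∈ openSegment ℝ (x k) (x (k + 1)), 0 < q.2) {φ ξ : ℝ} {w : ℝ × ℝ}
    (h : ReturnsTo m x (ξ, 0) (heading φ) w) : exitAngle m x φ ξ = Real.arcsin (-w).1 := by
  have h2 : 0 < (-w).2 := by simpa using h.snd_neg
  have h1 : dot (-w) (-w) = 1 := by
    have : dot w w = 1 := by rw [h.dot_self, dot_heading]; simp
    simpa [dot] using this
  obtain ⟨ha, hb⟩ := exists_heading_of_dot_self h1 h2
  have hex : ∃ ψ : ℝ, ψ ∈ Set.Ioo (-(Real.pi / 2)) (Real.pi / 2) ∧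
      ReturnsTo m x (ξ, 0) (heading φ) (-heading ψ) := ⟨_, ha, by rw [hb, neg_neg]; exact h⟩
  rw [exitAngle, dif_pos hex]
  refine heading_injOn hex.choose_spec.1 ha ?_
  rw [hb, ← hex.choose_spec.2.unique hx hy h, neg_neg]

/-- Only the vector `heading ψ` matters, so angles such as `π/2 + α - φ` may be inserted without
reducing them to `(-π/2, π/2)`. -/
lemma cos_exitAngle_sub {m : ℕ} {x : ℕ → ℝ × ℝ} (hx : ∀ k < m, (x k).1 < (x (k + 1)).1)
    (hy : ∀ k < m, ∀ q ∈ openSegment ℝ (x k) (x (k + 1)), 0 < q.2) {φ ξ ψ : ℝ}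
    (h : ReturnsTo m x (ξ, 0) (heading φ) (-heading ψ)) :
    Real.cos (exitAngle m x φ ξ - φ) = Real.cos (ψ - φ) := by
  have h2 : 0 < (heading ψ).2 := by simpa using h.snd_neg
  have h1 : dot (heading ψ) (heading ψ) = 1 := by rw [dot_heading]; simp
  have hb := (exists_heading_of_dot_self h1 h2).2
  rw [exitAngle_eq hx hy h, neg_neg, ← dot_heading, hb, dot_heading]

/-! ### Measurability of the exit angle -/

/-- The initial states whose trajectories hit the sides listed in `l` and then return. -/
def itinerarySet (m : ℕ) (x : ℕ → ℝ × ℝ) : List ℕ → Set ((ℝ × ℝ) × (ℝ × ℝ))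
  | [] => {z | ∃ t, FreeFlight m x z.1 z.2 t ∧ (z.1 + t • z.2).2 = 0 ∧
      (z.1 + t • z.2).1 ∈ Set.Ioo (0 : ℝ) 1}
  | k :: l => {z | ∃ t, k < m ∧ FreeFlight m x z.1 z.2 t ∧
      z.1 + t • z.2 ∈ openSegment ℝ (x k) (x (k + 1)) ∧
      (z.1 + t • z.2, mirror (x (k + 1) - x k) z.2) ∈ itinerarySet m x l}

/-- The velocity after the reflections from the sides listed in `l`. -/
def itineraryVelocity (x : ℕ → ℝ × ℝ) : List ℕ → ℝ × ℝ → ℝ × ℝ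
  | [], u => u
  | k :: l, u => itineraryVelocity x l (mirror (x (k + 1) - x k) u)

lemma returnsTo_iff_itinerary {m : ℕ} {x : ℕ → ℝ × ℝ} {p u w : ℝ × ℝ} :
    ReturnsTo m x p u w ↔ ∃ l, (p, u) ∈ itinerarySet m x l ∧ w = itineraryVelocity x l u := by
  constructor
  · intro h
    induction h with
    | arrive p u t hfree h0 h1 => exact ⟨[], ⟨t, hfree, h0, h1⟩, rfl⟩
    | bounce p u w t k hk hfree hit hnext ih =>
      obtain ⟨l, h1, h2⟩ := ih
      exact ⟨k :: l, ⟨t, hk, hfree, hit, h1⟩, h2⟩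
  · rintro ⟨l, h1, rfl⟩
    induction l generalizing p u with
    | nil =>
      obtain ⟨t, h, h0, h1⟩ := h1
      exact .arrive p u t h h0 h1
    | cons k l ih =>
      obtain ⟨t, hk, h, h0, h1⟩ := h1
      exact .bounce p u _ t k hk h h0 (ih h1)

lemma isClosed_brokenLine (m : ℕ) (x : ℕ → ℝ × ℝ) : IsClosed (brokenLine m x) := by
  have : brokenLine m x = ⋃ k ∈ Set.Iio m, segment ℝ (x k) (x (k + 1)) := by
    ext q; simp [brokenLine]
  rw [this]
  refine (Set.finite_Iio m).isClosed_biUnion fun k _ => ?_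
  rw [segment_eq_image]
  refine (isCompact_Icc.image ?_).isClosed
  fun_prop

/-- The quantifier over all times is uncountable. Rescaling time to `(0, 1)` and exhausting it by
compact intervals makes the complementary condition a countable union of projections of closed sets
along a compact factor, and these are closed. -/
lemma measurableSet_freeFlight (m : ℕ) (x : ℕ → ℝ × ℝ) :
    MeasurableSet {z : (ℝ × ℝ) × (ℝ × ℝ) × ℝ | FreeFlight m x z.1 z.2.1 z.2.2} := by
  set K : Set (ℝ × ℝ) := brokenLine m x ∪ {q | q.2 ≤ 0} with hK
  have hKc : IsClosed K := (isClosed_brokenLine m x).union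
    (isClosed_le continuous_snd continuous_const)
  let E : ℕ → Set ((ℝ × ℝ) × (ℝ × ℝ) × ℝ) := fun n =>
    {z | ∃ τ : Set.Icc (1 / ((n : ℝ) + 2)) (1 - 1 / ((n : ℝ) + 2)),
      z.1 + ((τ : ℝ) * z.2.2) • z.2.1 ∈ K}
  have hE : ∀ n, IsClosed (E n) := fun n => by
    have h1 : IsClosed {y : Set.Icc (1 / ((n : ℝ) + 2)) (1 - 1 / ((n : ℝ) + 2)) ×
        ((ℝ × ℝ) × (ℝ × ℝ) × ℝ) | y.2.1 + ((y.1 : ℝ) * y.2.2.2) • y.2.2.1 ∈ K} :=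
      hKc.preimage (by fun_prop)
    have h2 := isClosedMap_snd_of_compactSpace _ h1
    convert h2 using 1
    ext z
    simp only [E, Set.mem_ofPred_eq, Set.mem_image, Prod.exists, exists_eq_right]
  have heq : {z : (ℝ × ℝ) × (ℝ × ℝ) × ℝ | FreeFlight m x z.1 z.2.1 z.2.2} =
      {z | 0 < z.2.2} ∩ (⋃ n, E n)ᶜ := by
    ext ⟨p, u, t⟩
    simp only [FreeFlight, Set.mem_ofPred_eq, Set.mem_inter_iff, Set.mem_compl_iff, Set.mem_iUnion,
      not_exists, E]
    refine and_congr_right fun ht => ⟨fun h n τ hτ => ?_, fun h s hs hst => ?_⟩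
    · have h2 : (0 : ℝ) < 1 / ((n : ℝ) + 2) := by positivity
      have h3 := τ.2.1
      have h4 := τ.2.2
      have := h (τ * t) (mul_pos (by linarith) ht) (by nlinarith)
      rcases hτ with hτ | hτ
      · exact this.2 hτ
      · exact absurd this.1 (not_lt.2 hτ)
    · have hpos : 0 < min (s / t) (1 - s / t) := lt_min (div_pos hs ht) (by
        rw [sub_pos, div_lt_one ht]; exact hst)
      obtain ⟨n, hn⟩ := exists_nat_one_div_lt hpos
      have hn' : 1 / ((n : ℝ) + 2) ≤ 1 / ((n : ℝ) + 1) := by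
        apply one_div_le_one_div_of_le <;> [positivity; linarith]
      have h1 := lt_of_lt_of_le hn (min_le_left _ _)
      have h2 := lt_of_lt_of_le hn (min_le_right _ _)
      have := h n ⟨s / t, by linarith, by linarith⟩
      simp only [div_mul_cancel₀ _ ht.ne'] at this
      simp only [hK, Set.mem_union, not_or, Set.mem_ofPred_eq, not_le] at this
      exact ⟨this.2, this.1⟩
  rw [heq]
  refine (measurableSet_lt measurable_const (by fun_prop)).inter
    (MeasurableSet.iUnion fun n => (hE n).measurableSet).compl

lemma measurable_mirror (d : ℝ × ℝ) : Measurable (mirror d) := by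
  unfold mirror dot
  fun_prop

/-- A particle moving parallel to the side it hits would have been on that side shortly before.
Hence the hitting time is a quotient with nonzero denominator. -/
lemma transversal_of_hit {m : ℕ} {x : ℕ → ℝ × ℝ} {k : ℕ} (hk : k < m)
    (hx : (x k).1 < (x (k + 1)).1) {p u : ℝ × ℝ} {t : ℝ} (hf : FreeFlight m x p u t)
    (hit : p + t • u ∈ openSegment ℝ (x k) (x (k + 1))) :
    u.1 * ((x (k + 1)).2 - (x k).2) - u.2 * ((x (k + 1)).1 - (x k).1) ≠ 0 := by
  intro h0
  rw [mem_openSegment_iff_of_fst_lt hx] at hit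
  obtain ⟨h1, h2⟩ := hit
  have hc : Filter.Tendsto (fun s : ℝ => (p + s • u).1) (nhdsWithin t (Set.Iio t))
      (nhds (p + t • u).1) := by
    refine (Continuous.tendsto ?_ t).mono_left nhdsWithin_le_nhds
    fun_prop
  have e1 := hc.eventually (Ioo_mem_nhds h2.1 h2.2)
  have e2 : ∀ᶠ s in nhdsWithin t (Set.Iio t), s ∈ Set.Ioo 0 t :=
    Ioo_mem_nhdsLT hf.1
  obtain ⟨s, hs1, hs2⟩ := (e1.and e2).exists
  refine (hf.2 s hs2.1 hs2.2).2 (mem_brokenLine_of_openSegment hk ?_)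
  rw [mem_openSegment_iff_of_fst_lt hx]
  refine ⟨?_, hs1⟩
  simp only [Prod.fst_add, Prod.snd_add, Prod.smul_fst, Prod.smul_snd, smul_eq_mul] at h1 ⊢
  linear_combination h1 + (s - t) * h0

/-- Along a prescribed itinerary each flight time is a fixed rational function of the state, so the
existential over times disappears. -/
lemma measurableSet_itinerarySet {m : ℕ} {x : ℕ → ℝ × ℝ}
    (hx : ∀ k < m, (x k).1 < (x (k + 1)).1) (l : List ℕ) :
    MeasurableSet (itinerarySet m x l) := by
  induction l with
  | nil =>
    let T : (ℝ × ℝ) × (ℝ × ℝ) → ℝ := fun z => -z.1.2 / z.2.2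
    have hT : Measurable T := by fun_prop
    have heq : itinerarySet m x [] = {z | z.2.2 ≠ 0} ∩
        ((fun z => (z.1, z.2, T z)) ⁻¹'
          {z : (ℝ × ℝ) × (ℝ × ℝ) × ℝ | FreeFlight m x z.1 z.2.1 z.2.2} ∩
        (fun z => (z.1 + T z • z.2).1) ⁻¹' Set.Ioo (0 : ℝ) 1) := by
      ext ⟨p, u⟩
      simp only [itinerarySet, Set.mem_ofPred_eq, Set.mem_inter_iff, Set.mem_preimage, T]
      constructor
      · rintro ⟨t, hf, h0, h1⟩
        have hu := (ReturnsTo.arrive p u t hf h0 h1).snd_neg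
        have : t = -p.2 / u.2 := by
          simp only [Prod.snd_add, Prod.smul_snd, smul_eq_mul] at h0
          rw [eq_div_iff hu.ne]
          linarith
        subst this
        exact ⟨hu.ne, hf, h1⟩
      · rintro ⟨hu, hf, h1⟩
        refine ⟨_, hf, ?_, h1⟩
        simp only [Prod.snd_add, Prod.smul_snd, smul_eq_mul]
        field_simp
        ring
    rw [heq]
    refine ((measurableSet_eq_fun (by fun_prop) measurable_const).compl).inter (.inter ?_ ?_)
    · exact (by fun_prop : Measurable fun z : (ℝ × ℝ) × (ℝ × ℝ) => (z.1, z.2, T z))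
        (measurableSet_freeFlight m x)
    · exact (by fun_prop : Measurable fun z : (ℝ × ℝ) × (ℝ × ℝ) => (z.1 + T z • z.2).1)
        measurableSet_Ioo
  | cons k l ih =>
    by_cases hk : k < m
    swap
    · have : itinerarySet m x (k :: l) = ∅ := by
        ext z; simp [itinerarySet, hk]
      rw [this]; exact MeasurableSet.empty
    set d := x (k + 1) - x k with hd
    let c : (ℝ × ℝ) × (ℝ × ℝ) → ℝ := fun z => z.2.1 * d.2 - z.2.2 * d.1
    let T : (ℝ × ℝ) × (ℝ × ℝ) → ℝ := fun z =>
      (((x k).1 - z.1.1) * d.2 - ((x k).2 - z.1.2) * d.1) / c z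
    have hc : Measurable c := by fun_prop
    have hT : Measurable T := by fun_prop
    have heq : itinerarySet m x (k :: l) = {z | c z ≠ 0} ∩
        ((fun z => (z.1, z.2, T z)) ⁻¹'
          {z : (ℝ × ℝ) × (ℝ × ℝ) × ℝ | FreeFlight m x z.1 z.2.1 z.2.2} ∩
        ((fun z => (z.1 + T z • z.2).1) ⁻¹' Set.Ioo (x k).1 (x (k + 1)).1 ∩
        (fun z => (z.1 + T z • z.2, mirror d z.2)) ⁻¹' itinerarySet m x l)) := by
      ext ⟨p, u⟩
      simp only [itinerarySet, Set.mem_ofPred_eq, Set.mem_inter_iff, Set.mem_preimage]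
      constructor
      · rintro ⟨t, -, hf, h0, h1⟩
        have hcu : c (p, u) ≠ 0 := transversal_of_hit hk (hx k hk) hf h0
        rw [mem_openSegment_iff_of_fst_lt (hx k hk)] at h0
        have : t = T (p, u) := by
          simp only [T]
          rw [eq_div_iff hcu]
          have := h0.1
          simp only [Prod.fst_add, Prod.snd_add, Prod.smul_fst, Prod.smul_snd, smul_eq_mul] at this
          simp only [c, hd, Prod.fst_sub, Prod.snd_sub]
          linarith
        subst this
        exact ⟨hcu, hf, h0.2, h1⟩
      · rintro ⟨hcu, hf, h0, h1⟩
        refine ⟨_, hk, hf, ?_, h1⟩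
        rw [mem_openSegment_iff_of_fst_lt (hx k hk)]
        refine ⟨?_, h0⟩
        have : T (p, u) * c (p, u) =
            (((x k).1 - p.1) * d.2 - ((x k).2 - p.2) * d.1) := div_mul_cancel₀ _ hcu
        simp only [c, hd, Prod.fst_sub, Prod.snd_sub] at this
        simp only [Prod.fst_add, Prod.snd_add, Prod.smul_fst, Prod.smul_snd, smul_eq_mul]
        linear_combination this
    rw [heq]
    have hmir := measurable_mirror d
    refine ((measurableSet_eq_fun hc measurable_const).compl).inter (.inter ?_ (.inter ?_ ?_))
    · exact (by fun_prop : Measurable fun z : (ℝ × ℝ) × (ℝ × ℝ) => (z.1, z.2, T z))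
        (measurableSet_freeFlight m x)
    · exact (by fun_prop : Measurable fun z : (ℝ × ℝ) × (ℝ × ℝ) => (z.1 + T z • z.2).1)
        measurableSet_Ioo
    · exact (by fun_prop : Measurable fun z : (ℝ × ℝ) × (ℝ × ℝ) =>
        (z.1 + T z • z.2, mirror d z.2)) ih

lemma measurable_itineraryVelocity (x : ℕ → ℝ × ℝ) (l : List ℕ) :
    Measurable (itineraryVelocity x l) := by
  induction l with
  | nil => exact measurable_id
  | cons k l ih => exact ih.comp (measurable_mirror _)

lemma measurable_heading : Measurable heading := by
  unfold heading
  fun_prop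

/-- There are countably many itineraries. On the measurable set of each of them the exit angle is
explicit, and outside their union it has the default value `0`. -/
lemma measurable_exitAngle {m : ℕ} {x : ℕ → ℝ × ℝ} (hx : ∀ k < m, (x k).1 < (x (k + 1)).1)
    (hy : ∀ k < m, ∀ q ∈ openSegment ℝ (x k) (x (k + 1)), 0 < q.2) :
    Measurable fun z : ℝ × ℝ => exitAngle m x z.1 z.2 := by
  let S : List ℕ → Set (ℝ × ℝ) := fun l =>
    (fun z : ℝ × ℝ => (((z.2, 0), heading z.1) : (ℝ × ℝ) × (ℝ × ℝ))) ⁻¹' itinerarySet m x l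
  let f : List ℕ → ℝ × ℝ → ℝ := fun l z => Real.arcsin (-itineraryVelocity x l (heading z.1)).1
  have hh := measurable_heading
  have hS : ∀ l, MeasurableSet (S l) := fun l =>
    (by fun_prop : Measurable fun z : ℝ × ℝ => (((z.2, 0), heading z.1) : (ℝ × ℝ) × (ℝ × ℝ)))
      (measurableSet_itinerarySet hx l)
  have hf : ∀ l, Measurable (f l) := fun l => by
    have := measurable_itineraryVelocity x l
    have h2 := Real.measurable_arcsin
    simp only [f]
    fun_prop
  have h1 : ∀ l, ∀ z ∈ S l, exitAngle m x z.1 z.2 = f l z := fun l z hz =>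
    exitAngle_eq hx hy (returnsTo_iff_itinerary.2 ⟨l, hz, rfl⟩)
  have h2 : ∀ z, z ∉ ⋃ l, S l → exitAngle m x z.1 z.2 = 0 := fun z hz => by
    rw [exitAngle, dif_neg]
    rintro ⟨ψ, -, h⟩
    obtain ⟨l, hl, -⟩ := returnsTo_iff_itinerary.1 h
    exact hz (Set.mem_iUnion.2 ⟨l, hl⟩)
  intro B hB
  have : (fun z : ℝ × ℝ => exitAngle m x z.1 z.2) ⁻¹' B =
      (⋃ l, S l ∩ f l ⁻¹' B) ∪ ((⋃ l, S l)ᶜ ∩ {_z | (0 : ℝ) ∈ B}) := by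
    ext z
    by_cases hz : z ∈ ⋃ l, S l
    · obtain ⟨l, hl⟩ := Set.mem_iUnion.1 hz
      simp only [Set.mem_preimage, Set.mem_union, Set.mem_inter_iff, Set.mem_compl_iff, hz,
        not_true, false_and, or_false, Set.mem_iUnion]
      constructor
      · intro h
        exact ⟨l, hl, by rwa [← h1 l z hl]⟩
      · rintro ⟨l', hl', h⟩
        rwa [h1 l' z hl']
    · have hz' : ∀ l, z ∉ S l := fun l hl => hz (Set.mem_iUnion.2 ⟨l, hl⟩)
      simp [h2 z hz, hz']
  rw [this]
  refine (MeasurableSet.iUnion fun l => (hS l).inter (hf l hB)).union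
    ((MeasurableSet.iUnion hS).compl.inter (MeasurableSet.const _))

end
noncomputable section

/-! ### Billiard in a canonical triangle -/

lemma canonicalLine_even (p : ℕ → ℝ × ℝ) (i : ℕ) : canonicalLine p (2 * i) = p i := by
  simp [canonicalLine]

lemma canonicalLine_odd (p : ℕ → ℝ × ℝ) (i : ℕ) :
    canonicalLine p (2 * i + 1) = canonicalApex (p i) (p (i + 1)) := by
  have h1 : (2 * i + 1) % 2 = 1 := by omega
  have h2 : (2 * i + 1) / 2 = i := by omega
  simp [canonicalLine, h1, h2]

lemma canonicalLine_even_succ (p : ℕ → ℝ × ℝ) (i : ℕ) :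
    canonicalLine p (2 * i + 1 + 1) = p (i + 1) := canonicalLine_even p (i + 1)

/-- The length of the hypotenuse. -/
def hypot (A C : ℝ × ℝ) : ℝ := Real.sqrt ((C.1 - A.1) ^ 2 + (C.2 - A.2) ^ 2)

lemma hypot_sq (A C : ℝ × ℝ) : hypot A C ^ 2 = (C.1 - A.1) ^ 2 + (C.2 - A.2) ^ 2 :=
  Real.sq_sqrt (by positivity)

lemma abs_snd_sub_lt_hypot {A C : ℝ × ℝ} (h : A.1 < C.1) : |C.2 - A.2| < hypot A C := by
  refine Real.lt_sqrt_of_sq_lt ?_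
  rw [sq_abs]
  nlinarith

/-- The point with barycentric coordinates `x`, `y` with respect to the vertices of the canonical
triangle with hypotenuse `A C`. -/
def triPoint (A C : ℝ × ℝ) (x y : ℝ) : ℝ × ℝ :=
  ((A.1 + C.1) / 2 + (y - x) * (C.1 - A.1) / 2,
    (A.2 + C.2) / 2 + (y - x) * (C.2 - A.2) / 2 + (1 - x - y) * hypot A C / 2)

/-- The vector with coordinates `a`, `b` with respect to the legs of the canonical triangle. -/
def triVec (A C : ℝ × ℝ) (a b : ℝ) : ℝ × ℝ :=
  ((b - a) * (C.1 - A.1) / 2, (b - a) * (C.2 - A.2) / 2 - (a + b) * hypot A C / 2)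

lemma triPoint_add_smul (A C : ℝ × ℝ) (x y a b t : ℝ) :
    triPoint A C x y + t • triVec A C a b = triPoint A C (x + t * a) (y + t * b) := by
  ext <;> simp [triPoint, triVec] <;> ring

lemma triVec_neg (A C : ℝ × ℝ) (a b : ℝ) : triVec A C (-a) (-b) = -triVec A C a b := by
  ext <;> simp [triVec] <;> ring

lemma triPoint_hypotenuse (A C : ℝ × ℝ) (y : ℝ) :
    triPoint A C (1 - y) y = (1 - y) • A + y • C := by
  ext <;> simp [triPoint] <;> ring

lemma segment_left_leg {A C q : ℝ × ℝ} :
    q ∈ segment ℝ A (canonicalApex A C) ↔ ∃ x, 0 ≤ x ∧ x ≤ 1 ∧ q = triPoint A C x 0 := by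
  rw [segment_eq_image']
  constructor
  · rintro ⟨s, ⟨h0, h1⟩, rfl⟩
    refine ⟨1 - s, by linarith, by linarith, ?_⟩
    ext <;> simp [triPoint, canonicalApex, hypot] <;> ring
  · rintro ⟨x, h0, h1, rfl⟩
    refine ⟨1 - x, ⟨by linarith, by linarith⟩, ?_⟩
    ext <;> simp [triPoint, canonicalApex, hypot] <;> ring

lemma segment_right_leg {A C q : ℝ × ℝ} :
    q ∈ segment ℝ (canonicalApex A C) C ↔ ∃ y, 0 ≤ y ∧ y ≤ 1 ∧ q = triPoint A C 0 y := by
  rw [segment_eq_image']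
  constructor
  · rintro ⟨s, ⟨h0, h1⟩, rfl⟩
    refine ⟨s, by linarith, by linarith, ?_⟩
    ext <;> simp [triPoint, canonicalApex, hypot] <;> ring
  · rintro ⟨x, h0, h1, rfl⟩
    refine ⟨x, ⟨by linarith, by linarith⟩, ?_⟩
    ext <;> simp [triPoint, canonicalApex, hypot] <;> ring

lemma openSegment_left_leg {A C : ℝ × ℝ} {x : ℝ} (h0 : 0 < x) (h1 : x < 1) :
    triPoint A C x 0 ∈ openSegment ℝ A (canonicalApex A C) := by
  rw [openSegment_eq_image']
  refine ⟨1 - x, ⟨by linarith, by linarith⟩, ?_⟩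
  ext <;> simp [triPoint, canonicalApex, hypot] <;> ring

lemma openSegment_right_leg {A C : ℝ × ℝ} {y : ℝ} (h0 : 0 < y) (h1 : y < 1) :
    triPoint A C 0 y ∈ openSegment ℝ (canonicalApex A C) C := by
  rw [openSegment_eq_image']
  refine ⟨y, ⟨by linarith, by linarith⟩, ?_⟩
  ext <;> simp [triPoint, canonicalApex, hypot] <;> ring

lemma triPoint_inj {A C : ℝ × ℝ} (h : A.1 < C.1) {x y x' y' : ℝ}
    (he : triPoint A C x y = triPoint A C x' y') : x = x' ∧ y = y' := by
  have hl : 0 < hypot A C := (abs_nonneg _).trans_lt (abs_snd_sub_lt_hypot h)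
  have h1 := congrArg Prod.fst he
  have h2 := congrArg Prod.snd he
  simp only [triPoint] at h1 h2
  have h3 : y - x = y' - x' := by
    have : (C.1 - A.1) * ((y - x) - (y' - x')) = 0 := by linarith
    rcases mul_eq_zero.1 this with h4 | h4 <;> linarith
  rw [h3] at h2
  have h4 : x + y = x' + y' := by
    have : hypot A C * ((x + y) - (x' + y')) = 0 := by linarith
    rcases mul_eq_zero.1 this with h4 | h4 <;> linarith
  constructor <;> linarith

lemma mirror_of_orthogonal {d e : ℝ × ℝ} (hd : dot d d ≠ 0) (he : dot e d = 0) (a b : ℝ) :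
    mirror d (a • e + b • d) = (-a) • e + b • d := by
  have : dot (a • e + b • d) d = b * dot d d := by
    simp only [dot, Prod.fst_add, Prod.snd_add, Prod.smul_fst, Prod.smul_snd, smul_eq_mul] at he ⊢
    linear_combination a * he
  rw [mirror, this, mul_div_assoc, mul_div_cancel_right₀ _ hd]
  module

/-- The legs are orthogonal because the apex is at half the length of the hypotenuse from its
midpoint (`hypot_sq`). The reflection therefore changes the sign of the component along the other
leg and keeps the component along its own. -/
lemma mirror_right_leg {A C : ℝ × ℝ} (h : A.1 < C.1) (a b : ℝ) :
    mirror (C - canonicalApex A C) (triVec A C a b) = triVec A C (-a) b := by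
  have hq := hypot_sq A C
  have hl := abs_snd_sub_lt_hypot h
  have e1 : ∀ a b, triVec A C a b = a • triVec A C 1 0 + b • triVec A C 0 1 := fun a b => by
    ext <;> simp [triVec] <;> ring
  have e2 : C - canonicalApex A C = triVec A C 0 1 := by
    ext <;> simp [triVec, canonicalApex, hypot] <;> ring
  rw [e1 a b, e1 (-a) b, e2]
  apply mirror_of_orthogonal
  · have : 0 < dot (triVec A C 0 1) (triVec A C 0 1) := by
      simp only [dot, triVec]
      nlinarith [mul_pos (sub_pos.2 h) (sub_pos.2 h), mul_self_nonneg (C.2 - A.2 - hypot A C)]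
    exact this.ne'
  · simp only [dot, triVec]
    linear_combination hq / 4

lemma mirror_left_leg {A C : ℝ × ℝ} (h : A.1 < C.1) (a b : ℝ) :
    mirror (canonicalApex A C - A) (triVec A C a b) = triVec A C a (-b) := by
  have hq := hypot_sq A C
  have hl := abs_snd_sub_lt_hypot h
  have e1 : ∀ a b, triVec A C a b = b • triVec A C 0 1 + (-a) • triVec A C (-1) 0 :=
    fun a b => by ext <;> simp [triVec] <;> ring
  have e2 : canonicalApex A C - A = triVec A C (-1) 0 := by
    ext <;> simp [triVec, canonicalApex, hypot] <;> ring
  rw [e1 a b, e1 a (-b), e2]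
  apply mirror_of_orthogonal
  · have : 0 < dot (triVec A C (-1) 0) (triVec A C (-1) 0) := by
      simp only [dot, triVec]
      nlinarith [mul_pos (sub_pos.2 h) (sub_pos.2 h), mul_self_nonneg (C.2 - A.2 + hypot A C)]
    exact this.ne'
  · simp only [dot, triVec]
    linear_combination -hq / 4

/-- The points `p 0, …, p n` go from left to right and lie on or above the axis. -/
structure IsProfile (n : ℕ) (p : ℕ → ℝ × ℝ) : Prop where
  fst_lt : ∀ i < n, (p i).1 < (p (i + 1)).1
  snd_nonneg : ∀ i ≤ n, 0 ≤ (p i).2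

namespace IsProfile

variable {n : ℕ} {p : ℕ → ℝ × ℝ}

lemma snd_triPoint_pos (hp : IsProfile n p) {i : ℕ} (hi : i < n) {x y : ℝ} (hx : 0 ≤ x)
    (hy : 0 ≤ y) (hxy : x + y < 1) : 0 < (triPoint (p i) (p (i + 1)) x y).2 := by
  have h1 := hp.snd_nonneg i hi.le
  have h2 := hp.snd_nonneg (i + 1) hi
  have hl := abs_snd_sub_lt_hypot (hp.fst_lt i hi)
  rw [abs_lt] at hl
  have hl' : 0 < hypot (p i) (p (i + 1)) := by linarith
  simp only [triPoint]
  have h3 : 0 ≤ x * ((p i).2 + (p i).2) := by positivity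
  have h4 : 0 ≤ y * ((p (i + 1)).2 + (p (i + 1)).2) := by positivity
  have h5 : 0 < (1 - x - y) * ((p i).2 + (p (i + 1)).2 + hypot (p i) (p (i + 1))) := by
    apply mul_pos <;> linarith
  nlinarith

lemma exists_leg (p : ℕ → ℝ × ℝ) {k : ℕ} (hk : k < 2 * n) : ∃ i < n,
    (canonicalLine p k = p i ∧ canonicalLine p (k + 1) = canonicalApex (p i) (p (i + 1))) ∨
    (canonicalLine p k = canonicalApex (p i) (p (i + 1)) ∧
      canonicalLine p (k + 1) = p (i + 1)) := by
  rcases Nat.even_or_odd' k with ⟨i, rfl | rfl⟩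
  · exact ⟨i, by omega, Or.inl ⟨canonicalLine_even p i, canonicalLine_odd p i⟩⟩
  · exact ⟨i, by omega, Or.inr ⟨canonicalLine_odd p i, canonicalLine_even_succ p i⟩⟩

lemma line_fst_lt (hp : IsProfile n p) : ∀ k < 2 * n,
    (canonicalLine p k).1 < (canonicalLine p (k + 1)).1 := by
  intro k hk
  obtain ⟨i, hi, ⟨h1, h2⟩ | ⟨h1, h2⟩⟩ := exists_leg p hk <;>
  · have := hp.fst_lt i hi
    rw [h1, h2]
    simp only [canonicalApex]
    linarith

lemma line_snd_pos (hp : IsProfile n p) : ∀ k < 2 * n,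
    ∀ q ∈ openSegment ℝ (canonicalLine p k) (canonicalLine p (k + 1)), 0 < q.2 := by
  intro k hk q hq
  rw [openSegment_eq_image'] at hq
  obtain ⟨s, ⟨h0, h1⟩, rfl⟩ := hq
  obtain ⟨i, hi, ⟨e1, e2⟩ | ⟨e1, e2⟩⟩ := exists_leg p hk <;> rw [e1, e2]
  · convert hp.snd_triPoint_pos hi (x := 1 - s) (y := 0) (by linarith) le_rfl (by linarith)
      using 1
    simp [triPoint, canonicalApex, hypot]
    ring
  · convert hp.snd_triPoint_pos hi (x := 0) (y := s) le_rfl (by linarith) (by linarith) using 1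
    simp [triPoint, canonicalApex, hypot]
    ring

lemma exists_triPoint_of_mem {q : ℝ × ℝ}
    (hq : q ∈ brokenLine (2 * n) (canonicalLine p)) : ∃ i < n, ∃ x y, 0 ≤ x ∧ 0 ≤ y ∧
      x + y ≤ 1 ∧ (x = 0 ∨ y = 0) ∧ q = triPoint (p i) (p (i + 1)) x y := by
  obtain ⟨k, hk, hq⟩ := hq
  obtain ⟨i, hi, ⟨h1, h2⟩ | ⟨h1, h2⟩⟩ := exists_leg p hk <;> rw [h1, h2] at hq
  · obtain ⟨x, h0, h1, rfl⟩ := segment_left_leg.1 hq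
    exact ⟨i, hi, x, 0, h0, le_rfl, by linarith, Or.inr rfl, rfl⟩
  · obtain ⟨y, h0, h1, rfl⟩ := segment_right_leg.1 hq
    exact ⟨i, hi, 0, y, le_rfl, h0, by linarith, Or.inl rfl, rfl⟩

/-- The triangles lie over disjoint vertical strips, so only the legs of the same triangle could
interfere. -/
lemma triPoint_notMem (hp : IsProfile n p) {i : ℕ} (hi : i < n) {x y : ℝ} (hx : 0 < x)
    (hy : 0 < y) (hxy : x + y ≤ 1) :
    triPoint (p i) (p (i + 1)) x y ∉ brokenLine (2 * n) (canonicalLine p) := by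
  intro h
  obtain ⟨j, hj, x', y', hx', hy', hxy', h0, he⟩ := exists_triPoint_of_mem h
  have hw := hp.fst_lt i hi
  have hw' := hp.fst_lt j hj
  have h1 := congrArg Prod.fst he
  simp only [triPoint] at h1
  rcases lt_trichotomy i j with hij | rfl | hij
  · have := fst_le_of_lt hp.fst_lt (i := i + 1) (j := j) hij hj.le
    nlinarith
  · obtain ⟨rfl, rfl⟩ := triPoint_inj hw he
    rcases h0 with h0 | h0 <;> linarith
  · have := fst_le_of_lt hp.fst_lt (i := j + 1) (j := i) hij hi.le
    nlinarith

end IsProfile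

lemma exists_add_mul_eq_zero (c : ℝ) {d : ℝ} (hd : d ≠ 0) : ∃ t, c + t * d = 0 :=
  ⟨-c / d, by rw [div_mul_cancel₀ _ hd, add_neg_cancel]⟩

/-- All free flights are verified through this fact: a flight is affine in time, so only its two
ends have to be inspected. -/
lemma pos_of_endpoints {f k s t : ℝ} (h0 : 0 ≤ f) (h1 : 0 ≤ f + t * k)
    (h : 0 < f ∨ 0 < f + t * k) (hs : 0 < s) (hst : s < t) : 0 < f + s * k := by
  have ht : 0 < t := hs.trans hst
  have : t * (f + s * k) = (t - s) * f + s * (f + t * k) := by ring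
  have : 0 < t * (f + s * k) := by
    rw [this]
    rcases h with h | h
    · have := mul_pos (sub_pos.2 hst) h
      have := mul_nonneg hs.le h1
      linarith
    · have := mul_nonneg (sub_pos.2 hst).le h0
      have := mul_pos hs h
      linarith
  exact pos_of_mul_pos_right this ht.le

namespace IsProfile

variable {n : ℕ} {p : ℕ → ℝ × ℝ}

/-- A flight inside a canonical triangle. -/
lemma freeFlight_triangle (hp : IsProfile n p) {i : ℕ} (hi : i < n) {x y a b t : ℝ} (ht : 0 < t)
    (hx : 0 ≤ x) (hx' : 0 ≤ x + t * a) (hx2 : 0 < x ∨ 0 < x + t * a)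
    (hy : 0 ≤ y) (hy' : 0 ≤ y + t * b) (hy2 : 0 < y ∨ 0 < y + t * b)
    (hz : 0 ≤ 1 - x - y) (hz' : 0 ≤ 1 - x - y + t * (-a - b))
    (hz2 : 0 < 1 - x - y ∨ 0 < 1 - x - y + t * (-a - b)) :
    FreeFlight (2 * n) (canonicalLine p) (triPoint (p i) (p (i + 1)) x y)
      (triVec (p i) (p (i + 1)) a b) t := by
  refine ⟨ht, fun s hs hst => ?_⟩
  have h1 := pos_of_endpoints hx hx' hx2 hs hst
  have h2 := pos_of_endpoints hy hy' hy2 hs hst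
  have h3 := pos_of_endpoints hz hz' hz2 hs hst
  rw [triPoint_add_smul]
  exact ⟨hp.snd_triPoint_pos hi h1.le h2.le (by linarith),
    hp.triPoint_notMem hi h1 h2 (by linarith)⟩

lemma bounce_right (hp : IsProfile n p) {i : ℕ} (hi : i < n) {x y a b t : ℝ} {w : ℝ × ℝ}
    (hf : FreeFlight (2 * n) (canonicalLine p) (triPoint (p i) (p (i + 1)) x y)
      (triVec (p i) (p (i + 1)) a b) t)
    (hx : x + t * a = 0) (hy0 : 0 < y + t * b) (hy1 : y + t * b < 1)
    (hr : ReturnsTo (2 * n) (canonicalLine p) (triPoint (p i) (p (i + 1)) 0 (y + t * b))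
      (triVec (p i) (p (i + 1)) (-a) b) w) :
    ReturnsTo (2 * n) (canonicalLine p) (triPoint (p i) (p (i + 1)) x y)
      (triVec (p i) (p (i + 1)) a b) w := by
  refine .bounce _ _ w t (2 * i + 1) (by omega) hf ?_ ?_
  · rw [triPoint_add_smul, hx, canonicalLine_odd, canonicalLine_even_succ]
    exact openSegment_right_leg hy0 hy1
  · rw [triPoint_add_smul, hx, canonicalLine_odd, canonicalLine_even_succ,
      mirror_right_leg (hp.fst_lt i hi)]
    exact hr

lemma bounce_left (hp : IsProfile n p) {i : ℕ} (hi : i < n) {x y a b t : ℝ} {w : ℝ × ℝ}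
    (hf : FreeFlight (2 * n) (canonicalLine p) (triPoint (p i) (p (i + 1)) x y)
      (triVec (p i) (p (i + 1)) a b) t)
    (hy : y + t * b = 0) (hx0 : 0 < x + t * a) (hx1 : x + t * a < 1)
    (hr : ReturnsTo (2 * n) (canonicalLine p) (triPoint (p i) (p (i + 1)) (x + t * a) 0)
      (triVec (p i) (p (i + 1)) a (-b)) w) :
    ReturnsTo (2 * n) (canonicalLine p) (triPoint (p i) (p (i + 1)) x y)
      (triVec (p i) (p (i + 1)) a b) w := by
  refine .bounce _ _ w t (2 * i) (by omega) hf ?_ ?_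
  · rw [triPoint_add_smul, hy, canonicalLine_odd, canonicalLine_even]
    exact openSegment_left_leg hx0 hx1
  · rw [triPoint_add_smul, hy, canonicalLine_odd, canonicalLine_even,
      mirror_left_leg (hp.fst_lt i hi)]
    exact hr

/-- Every flight with velocity `v` that arrives at the point with barycentric coordinates `1 - y`,
`y` of the hypotenuse of the triangle `i` is continued to a return with velocity `w`. -/
def LeavesTo (n : ℕ) (p : ℕ → ℝ × ℝ) (i : ℕ) (y : ℝ) (v w : ℝ × ℝ) : Prop :=
  ∀ (q : ℝ × ℝ) (t : ℝ), FreeFlight (2 * n) (canonicalLine p) q v t →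
    q + t • v = triPoint (p i) (p (i + 1)) (1 - y) y → ReturnsTo (2 * n) (canonicalLine p) q v w

/-- A particle which is reflected from the right leg only. -/
lemma single_right (hp : IsProfile n p) {i : ℕ} (hi : i < n) {a b y : ℝ} {w : ℝ × ℝ}
    (hab : a + b < 0) (hy0 : 0 < y) (hy1 : y < 1) (hs : y * (a + b) < 2 * b)
    (hw : ∀ y', 0 < y' → y' < 1 → (b - a) * y' = 2 * b - y * (a + b) →
      LeavesTo n p i y' (triVec (p i) (p (i + 1)) (-a) b) w) :
    ReturnsTo (2 * n) (canonicalLine p) (triPoint (p i) (p (i + 1)) (1 - y) y)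
      (triVec (p i) (p (i + 1)) a b) w := by
  have hab' : a < b := by
    by_contra h
    push Not at h
    nlinarith
  have ha : a < 0 := by linarith
  -- Here `t` is the time of flight to the right leg and `Y` the coordinate of the impact; `s` below
  -- is the time from there back to the hypotenuse.
  obtain ⟨t, ht⟩ : ∃ t, 1 - y + t * a = 0 := exists_add_mul_eq_zero _ ha.ne
  have ht0 : 0 < t := by by_contra h; nlinarith
  obtain ⟨Y, hY⟩ : ∃ Y, Y = y + t * b := ⟨_, rfl⟩
  have hYa : a * Y = y * (a + b) - b := by rw [hY]; linear_combination b * ht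
  have hY0 : 0 < Y := by
    by_contra h
    push Not at h
    have : 0 ≤ a * Y := mul_nonneg_of_nonpos_of_nonpos ha.le h
    rcases le_total b 0 with hb | hb <;> nlinarith
  have hY1 : Y < 1 := by
    by_contra h
    push Not at h
    have : a * Y ≤ a * 1 := mul_le_mul_of_nonpos_left h ha.le
    nlinarith
  obtain ⟨s, hs'⟩ : ∃ s, 1 - Y = s * (b - a) := ⟨(1 - Y) / (b - a), by
    have : b - a ≠ 0 := by linarith
    field_simp⟩
  have hs0 : 0 < s := by by_contra h; nlinarith
  have hX0 : 0 < s * -a := mul_pos hs0 (by linarith)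
  -- Hypothesis `hs` says that the hypotenuse is reached before the left leg.
  have hYs : 0 < Y + s * b := by
    have h1 : 0 < (b - a) * (Y + s * b) := by
      have : (b - a) * (Y + s * b) = b - a * Y := by linear_combination -b * hs'
      rw [this, hYa]
      linarith
    exact pos_of_mul_pos_right h1 (by linarith)
  refine hp.bounce_right hi (t := t) (hp.freeFlight_triangle hi ht0 ?_ ?_ ?_ ?_ ?_ ?_ ?_ ?_ ?_) ht
    (by rwa [← hY]) (by rwa [← hY]) ?_
  · linarith
  · exact ht.ge
  · left; linarith
  · exact hy0.le
  · rw [← hY]; exact hY0.le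
  · exact Or.inl hy0
  · linarith
  · have : 0 < t * (-a - b) := mul_pos ht0 (by linarith)
    linarith
  · right
    have : 0 < t * (-a - b) := mul_pos ht0 (by linarith)
    linarith
  · rw [← hY]
    refine hw (Y + s * b) hYs ?_ ?_ _ s (hp.freeFlight_triangle hi hs0 le_rfl ?_ ?_ hY0.le hYs.le
      (Or.inl hY0) ?_ ?_ ?_) ?_
    · nlinarith
    · linear_combination -b * hs' - hYa
    · linarith
    · right; linarith
    · linarith
    · have : 1 - 0 - Y + s * (- -a - b) = 0 := by linear_combination hs'
      exact this.ge
    · left; linarith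
    · rw [triPoint_add_smul]
      congr 1
      linear_combination -hs'

/-- A particle which is reflected from the left leg only. -/
lemma single_left (hp : IsProfile n p) {i : ℕ} (hi : i < n) {a b y : ℝ} {w : ℝ × ℝ}
    (hab : a + b < 0) (hy0 : 0 < y) (hy1 : y < 1) (ha : 0 ≤ a)
    (hw : ∀ y', 0 < y' → y' < 1 →
      LeavesTo n p i y' (triVec (p i) (p (i + 1)) a (-b)) w) :
    ReturnsTo (2 * n) (canonicalLine p) (triPoint (p i) (p (i + 1)) (1 - y) y)
      (triVec (p i) (p (i + 1)) a b) w := by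
  have hb : b < 0 := by linarith
  obtain ⟨t, ht⟩ : ∃ t, y + t * b = 0 := exists_add_mul_eq_zero _ hb.ne
  have ht0 : 0 < t := by by_contra h; nlinarith
  obtain ⟨X, hX⟩ : ∃ X, X = 1 - y + t * a := ⟨_, rfl⟩
  have hX0 : 0 < X := by
    have := mul_nonneg ht0.le ha
    linarith
  have hX1 : X < 1 := by
    have : 0 < t * (-a - b) := mul_pos ht0 (by linarith)
    nlinarith
  obtain ⟨s, hs'⟩ : ∃ s, 1 - X = s * (a - b) := ⟨(1 - X) / (a - b), by
    have : a - b ≠ 0 := by linarith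
    field_simp⟩
  have hs0 : 0 < s := by by_contra h; nlinarith
  have hY0 : 0 < s * -b := mul_pos hs0 (by linarith)
  have hsa := mul_nonneg hs0.le ha
  refine hp.bounce_left hi (t := t) (hp.freeFlight_triangle hi ht0 ?_ ?_ ?_ ?_ ?_ ?_ ?_ ?_ ?_) ht
    (by rwa [← hX]) (by rwa [← hX]) ?_
  · linarith
  · rw [← hX]; exact hX0.le
  · left; linarith
  · exact hy0.le
  · exact ht.ge
  · exact Or.inl hy0
  · linarith
  · have : 0 < t * (-a - b) := mul_pos ht0 (by linarith)
    linarith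
  · right
    have : 0 < t * (-a - b) := mul_pos ht0 (by linarith)
    linarith
  · rw [← hX]
    refine hw (s * -b) hY0 ?_ _ s (hp.freeFlight_triangle hi hs0 hX0.le ?_ (Or.inl hX0) le_rfl
      ?_ ?_ ?_ ?_ ?_) ?_
    · nlinarith
    · linarith
    · linarith
    · right; linarith
    · linarith
    · have : 1 - X - 0 + s * (-a - -b) = 0 := by linear_combination hs'
      exact this.ge
    · left; linarith
    · rw [triPoint_add_smul]
      congr 1
      · linear_combination -hs'
      · ring

/-- A particle which is reflected from both legs. -/
lemma double_reflection (hp : IsProfile n p) {i : ℕ} (hi : i < n) {a b y : ℝ} {w : ℝ × ℝ}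
    (hab : a < b) (hy0 : 0 < y) (hy1 : y < 1) (hs : 2 * b < y * (a + b))
    (hne : y * (a + b) ≠ b) (hb : b < 0)
    (hw : ∀ y', 0 < y' → y' < 1 →
      LeavesTo n p i y' (triVec (p i) (p (i + 1)) (-a) (-b)) w) :
    ReturnsTo (2 * n) (canonicalLine p) (triPoint (p i) (p (i + 1)) (1 - y) y)
      (triVec (p i) (p (i + 1)) a b) w := by
  have ha : a < 0 := by linarith
  -- Equality in `hne` would mean a trajectory through the apex. The strict inequality decides which
  -- leg is met first.
  rcases hne.lt_or_gt with hlt | hgt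
  · obtain ⟨t, ht⟩ : ∃ t, 1 - y + t * a = 0 := exists_add_mul_eq_zero _ ha.ne
    have ht0 : 0 < t := by by_contra h; nlinarith
    obtain ⟨Y, hY⟩ : ∃ Y, Y = y + t * b := ⟨_, rfl⟩
    have hYa : a * Y = y * (a + b) - b := by rw [hY]; linear_combination b * ht
    have hY0 : 0 < Y := by
      by_contra h
      push Not at h
      have : 0 ≤ a * Y := mul_nonneg_of_nonpos_of_nonpos ha.le h
      linarith
    have hY1 : Y < 1 := by
      by_contra h
      push Not at h
      have : a * Y ≤ a * 1 := mul_le_mul_of_nonpos_left h ha.le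
      nlinarith
    obtain ⟨s, hs'⟩ : ∃ s, Y + s * b = 0 := exists_add_mul_eq_zero _ hb.ne
    have hs0 : 0 < s := by by_contra h; nlinarith
    obtain ⟨X, hX⟩ : ∃ X, X = 0 + s * -a := ⟨_, rfl⟩
    have hX0 : 0 < X := by rw [hX, zero_add]; exact mul_pos hs0 (by linarith)
    have hXb : b * X = a * Y := by rw [hX]; linear_combination -a * hs'
    have hX1 : X < 1 := by
      by_contra h
      push Not at h
      have : b * X ≤ b * 1 := mul_le_mul_of_nonpos_left h hb.le
      linarith
    obtain ⟨r, hr⟩ : ∃ r, 1 - X = r * (-a - b) := ⟨(1 - X) / (-a - b), by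
      have : -a - b ≠ 0 := by linarith
      field_simp⟩
    have hr0 : 0 < r := by by_contra h; nlinarith
    have hra : 0 < r * -a := mul_pos hr0 (by linarith)
    have hrb : 0 < r * -b := mul_pos hr0 (by linarith)
    have htab : 0 < t * (-a - b) := mul_pos ht0 (by linarith)
    refine hp.bounce_right hi (t := t) (hp.freeFlight_triangle hi ht0 ?_ ht.ge ?_ hy0.le ?_
      (Or.inl hy0) ?_ ?_ ?_) ht (by rwa [← hY]) (by rwa [← hY]) ?_
    · linarith
    · left; linarith
    · rw [← hY]; exact hY0.le
    · linarith
    · linarith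
    · right; linarith
    rw [← hY]
    refine hp.bounce_left hi (t := s) (hp.freeFlight_triangle hi hs0 le_rfl ?_ ?_ hY0.le hs'.ge
      (Or.inl hY0) ?_ ?_ ?_) hs' (by rwa [← hX]) (by rwa [← hX]) ?_
    · rw [← hX]; exact hX0.le
    · right; rw [← hX]; exact hX0
    · linarith
    · linarith
    · left; linarith
    rw [← hX]
    refine hw (r * -b) hrb ?_ _ r (hp.freeFlight_triangle hi hr0 hX0.le ?_ (Or.inl hX0) le_rfl
      ?_ ?_ ?_ ?_ ?_) ?_
    · linarith
    · linarith
    · linarith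
    · right; linarith
    · linarith
    · linarith
    · left; linarith
    · rw [triPoint_add_smul]
      congr 1
      · linear_combination -hr
      · ring
  · obtain ⟨t, ht⟩ : ∃ t, y + t * b = 0 := exists_add_mul_eq_zero _ hb.ne
    have ht0 : 0 < t := by by_contra h; nlinarith
    obtain ⟨X, hX⟩ : ∃ X, X = 1 - y + t * a := ⟨_, rfl⟩
    have hXb : b * X = b - y * (a + b) := by rw [hX]; linear_combination a * ht
    have hX0 : 0 < X := by
      by_contra h
      push Not at h
      have : 0 ≤ b * X := mul_nonneg_of_nonpos_of_nonpos hb.le h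
      linarith
    have hX1 : X < 1 := by
      have : t * a < 0 := mul_neg_of_pos_of_neg ht0 ha
      linarith
    obtain ⟨s, hs'⟩ : ∃ s, X + s * a = 0 := exists_add_mul_eq_zero _ ha.ne
    have hs0 : 0 < s := by by_contra h; nlinarith
    obtain ⟨Y, hY⟩ : ∃ Y, Y = 0 + s * -b := ⟨_, rfl⟩
    have hY0 : 0 < Y := by rw [hY, zero_add]; exact mul_pos hs0 (by linarith)
    have hYX : Y < X := by nlinarith
    obtain ⟨r, hr⟩ : ∃ r, 1 - Y = r * (-a - b) := ⟨(1 - Y) / (-a - b), by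
      have : -a - b ≠ 0 := by linarith
      field_simp⟩
    have hr0 : 0 < r := by by_contra h; nlinarith
    have hra : 0 < r * -a := mul_pos hr0 (by linarith)
    have hrb : 0 < r * -b := mul_pos hr0 (by linarith)
    have htab : 0 < t * (-a - b) := mul_pos ht0 (by linarith)
    refine hp.bounce_left hi (t := t) (hp.freeFlight_triangle hi ht0 ?_ ?_ ?_ hy0.le ht.ge
      (Or.inl hy0) ?_ ?_ ?_) ht (by rwa [← hX]) (by rwa [← hX]) ?_
    · linarith
    · rw [← hX]; exact hX0.le
    · left; linarith
    · linarith
    · linarith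
    · right; linarith
    rw [← hX]
    refine hp.bounce_right hi (t := s) (hp.freeFlight_triangle hi hs0 hX0.le hs'.ge (Or.inl hX0)
      le_rfl ?_ ?_ ?_ ?_ ?_) hs' (by rwa [← hY]) (by rw [← hY]; linarith) ?_
    · rw [← hY]; exact hY0.le
    · right; rw [← hY]; exact hY0
    · linarith
    · linarith
    · left; linarith
    rw [← hY]
    refine hw (Y + r * -b) ?_ ?_ _ r (hp.freeFlight_triangle hi hr0 le_rfl ?_ ?_ hY0.le ?_
      (Or.inl hY0) ?_ ?_ ?_) ?_
    · linarith
    · linarith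
    · linarith
    · right; linarith
    · linarith
    · linarith
    · linarith
    · left; linarith
    · rw [triPoint_add_smul]
      congr 1
      linear_combination -hr

end IsProfile

end
noncomputable section
open Real

/-! ### Canonical lines of an arc -/

/-- The coordinate transversal to the direction `heading θ`. -/
def offset (θ : ℝ) (q : ℝ × ℝ) : ℝ := q.1 * cos θ - q.2 * sin θ

lemma offset_arcPoint {Ψ : ℝ} (hΨ : sin Ψ ≠ 0) (θ α : ℝ) :
    2 * sin Ψ * offset θ (arcPoint Ψ α) = sin (α - θ) + sin (Ψ + θ) := by
  simp only [offset, arcPoint, sin_sub, sin_add]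
  field_simp
  ring

lemma sin_add_sin_eq (x y : ℝ) : sin x + sin y = 2 * sin ((x + y) / 2) * cos ((x - y) / 2) := by
  have h1 := sin_add ((x + y) / 2) ((x - y) / 2)
  have h2 := sin_sub ((x + y) / 2) ((x - y) / 2)
  rw [show (x + y) / 2 + (x - y) / 2 = x by ring] at h1
  rw [show (x + y) / 2 - (x - y) / 2 = y by ring] at h2
  rw [h1, h2]
  ring

/-- Equal offsets mean a common line with direction `heading θ`; the scalar is the flight time at
unit speed. Visibility thus becomes a comparison of offsets. -/
lemma eq_add_smul_of_offset_eq {θ : ℝ} {q r : ℝ × ℝ} (h : offset θ q = offset θ r) :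
    r = q + (-dot (r - q) (heading θ)) • -heading θ := by
  simp only [offset] at h
  have := sin_sq_add_cos_sq θ
  ext
  · simp only [dot, heading, Prod.fst_add, Prod.smul_fst, Prod.fst_sub, Prod.snd_sub,
      Prod.fst_neg, smul_eq_mul]
    linear_combination (-(r.1 - q.1)) * this - cos θ * h
  · simp only [dot, heading, Prod.snd_add, Prod.smul_snd, Prod.fst_sub, Prod.snd_sub,
      Prod.snd_neg, smul_eq_mul]
    linear_combination (-(r.2 - q.2)) * this + sin θ * h

lemma neg_heading_eq (θ : ℝ) : heading (θ + π) = -heading θ := by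
  ext <;> simp [heading, sin_add_pi, cos_add_pi]

/-- A partition of the arc into at least two small arcs. -/
structure IsArcPartition (Ψ : ℝ) (n : ℕ) (a : ℕ → ℝ) : Prop where
  pos : 0 < Ψ
  le : Ψ ≤ π / 2
  two_le : 2 ≤ n
  part : IsPartition (-Ψ) Ψ n a

/-- The division points of the arc. -/
def vtx (Ψ : ℝ) (a : ℕ → ℝ) (i : ℕ) : ℝ × ℝ := arcPoint Ψ (a i)

/-- The midpoint of a small arc. -/
def mid (a : ℕ → ℝ) (i : ℕ) : ℝ := (a i + a (i + 1)) / 2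

/-- The signed distance from the chord `k`. -/
def side (Ψ : ℝ) (a : ℕ → ℝ) (k : ℕ) (q : ℝ × ℝ) : ℝ :=
  dot (q - vtx Ψ a k) (heading (mid a k))

/-- The point dividing the chord `i` in the ratio `y : 1 - y`. -/
def chordPoint (Ψ : ℝ) (a : ℕ → ℝ) (i : ℕ) (y : ℝ) : ℝ × ℝ :=
  triPoint (vtx Ψ a i) (vtx Ψ a (i + 1)) (1 - y) y

lemma chordPoint_eq (Ψ : ℝ) (a : ℕ → ℝ) (i : ℕ) (y : ℝ) :
    chordPoint Ψ a i y = (1 - y) • vtx Ψ a i + y • vtx Ψ a (i + 1) := triPoint_hypotenuse _ _ _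

lemma side_comb (Ψ : ℝ) (a : ℕ → ℝ) (k : ℕ) (y : ℝ) (q r : ℝ × ℝ) :
    side Ψ a k ((1 - y) • q + y • r) = (1 - y) * side Ψ a k q + y * side Ψ a k r := by
  simp [side, dot]
  ring

lemma offset_comb (θ : ℝ) (y : ℝ) (q r : ℝ × ℝ) :
    offset θ ((1 - y) • q + y • r) = (1 - y) * offset θ q + y * offset θ r := by
  simp [offset]
  ring

lemma side_add_smul (Ψ : ℝ) (a : ℕ → ℝ) (k : ℕ) (q : ℝ × ℝ) (t θ : ℝ) :
    side Ψ a k (q + t • -heading θ) = side Ψ a k q - t * cos (θ - mid a k) := by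
  rw [← dot_heading]
  simp [side, dot]
  ring

lemma cos_sub_cos_lt_of_abs {x y : ℝ} (h : |x| < |y|) (hy : |y| ≤ π) : cos y < cos x := by
  rw [← cos_abs x, ← cos_abs y]
  exact cos_lt_cos_of_nonneg_of_le_pi (abs_nonneg x) hy h

namespace IsArcPartition

variable {Ψ : ℝ} {n : ℕ} {a : ℕ → ℝ}

lemma sin_pos (h : IsArcPartition Ψ n a) : 0 < sin Ψ :=
  sin_pos_of_pos_of_lt_pi h.pos (by linarith [h.le, pi_pos])

lemma lt (h : IsArcPartition Ψ n a) {i j : ℕ} (hij : i < j) (hj : j ≤ n) : a i < a j := by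
  induction j, hij using Nat.le_induction with
  | base => exact h.part.2.2 i (by omega)
  | succ j hij ih => exact (ih (by omega)).trans (h.part.2.2 j (by omega))

lemma monotone (h : IsArcPartition Ψ n a) {i j : ℕ} (hij : i ≤ j) (hj : j ≤ n) : a i ≤ a j := by
  rcases hij.eq_or_lt with rfl | hlt
  · exact le_rfl
  · exact (h.lt hlt hj).le

lemma neg_le (h : IsArcPartition Ψ n a) {i : ℕ} (hi : i ≤ n) : -Ψ ≤ a i :=
  h.part.1 ▸ h.monotone (Nat.zero_le i) hi

lemma le_self (h : IsArcPartition Ψ n a) {i : ℕ} (hi : i ≤ n) : a i ≤ Ψ :=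
  h.part.2.1 ▸ h.monotone hi le_rfl

lemma mid_mem (h : IsArcPartition Ψ n a) {i : ℕ} (hi : i < n) :
    a i < mid a i ∧ mid a i < a (i + 1) := by
  have := h.part.2.2 i hi
  unfold mid
  constructor <;> linarith

lemma neg_lt_mid (h : IsArcPartition Ψ n a) {i : ℕ} (hi : i < n) : -Ψ < mid a i :=
  (h.neg_le hi.le).trans_lt (h.mid_mem hi).1

lemma mid_lt (h : IsArcPartition Ψ n a) {i : ℕ} (hi : i < n) : mid a i < Ψ :=
  (h.mid_mem hi).2.trans_le (h.le_self (i := i + 1) hi)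

lemma cos_mid_pos (h : IsArcPartition Ψ n a) {i : ℕ} (hi : i < n) : 0 < cos (mid a i) :=
  cos_pos_of_mem_Ioo ⟨by linarith [h.neg_lt_mid hi, h.le], by linarith [h.mid_lt hi, h.le]⟩

lemma isProfile (h : IsArcPartition Ψ n a) : IsProfile n (vtx Ψ a) := by
  have hs := h.sin_pos
  have hle := h.le
  refine ⟨fun i hi => ?_, fun i hi => ?_⟩
  · have h1 := h.neg_le hi.le
    have h2 := h.le_self (i := i + 1) hi
    have := sin_lt_sin_of_lt_of_le_pi_div_two (by linarith) (by linarith) (h.part.2.2 i hi)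
    simp only [vtx, arcPoint]
    gcongr
  · have h1 := h.neg_le hi
    have h2 := h.le_self hi
    have : cos Ψ ≤ cos (a i) := by
      rw [← cos_abs (a i)]
      exact cos_le_cos_of_nonneg_of_le_pi (abs_nonneg _) (by linarith [pi_pos]) (abs_le.2 ⟨h1, h2⟩)
    simp only [vtx, arcPoint]
    exact div_nonneg (by linarith) (by linarith)

lemma side_vtx (h : IsArcPartition Ψ n a) (k j : ℕ) : 2 * sin Ψ * side Ψ a k (vtx Ψ a j) =
    cos (a j - mid a k) - cos ((a (k + 1) - a k) / 2) := by
  have hs := h.sin_pos.ne'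
  have : cos ((a (k + 1) - a k) / 2) = cos (a k - mid a k) := by
    rw [← cos_neg]; congr 1; unfold mid; ring
  rw [this, cos_sub, cos_sub]
  simp only [side, dot, vtx, arcPoint, heading, Prod.fst_sub, Prod.snd_sub]
  field_simp
  ring

/-- Strict convexity of the inscribed polygon: every other vertex is at a larger angular distance
from the midpoint of the small arc than the endpoints of its chord. -/
lemma side_vtx_neg (h : IsArcPartition Ψ n a) {k j : ℕ} (hk : k < n) (hj : j ≤ n) (h1 : j ≠ k)
    (h2 : j ≠ k + 1) : side Ψ a k (vtx Ψ a j) < 0 := by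
  have hs := h.sin_pos
  have hlt := h.part.2.2 k hk
  have e1 := h.neg_le hj
  have e2 := h.le_self hj
  have e3 := h.neg_lt_mid hk
  have e4 := h.mid_lt hk
  have e5 := h.le
  have key : cos (a j - mid a k) < cos ((a (k + 1) - a k) / 2) := by
    apply cos_sub_cos_lt_of_abs
    · rw [abs_of_pos (by linarith), lt_abs]
      rcases lt_or_gt_of_ne h1 with h3 | h3
      · right
        have := h.lt h3 hk.le
        unfold mid; linarith
      · left
        have := h.lt (show k + 1 < j by omega) hj
        unfold mid; linarith
    · rw [abs_le]; constructor <;> linarith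
  have := h.side_vtx k j
  by_contra hc
  push Not at hc
  have : 0 ≤ 2 * sin Ψ * side Ψ a k (vtx Ψ a j) := by positivity
  linarith

lemma side_left (k : ℕ) : side Ψ a k (vtx Ψ a k) = 0 := by
  simp [side, dot]

lemma side_right (h : IsArcPartition Ψ n a) (k : ℕ) : side Ψ a k (vtx Ψ a (k + 1)) = 0 := by
  have := h.side_vtx k (k + 1)
  rw [show a (k + 1) - mid a k = (a (k + 1) - a k) / 2 by unfold mid; ring, sub_self] at this
  exact (mul_eq_zero.1 this).resolve_left (by have := h.sin_pos; positivity)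

lemma side_vtx_nonpos (h : IsArcPartition Ψ n a) {k j : ℕ} (hk : k < n) (hj : j ≤ n) :
    side Ψ a k (vtx Ψ a j) ≤ 0 := by
  by_cases h1 : j = k
  · subst h1; exact (side_left j).le
  by_cases h2 : j = k + 1
  · subst h2; exact (h.side_right k).le
  exact (h.side_vtx_neg hk hj h1 h2).le

lemma side_chordPoint_self (h : IsArcPartition Ψ n a) (i : ℕ) (y : ℝ) :
    side Ψ a i (chordPoint Ψ a i y) = 0 := by
  rw [chordPoint_eq, side_comb, side_left, h.side_right]
  ring

lemma side_chordPoint_neg (h : IsArcPartition Ψ n a) {i k : ℕ} (hi : i < n) (hk : k < n)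
    (hik : k ≠ i) {y : ℝ} (hy0 : 0 < y) (hy1 : y < 1) : side Ψ a k (chordPoint Ψ a i y) < 0 := by
  rw [chordPoint_eq, side_comb]
  have h1 := h.side_vtx_nonpos hk hi.le
  have h2 := h.side_vtx_nonpos (j := i + 1) hk hi
  by_cases hc : i = k + 1
  · have h3 := h.side_vtx_neg (j := i + 1) hk hi (by omega) (by omega)
    nlinarith
  · have h3 := h.side_vtx_neg (j := i) hk hi.le (by omega) (by omega)
    nlinarith

lemma side_chordPoint_nonpos (h : IsArcPartition Ψ n a) {i k : ℕ} (hi : i < n) (hk : k < n)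
    {y : ℝ} (hy0 : 0 < y) (hy1 : y < 1) : side Ψ a k (chordPoint Ψ a i y) ≤ 0 := by
  by_cases hik : k = i
  · subst hik; exact (h.side_chordPoint_self k y).le
  · exact (h.side_chordPoint_neg hi hk hik hy0 hy1).le

lemma vtx_zero (h : IsArcPartition Ψ n a) : vtx Ψ a 0 = (0, 0) := by
  simp [vtx, arcPoint, h.part.1]

lemma vtx_last (h : IsArcPartition Ψ n a) : vtx Ψ a n = (1, 0) := by
  have := h.sin_pos.ne'
  simp only [vtx, arcPoint, h.part.2.1, sub_self, zero_div, Prod.mk.injEq, and_true]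
  field_simp
  ring

/-- This needs `two_le`: with a single small arc the chord would be the axis segment itself. -/
lemma side_axis_neg (h : IsArcPartition Ψ n a) {k : ℕ} (hk : k < n) {ξ : ℝ} (h0 : 0 < ξ)
    (h1 : ξ < 1) : side Ψ a k (ξ, 0) < 0 := by
  have : ((ξ, 0) : ℝ × ℝ) = (1 - ξ) • vtx Ψ a 0 + ξ • vtx Ψ a n := by
    rw [h.vtx_zero, h.vtx_last]; ext <;> simp
  rw [this, side_comb]
  have hn := h.two_le
  have h2 := h.side_vtx_nonpos hk (Nat.zero_le n)
  have h3 := h.side_vtx_nonpos hk le_rfl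
  by_cases hc : k = 0
  · have h3 := h.side_vtx_neg hk le_rfl (by omega) (by omega)
    nlinarith
  · have h3 := h.side_vtx_neg hk (Nat.zero_le n) (by omega) (by omega)
    nlinarith

/-- The length of the chord `i`. -/
lemma hypot_eq (h : IsArcPartition Ψ n a) {i : ℕ} (hi : i < n) :
    hypot (vtx Ψ a i) (vtx Ψ a (i + 1)) = sin ((a (i + 1) - a i) / 2) / sin Ψ ∧
    (vtx Ψ a (i + 1)).1 - (vtx Ψ a i).1 =
      sin ((a (i + 1) - a i) / 2) / sin Ψ * cos (mid a i) ∧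
    (vtx Ψ a (i + 1)).2 - (vtx Ψ a i).2 =
      -(sin ((a (i + 1) - a i) / 2) / sin Ψ * sin (mid a i)) := by
  have hs := h.sin_pos
  have hlt := h.part.2.2 i hi
  have e1 : a (i + 1) = mid a i + (a (i + 1) - a i) / 2 := by unfold mid; ring
  have e2 : a i = mid a i - (a (i + 1) - a i) / 2 := by unfold mid; ring
  set d := (a (i + 1) - a i) / 2 with hd
  have hsd : 0 ≤ sin d := sin_nonneg_of_nonneg_of_le_pi (by linarith)
    (by linarith [h.neg_le hi.le, h.le_self (i := i + 1) hi, h.le])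
  have h1 : (vtx Ψ a (i + 1)).1 - (vtx Ψ a i).1 = sin d / sin Ψ * cos (mid a i) := by
    simp only [vtx, arcPoint]
    rw [e1, e2, sin_add, sin_sub]
    field_simp
    ring
  have h2 : (vtx Ψ a (i + 1)).2 - (vtx Ψ a i).2 = -(sin d / sin Ψ * sin (mid a i)) := by
    simp only [vtx, arcPoint]
    rw [e1, e2, cos_add, cos_sub]
    field_simp
    ring
  refine ⟨?_, h1, h2⟩
  rw [hypot, h1, h2, show (sin d / sin Ψ * cos (mid a i)) ^ 2 +
    (-(sin d / sin Ψ * sin (mid a i))) ^ 2 = (sin d / sin Ψ) ^ 2 by linear_combination (sin d / sin Ψ) ^ 2 * sin_sq_add_cos_sq (mid a i)]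
  exact sqrt_sq (by positivity)

lemma hypot_pos (h : IsArcPartition Ψ n a) {i : ℕ} (hi : i < n) :
    0 < hypot (vtx Ψ a i) (vtx Ψ a (i + 1)) :=
  (abs_nonneg _).trans_lt (abs_snd_sub_lt_hypot (h.isProfile.fst_lt i hi))

lemma side_triPoint_nonneg (h : IsArcPartition Ψ n a) {k : ℕ} (hk : k < n) {x y : ℝ}
    (hxy : x + y ≤ 1) : 0 ≤ side Ψ a k (triPoint (vtx Ψ a k) (vtx Ψ a (k + 1)) x y) := by
  have e := h.side_right k
  have : side Ψ a k (triPoint (vtx Ψ a k) (vtx Ψ a (k + 1)) x y) =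
      (1 + y - x) / 2 * side Ψ a k (vtx Ψ a (k + 1)) +
      (1 - x - y) * hypot (vtx Ψ a k) (vtx Ψ a (k + 1)) / 2 * cos (mid a k) := by
    simp only [side, dot, triPoint, heading, Prod.fst_sub, Prod.snd_sub]
    ring
  rw [this, e, mul_zero, zero_add]
  have h1 := h.hypot_pos hk
  have h2 := h.cos_mid_pos hk
  have h3 : 0 ≤ 1 - x - y := by linarith
  positivity

lemma freePoint_of_side_neg (h : IsArcPartition Ψ n a) {q : ℝ × ℝ} (hq : 0 < q.2)
    (hs : ∀ k < n, side Ψ a k q < 0) : FreePoint (2 * n) (canonicalLine (vtx Ψ a)) q := by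
  refine ⟨hq, fun hm => ?_⟩
  obtain ⟨k, hk, x, y, -, -, hxy, -, rfl⟩ := IsProfile.exists_triPoint_of_mem hm
  exact absurd (hs k hk) (not_lt.2 (h.side_triPoint_nonneg hk hxy))

lemma chordPoint_snd_pos (h : IsArcPartition Ψ n a) {i : ℕ} (hi : i < n) {y : ℝ} (hy0 : 0 < y)
    (hy1 : y < 1) : 0 < (chordPoint Ψ a i y).2 := by
  have hpos : ∀ j, 0 < j → j < n → 0 < (vtx Ψ a j).2 := fun j h0 h1 => by
    have e1 := h.lt h0 h1.le
    have e2 := h.lt h1 le_rfl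
    rw [h.part.1] at e1
    rw [h.part.2.1] at e2
    have : cos Ψ < cos (a j) := by
      apply cos_sub_cos_lt_of_abs
      · rw [abs_of_pos h.pos]; exact abs_lt.2 ⟨e1, e2⟩
      · rw [abs_of_pos h.pos]; linarith [h.le, pi_pos]
    have hs := h.sin_pos
    simp only [vtx, arcPoint]
    exact div_pos (by linarith) (by linarith)
  have h1 := h.isProfile.snd_nonneg i hi.le
  have h2 := h.isProfile.snd_nonneg (i + 1) hi
  have hn := h.two_le
  simp only [chordPoint_eq, Prod.snd_add, Prod.smul_snd, smul_eq_mul]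
  by_cases hc : i = 0
  · have := hpos (i + 1) (by omega) (by omega)
    nlinarith
  · have := hpos i (by omega) (by omega)
    nlinarith

lemma freePoint_chordPoint (h : IsArcPartition Ψ n a) {i : ℕ} (hi : i < n) {y : ℝ} (hy0 : 0 < y)
    (hy1 : y < 1) : FreePoint (2 * n) (canonicalLine (vtx Ψ a)) (chordPoint Ψ a i y) :=
  ⟨h.chordPoint_snd_pos hi hy0 hy1,
    h.isProfile.triPoint_notMem hi (by linarith) hy0 (by linarith)⟩

/-- A flight below the chords. -/
lemma freeFlight_transit (h : IsArcPartition Ψ n a) {q : ℝ × ℝ} {t θ : ℝ} (ht : 0 < t)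
    (h1 : ∀ k < n, side Ψ a k q ≤ 0) (h2 : ∀ k < n, side Ψ a k (q + t • -heading θ) ≤ 0)
    (h3 : ∀ k < n, side Ψ a k q < 0 ∨ side Ψ a k (q + t • -heading θ) < 0)
    (h4 : 0 ≤ q.2) (h5 : 0 ≤ (q + t • -heading θ).2)
    (h6 : 0 < q.2 ∨ 0 < (q + t • -heading θ).2) :
    FreeFlight (2 * n) (canonicalLine (vtx Ψ a)) q (-heading θ) t := by
  refine ⟨ht, fun s hs hst => h.freePoint_of_side_neg ?_ fun k hk => ?_⟩
  · simp only [Prod.snd_add, Prod.smul_snd, smul_eq_mul] at h5 h6 ⊢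
    exact pos_of_endpoints h4 h5 h6 hs hst
  · have e1 := h1 k hk
    have e2 := h2 k hk
    have e3 := h3 k hk
    rw [side_add_smul] at e2 e3 ⊢
    have := pos_of_endpoints (f := -side Ψ a k q) (k := cos (θ - mid a k)) (t := t) (s := s)
      (by linarith) (by linarith) (e3.imp (fun _ => by linarith) fun _ => by linarith) hs hst
    linarith

/-- From the chord `i` along a line that meets the axis between the endpoints of the arc. -/
lemma leaves_axis (h : IsArcPartition Ψ n a) {i : ℕ} (hi : i < n) {y ψ : ℝ} (hy0 : 0 < y)
    (hy1 : y < 1) (hc : 0 < cos (ψ - mid a i)) (h0 : 0 < offset ψ (chordPoint Ψ a i y))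
    (h1 : offset ψ (chordPoint Ψ a i y) < cos ψ) :
    IsProfile.LeavesTo n (vtx Ψ a) i y (-heading ψ) (-heading ψ) := by
  intro q t hf hq
  change _ = chordPoint Ψ a i y at hq
  refine hf.returnsTo (by rw [hq]; exact h.freePoint_chordPoint hi hy0 hy1) ?_
  rw [hq]
  have hcψ : 0 < cos ψ := h0.trans h1
  set c := chordPoint Ψ a i y with hcdef
  obtain ⟨ξ, hξ⟩ : ∃ ξ, ξ = offset ψ c / cos ψ := ⟨_, rfl⟩
  have hξ0 : 0 < ξ := hξ ▸ div_pos h0 hcψ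
  have hξ1 : ξ < 1 := by rw [hξ, div_lt_one hcψ]; exact h1
  have hoff : offset ψ c = offset ψ (ξ, 0) := by
    simp only [offset] at hξ ⊢
    rw [hξ]
    field_simp
    ring
  have hz := eq_add_smul_of_offset_eq hoff
  set T := -dot ((ξ, 0) - c) (heading ψ) with hT
  have hside : side Ψ a i (ξ, 0) = 0 - T * cos (ψ - mid a i) := by
    rw [hz, side_add_smul, hcdef, h.side_chordPoint_self]
  have hneg : ∀ k < n, side Ψ a k (ξ, 0) < 0 := fun k hk => h.side_axis_neg hk hξ0 hξ1
  -- The target is strictly below the chord `i`, and the velocity points downwards from that chord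
  -- by `hc`; so the target lies ahead of the particle.
  have hT0 : 0 < T := by
    have := hneg i hi
    by_contra hcon
    push Not at hcon
    nlinarith
  refine .arrive _ _ T (h.freeFlight_transit hT0 (fun k hk =>
    h.side_chordPoint_nonpos hi hk hy0 hy1) ?_ ?_ ?_ ?_ ?_) ?_ ?_
  · rw [← hz]; exact fun k hk => (hneg k hk).le
  · rw [← hz]; exact fun k hk => Or.inr (hneg k hk)
  · exact (h.chordPoint_snd_pos hi hy0 hy1).le
  · rw [← hz]
  · exact Or.inl (h.chordPoint_snd_pos hi hy0 hy1)
  · rw [← hz]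
  · rw [← hz]; exact ⟨hξ0, hξ1⟩

/-- From the chord `i` to the chord `j`. -/
lemma leaves_chord (h : IsArcPartition Ψ n a) {i j : ℕ} (hi : i < n) (hj : j < n) (hij : i ≠ j)
    {y z ψ : ℝ} {w : ℝ × ℝ} (hy0 : 0 < y) (hy1 : y < 1) (hz0 : 0 < z) (hz1 : z < 1)
    (hc : 0 < cos (ψ - mid a i))
    (hoff : offset ψ (chordPoint Ψ a i y) = offset ψ (chordPoint Ψ a j z))
    (hr : cos (ψ - mid a j) < 0 → ReturnsTo (2 * n) (canonicalLine (vtx Ψ a))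
      (chordPoint Ψ a j z) (-heading ψ) w) :
    IsProfile.LeavesTo n (vtx Ψ a) i y (-heading ψ) w := by
  intro q t hf hq
  change _ = chordPoint Ψ a i y at hq
  refine hf.returnsTo (by rw [hq]; exact h.freePoint_chordPoint hi hy0 hy1) ?_
  rw [hq]
  set c := chordPoint Ψ a i y with hcdef
  have hz := eq_add_smul_of_offset_eq hoff
  set c' := chordPoint Ψ a j z with hcdef'
  set T := -dot (c' - c) (heading ψ) with hT
  have hside : side Ψ a i c' = 0 - T * cos (ψ - mid a i) := by
    rw [hz, side_add_smul, hcdef, h.side_chordPoint_self]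
  have hside' : 0 = side Ψ a j c - T * cos (ψ - mid a j) := by
    rw [← side_add_smul, ← hz, hcdef', h.side_chordPoint_self]
  have hT0 : 0 < T := by
    have := h.side_chordPoint_neg hj hi hij hz0 hz1
    by_contra hcon
    push Not at hcon
    nlinarith
  -- The particle starts strictly below the chord `j` and reaches it, hence crosses it upwards. This
  -- sign is handed over to `hr`.
  have hcj : cos (ψ - mid a j) < 0 := by
    have := h.side_chordPoint_neg hi hj hij.symm hy0 hy1
    by_contra hcon
    push Not at hcon
    nlinarith
  have hsnd := h.chordPoint_snd_pos hj hz0 hz1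
  refine (h.freeFlight_transit (t := T) hT0 (fun k hk =>
    h.side_chordPoint_nonpos hi hk hy0 hy1) ?_ ?_ (h.chordPoint_snd_pos hi hy0 hy1).le ?_
      ?_).returnsTo (by rw [← hz]; exact h.freePoint_chordPoint hj hz0 hz1) ?_
  · rw [← hz]; exact fun k hk => h.side_chordPoint_nonpos hj hk hz0 hz1
  · rw [← hz]
    intro k hk
    by_cases hki : k = i
    · right; exact h.side_chordPoint_neg hj hk (by omega) hz0 hz1
    · left; exact h.side_chordPoint_neg hi hk hki hy0 hy1
  · rw [← hz]; exact hsnd.le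
  · exact Or.inl (h.chordPoint_snd_pos hi hy0 hy1)
  · rw [← hz]; exact hr hcj

/-- From the axis to the chord `i`. -/
lemma returnsTo_of_chord (h : IsArcPartition Ψ n a) {i : ℕ} (hi : i < n) {y φ ξ : ℝ} {w : ℝ × ℝ}
    (hy0 : 0 < y) (hy1 : y < 1) (hξ0 : 0 < ξ) (hξ1 : ξ < 1) (hc : 0 < cos (φ - mid a i))
    (hoff : ξ * cos φ = offset φ (chordPoint Ψ a i y))
    (hr : ReturnsTo (2 * n) (canonicalLine (vtx Ψ a)) (chordPoint Ψ a i y) (heading φ) w) :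
    ReturnsTo (2 * n) (canonicalLine (vtx Ψ a)) (ξ, 0) (heading φ) w := by
  -- The transit lemmas are stated for velocities `-heading`, hence the shift by `π`.
  have hh : heading φ = -heading (φ + π) := by rw [neg_heading_eq, neg_neg]
  have hoff' : offset (φ + π) (ξ, 0) = offset (φ + π) (chordPoint Ψ a i y) := by
    simp only [offset, cos_add_pi, sin_add_pi] at hoff ⊢
    linear_combination -hoff
  rw [hh] at hr ⊢
  have hc' : cos (φ + π - mid a i) < 0 := by
    rw [show φ + π - mid a i = (φ - mid a i) + π by ring, cos_add_pi]
    linarith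
  have hz := eq_add_smul_of_offset_eq hoff'
  set c' := chordPoint Ψ a i y with hcdef'
  set T := -dot (c' - (ξ, 0)) (heading (φ + π)) with hT
  have hneg : ∀ k < n, side Ψ a k (ξ, 0) < 0 := fun k hk => h.side_axis_neg hk hξ0 hξ1
  have hside' : 0 = side Ψ a i (ξ, 0) - T * cos (φ + π - mid a i) := by
    rw [← side_add_smul, ← hz, hcdef', h.side_chordPoint_self]
  have hT0 : 0 < T := by
    have := hneg i hi
    by_contra hcon
    push Not at hcon
    nlinarith
  have hsnd := h.chordPoint_snd_pos hi hy0 hy1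
  refine (h.freeFlight_transit (t := T) hT0 (fun k hk => (hneg k hk).le) ?_
    (fun k hk => Or.inl (hneg k hk)) le_rfl ?_ ?_).returnsTo
      (by rw [← hz]; exact h.freePoint_chordPoint hi hy0 hy1) ?_
  · rw [← hz]; exact fun k hk => h.side_chordPoint_nonpos hi hk hy0 hy1
  · rw [← hz]; exact hsnd.le
  · rw [← hz]; exact Or.inr hsnd
  · rwa [← hz]

end IsArcPartition

end
-- Scattering by the triangles over an arc.
noncomputable section
open Real

namespace IsArcPartition

variable {Ψ : ℝ} {n : ℕ} {a : ℕ → ℝ}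

/-- This formula is the source of the reflection law: up to a positive factor the leg coordinates
are the sum, with a minus sign, and the difference of `sin θ` and `cos (θ - mid a i)`. For the angle
`π/2 + mid a i - θ` these two numbers are exchanged, and after a global sign this is the same as
changing the sign of the first leg coordinate. -/
lemma exists_heading_eq_triVec (h : IsArcPartition Ψ n a) {i : ℕ} (hi : i < n) :
    ∃ N : ℝ, 0 < N ∧ ∀ θ : ℝ, heading θ = triVec (vtx Ψ a i) (vtx Ψ a (i + 1))
      (-(N * (sin θ + cos (θ - mid a i)))) (N * (sin θ - cos (θ - mid a i))) := by
  obtain ⟨h0, h1, h2⟩ := h.hypot_eq hi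
  have hL := h.hypot_pos hi
  have hc := h.cos_mid_pos hi
  set L := hypot (vtx Ψ a i) (vtx Ψ a (i + 1)) with hLdef
  rw [← h0] at h1 h2
  refine ⟨1 / (L * cos (mid a i)), by positivity, fun θ => ?_⟩
  have e : cos θ = cos (θ - mid a i) * cos (mid a i) - sin (θ - mid a i) * sin (mid a i) := by
    rw [← cos_add]; congr 1; ring
  have e' : sin θ = sin (θ - mid a i) * cos (mid a i) + cos (θ - mid a i) * sin (mid a i) := by
    rw [← sin_add]; congr 1; ring
  ext
  · simp only [heading, triVec, h1]
    field_simp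
    ring
  · simp only [heading, triVec, h2, ← hLdef]
    field_simp
    rw [e, e']
    linear_combination (2 : ℝ) * cos (θ - mid a i) * sin_sq_add_cos_sq (mid a i)

/-- Condition `hs` selects the fraction `sin θ / cos (θ - mid a i)` of the chord when this ratio is
less than `1`, and the whole chord otherwise: the mass of the first splinter. The exit point is
recorded as well, because it decides which chord is met next. -/
lemma scatter_right (h : IsArcPartition Ψ n a) {i : ℕ} (hi : i < n) {y θ : ℝ} {w : ℝ × ℝ}
    (hy0 : 0 < y) (hy1 : y < 1) (hc : 0 < cos (θ - mid a i))
    (hs : (1 - y) * cos (θ - mid a i) < sin θ)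
    (hw : ∀ y', 0 < y' → y' < 1 → sin θ * y' = sin θ - (1 - y) * cos (θ - mid a i) →
      IsProfile.LeavesTo n (vtx Ψ a) i y' (-heading (π / 2 + mid a i - θ)) w) :
    ReturnsTo (2 * n) (canonicalLine (vtx Ψ a)) (chordPoint Ψ a i y) (heading θ) w := by
  obtain ⟨N, hN, hN'⟩ := h.exists_heading_eq_triVec hi
  have e1 : cos (π / 2 + mid a i - θ - mid a i) = sin θ := by
    rw [← cos_pi_div_two_sub]; congr 1; ring
  have e2 : sin (π / 2 + mid a i - θ) = cos (θ - mid a i) := by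
    rw [show π / 2 + mid a i - θ = π / 2 - (θ - mid a i) by ring, sin_pi_div_two_sub]
  have e3 : triVec (vtx Ψ a i) (vtx Ψ a (i + 1)) (N * (sin θ + cos (θ - mid a i)))
      (N * (sin θ - cos (θ - mid a i))) = -heading (π / 2 + mid a i - θ) := by
    rw [hN', e1, e2, ← triVec_neg]
    congr 1 <;> ring
  rw [hN' θ]
  refine h.isProfile.single_right hi ?_ hy0 hy1 ?_ ?_
  · nlinarith
  · nlinarith
  · intro y' h0 h1 he
    rw [neg_neg, e3]
    refine hw y' h0 h1 ?_
    have : N * (sin θ * y' - (sin θ - (1 - y) * cos (θ - mid a i))) = 0 := by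
      linear_combination he / 2
    linarith [(mul_eq_zero.1 this).resolve_left hN.ne']

/-- Only the case without splitting is needed for particles moving to the left; it describes the
second impact. -/
lemma scatter_left (h : IsArcPartition Ψ n a) {i : ℕ} (hi : i < n) {y θ : ℝ} {w : ℝ × ℝ}
    (hy0 : 0 < y) (hy1 : y < 1) (hc : 0 < cos (θ - mid a i))
    (hs : cos (θ - mid a i) ≤ -sin θ)
    (hw : ∀ y', 0 < y' → y' < 1 →
      IsProfile.LeavesTo n (vtx Ψ a) i y' (-heading (mid a i - π / 2 - θ)) w) :
    ReturnsTo (2 * n) (canonicalLine (vtx Ψ a)) (chordPoint Ψ a i y) (heading θ) w := by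
  obtain ⟨N, hN, hN'⟩ := h.exists_heading_eq_triVec hi
  have e1 : cos (mid a i - π / 2 - θ - mid a i) = -sin θ := by
    rw [← cos_add_pi_div_two, ← cos_neg]; congr 1; ring
  have e2 : sin (mid a i - π / 2 - θ) = -cos (θ - mid a i) := by
    rw [show mid a i - π / 2 - θ = -(θ - mid a i) - π / 2 by ring, sin_sub_pi_div_two, cos_neg]
  have e3 : triVec (vtx Ψ a i) (vtx Ψ a (i + 1)) (-(N * (sin θ + cos (θ - mid a i))))
      (-(N * (sin θ - cos (θ - mid a i)))) = -heading (mid a i - π / 2 - θ) := by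
    rw [hN', e1, e2, ← triVec_neg]
    congr 1 <;> ring
  rw [hN' θ]
  refine h.isProfile.single_left hi ?_ hy0 hy1 ?_ ?_
  · nlinarith
  · have : 0 ≤ N * (-sin θ - cos (θ - mid a i)) := mul_nonneg hN.le (by linarith)
    linarith
  · intro y' h0 h1
    rw [e3]
    exact hw y' h0 h1

lemma scatter_double (h : IsArcPartition Ψ n a) {i : ℕ} (hi : i < n) {y θ : ℝ} {w : ℝ × ℝ}
    (hy0 : 0 < y) (hy1 : y < 1) (hc : 0 < cos (θ - mid a i)) (hθ : 0 < sin θ)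
    (hs : sin θ < (1 - y) * cos (θ - mid a i)) (hne : sin θ ≠ (1 - 2 * y) * cos (θ - mid a i))
    (hw : ∀ y', 0 < y' → y' < 1 → IsProfile.LeavesTo n (vtx Ψ a) i y' (-heading θ) w) :
    ReturnsTo (2 * n) (canonicalLine (vtx Ψ a)) (chordPoint Ψ a i y) (heading θ) w := by
  obtain ⟨N, hN, hN'⟩ := h.exists_heading_eq_triVec hi
  rw [hN' θ] at hw ⊢
  refine h.isProfile.double_reflection hi ?_ hy0 hy1 ?_ ?_ ?_ ?_
  · nlinarith
  · nlinarith
  · intro he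
    have : N * (sin θ - (1 - 2 * y) * cos (θ - mid a i)) = 0 := by linear_combination -he
    exact hne (by linarith [(mul_eq_zero.1 this).resolve_left hN.ne'])
  · exact mul_neg_of_pos_of_neg hN (by linarith [mul_pos hy0 hc])
  · intro y' h0 h1
    rw [triVec_neg]
    exact hw y' h0 h1

/-- The offsets of the endpoints of the axis are `0` and `cos ψ`. The factored forms here and in
`cos_sub_offset_vtx` reduce the comparison with them to the sign of one cosine. -/
lemma offset_vtx (h : IsArcPartition Ψ n a) (ψ : ℝ) (i : ℕ) : 2 * sin Ψ * offset ψ (vtx Ψ a i) =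
    2 * sin ((a i + Ψ) / 2) * cos ((a i - Ψ) / 2 - ψ) := by
  rw [vtx, offset_arcPoint h.sin_pos.ne', sin_add_sin_eq]
  congr 3 <;> ring

lemma cos_sub_offset_vtx (h : IsArcPartition Ψ n a) (ψ : ℝ) (i : ℕ) :
    2 * sin Ψ * (cos ψ - offset ψ (vtx Ψ a i)) =
      2 * sin ((Ψ - a i) / 2) * cos ((Ψ + a i) / 2 - ψ) := by
  rw [mul_sub, vtx, offset_arcPoint h.sin_pos.ne']
  have h1 := sin_add_sin_eq (Ψ - ψ) (-(a i - ψ))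
  have h2 := sin_add Ψ ψ
  have h3 := sin_sub Ψ ψ
  rw [sin_neg] at h1
  rw [show (Ψ - ψ + -(a i - ψ)) / 2 = (Ψ - a i) / 2 by ring,
    show (Ψ - ψ - -(a i - ψ)) / 2 = (Ψ + a i) / 2 - ψ by ring] at h1
  linarith

lemma offset_sub (h : IsArcPartition Ψ n a) {i : ℕ} (hi : i < n) (ψ : ℝ) :
    offset ψ (vtx Ψ a (i + 1)) - offset ψ (vtx Ψ a i) =
      sin ((a (i + 1) - a i) / 2) / sin Ψ * cos (ψ - mid a i) := by
  obtain ⟨-, h1, h2⟩ := h.hypot_eq hi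
  simp only [offset, cos_sub]
  linear_combination cos ψ * h1 - sin ψ * h2

lemma offset_lt (h : IsArcPartition Ψ n a) {i : ℕ} (hi : i < n) {ψ : ℝ}
    (hc : 0 < cos (ψ - mid a i)) : offset ψ (vtx Ψ a i) < offset ψ (vtx Ψ a (i + 1)) := by
  have h1 := h.offset_sub hi ψ
  have h2 := (h.hypot_eq hi).1 ▸ h.hypot_pos hi
  have := mul_pos h2 hc
  linarith

lemma offset_chordPoint (i : ℕ) (y ψ : ℝ) : offset ψ (chordPoint Ψ a i y) =
    (1 - y) * offset ψ (vtx Ψ a i) + y * offset ψ (vtx Ψ a (i + 1)) := by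
  rw [chordPoint_eq, offset_comb]

lemma offset_vtx_nonneg (h : IsArcPartition Ψ n a) {i : ℕ} (hi : i ≤ n) {ψ : ℝ}
    (hc : 0 ≤ cos ((a i - Ψ) / 2 - ψ)) : 0 ≤ offset ψ (vtx Ψ a i) := by
  have h1 := h.offset_vtx ψ i
  have h2 : 0 ≤ sin ((a i + Ψ) / 2) := sin_nonneg_of_nonneg_of_le_pi
    (by linarith [h.neg_le hi]) (by linarith [h.le_self hi, h.le, pi_pos])
  have h3 := h.sin_pos
  have : 0 ≤ 2 * sin Ψ * offset ψ (vtx Ψ a i) := by rw [h1]; positivity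
  exact nonneg_of_mul_nonneg_right this (by positivity)

lemma offset_vtx_nonpos (h : IsArcPartition Ψ n a) {i : ℕ} (hi : i ≤ n) {ψ : ℝ}
    (hc : cos ((a i - Ψ) / 2 - ψ) ≤ 0) : offset ψ (vtx Ψ a i) ≤ 0 := by
  have h1 := h.offset_vtx ψ i
  have h2 : 0 ≤ sin ((a i + Ψ) / 2) := sin_nonneg_of_nonneg_of_le_pi
    (by linarith [h.neg_le hi]) (by linarith [h.le_self hi, h.le, pi_pos])
  have h3 := h.sin_pos
  have : 2 * sin Ψ * offset ψ (vtx Ψ a i) ≤ 0 := by rw [h1]; nlinarith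
  by_contra hcon
  push Not at hcon
  have : 0 < 2 * sin Ψ * offset ψ (vtx Ψ a i) := by positivity
  linarith

lemma offset_vtx_le (h : IsArcPartition Ψ n a) {i : ℕ} (hi : i ≤ n) {ψ : ℝ}
    (hc : 0 ≤ cos ((Ψ + a i) / 2 - ψ)) : offset ψ (vtx Ψ a i) ≤ cos ψ := by
  have h1 := h.cos_sub_offset_vtx ψ i
  have h2 : 0 ≤ sin ((Ψ - a i) / 2) := sin_nonneg_of_nonneg_of_le_pi
    (by linarith [h.le_self hi]) (by linarith [h.neg_le hi, h.le, pi_pos])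
  have h3 := h.sin_pos
  have : 0 ≤ 2 * sin Ψ * (cos ψ - offset ψ (vtx Ψ a i)) := by rw [h1]; positivity
  linarith [nonneg_of_mul_nonneg_right this (by positivity)]

/-- The offset increases along the chord, so it is enough to test the lower bound at its left end
and the upper bound at its right end. -/
lemma leaves (h : IsArcPartition Ψ n a) {i : ℕ} (hi : i < n) {y ψ : ℝ} (hy0 : 0 < y)
    (hy1 : y < 1) (hc : 0 < cos (ψ - mid a i)) (h0 : 0 ≤ cos ((a i - Ψ) / 2 - ψ))
    (h1 : 0 ≤ cos ((Ψ + a (i + 1)) / 2 - ψ)) :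
    IsProfile.LeavesTo n (vtx Ψ a) i y (-heading ψ) (-heading ψ) := by
  have e0 := h.offset_vtx_nonneg hi.le h0
  have e1 := h.offset_vtx_le (i := i + 1) hi h1
  have e2 := h.offset_lt hi hc
  refine h.leaves_axis hi hy0 hy1 hc ?_ ?_ <;> rw [offset_chordPoint] <;> nlinarith

/-- The line with heading `φ` through `(0, 0)` meets the circle again at the parameter `2 * φ - π +
Ψ`. Hypothesis `hvis` places the small arc to the right of that point, so that it is visible from
the axis. -/
lemma cos_sub_mid_pos (h : IsArcPartition Ψ n a) {i : ℕ} (hi : i < n) {φ : ℝ} (hφ0 : 0 < φ)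
    (hvis : 2 * φ - π + Ψ ≤ a i) : 0 < cos (φ - mid a i) := by
  have h1 := h.mid_mem hi
  have h2 := h.neg_le hi.le
  have h3 := h.mid_lt hi
  have h4 := h.le
  exact cos_pos_of_mem_Ioo ⟨by linarith, by linarith⟩

/-- The particles reflected from both legs of a visible triangle. -/
lemma returns_double (h : IsArcPartition Ψ n a) {i : ℕ} (hi : i < n) {φ y : ℝ} (hφ0 : 0 < φ)
    (hφ1 : φ < π / 2) (hvis : 2 * φ - π + Ψ ≤ a i) (hy0 : 0 < y) (hy1 : y < 1)
    (hs : sin φ < (1 - y) * cos (φ - mid a i)) (hne : sin φ ≠ (1 - 2 * y) * cos (φ - mid a i)) :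
    ReturnsTo (2 * n) (canonicalLine (vtx Ψ a)) (chordPoint Ψ a i y) (heading φ)
      (-heading φ) := by
  have hc := h.cos_sub_mid_pos hi hφ0 hvis
  have h1 := h.neg_le hi.le
  have h2 := h.le_self hi.le
  have h3 := h.neg_le (i := i + 1) hi
  have h4 := h.le_self (i := i + 1) hi
  have h5 := h.le
  refine h.scatter_double hi hy0 hy1 hc (sin_pos_of_pos_of_lt_pi hφ0 (by linarith)) hs hne
    fun y' h0' h1' => h.leaves hi h0' h1' hc ?_ ?_ <;>
  exact cos_nonneg_of_mem_Icc ⟨by linarith, by linarith⟩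

/-- The particles reflected once that return to the axis immediately. -/
lemma returns_single (h : IsArcPartition Ψ n a) {i : ℕ} (hi : i < n) {φ y : ℝ} (hφ0 : 0 < φ)
    (hφ1 : φ < π / 2) (hvis : 2 * φ - π + Ψ ≤ a i) (hy0 : 0 < y) (hy1 : y < 1)
    (hs : (1 - y) * cos (φ - mid a i) < sin φ) (hd : a (i + 1) + Ψ ≤ 2 * φ) :
    ReturnsTo (2 * n) (canonicalLine (vtx Ψ a)) (chordPoint Ψ a i y) (heading φ)
      (-heading (π / 2 + mid a i - φ)) := by
  have hc := h.cos_sub_mid_pos hi hφ0 hvis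
  have h1 := h.neg_le hi.le
  have h2 := h.le_self hi.le
  have h3 := h.neg_le (i := i + 1) hi
  have h4 := h.le_self (i := i + 1) hi
  have h5 := h.le
  refine h.scatter_right hi hy0 hy1 hc hs fun y' h0' h1' _ => h.leaves hi h0' h1' ?_ ?_ ?_
  · rw [show π / 2 + mid a i - φ - mid a i = π / 2 - φ by ring, cos_pi_div_two_sub]
    exact sin_pos_of_pos_of_lt_pi hφ0 (by linarith)
  · refine cos_nonneg_of_mem_Icc ⟨?_, ?_⟩ <;> unfold mid <;> linarith
  · refine cos_nonneg_of_mem_Icc ⟨?_, ?_⟩ <;> unfold mid <;> linarith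

/-- A discrete intermediate value argument. Applied to the offsets of the vertices it finds a chord
crossed by a given line. -/
lemma exists_last_above {f : ℕ → ℝ} {κ : ℝ} {i : ℕ} (h0 : κ < f 0) (hi : f i < κ)
    (hne : ∀ k ≤ i, κ ≠ f k) : ∃ j < i, κ < f j ∧ f (j + 1) < κ := by
  by_contra hcon
  push Not at hcon
  have : ∀ k ≤ i, κ < f k := by
    intro k
    induction k with
    | zero => exact fun _ => h0
    | succ k ih =>
      intro hk
      exact lt_of_le_of_ne (hcon k (by omega) (ih (by omega))) (hne (k + 1) hk)
  exact absurd (this i le_rfl) (not_lt.2 hi.le)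

/-- The line with heading `ψ` through the point `β` of the circle meets the circle again at `2 * ψ -
π - β`. The product shows on which side of this line the point `α` lies. -/
lemma sin_sub_sin_reflected (α β ψ : ℝ) : sin (α - ψ) - sin (β - ψ) =
    2 * sin ((α - (2 * ψ - π - β)) / 2) * sin ((α - β) / 2) := by
  have := sin_add_sin_eq (α - ψ) (-(β - ψ))
  rw [sin_neg, show (α - ψ + -(β - ψ)) / 2 = (α - β) / 2 by ring,
    show (α - ψ - -(β - ψ)) / 2 = (α - (2 * ψ - π - β)) / 2 - π / 2 by ring,
    cos_sub_pi_div_two] at this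
  linarith

/-- A particle reflected from the triangle `i` to the right of the origin of its path meets the
chord `j` coming from the right, close to the point `2 φ` to the left of the triangle `i`. -/
lemma exists_second_chord (h : IsArcPartition Ψ n a) {i : ℕ} (hi : i < n) {φ y : ℝ}
    (hφ0 : 0 < φ) (hφ1 : φ < π / 2) (hy0 : 0 < y) (hy1 : y < 1) (hd : 2 * φ ≤ a i + Ψ)
    (hgen : ∀ k ≤ n, offset (π / 2 + mid a i - φ) (chordPoint Ψ a i y) ≠
      offset (π / 2 + mid a i - φ) (vtx Ψ a k)) :
    ∃ j < n, j < i ∧ ∃ z, 0 < z ∧ z < 1 ∧ offset (π / 2 + mid a i - φ) (chordPoint Ψ a i y) =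
      offset (π / 2 + mid a i - φ) (chordPoint Ψ a j z) ∧ ∃ α ∈ Set.Ioo (a i) (a (i + 1)),
      2 * mid a i - 2 * φ - α ∈ Set.Ioo (a j) (a (j + 1)) := by
  set ψ := π / 2 + mid a i - φ with hψ
  set κ := offset ψ (chordPoint Ψ a i y) with hκ
  have h1 := h.neg_le hi.le
  have h2 := h.le_self hi.le
  have h3 := h.neg_le (i := i + 1) hi
  have h4 := h.le_self (i := i + 1) hi
  have h5 := h.le
  have hmid : 2 * mid a i = a i + a (i + 1) := by unfold mid; ring
  have hs := h.sin_pos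
  have hci : 0 < cos (ψ - mid a i) := by
    rw [hψ, show π / 2 + mid a i - φ - mid a i = π / 2 - φ by ring, cos_pi_div_two_sub]
    exact sin_pos_of_pos_of_lt_pi hφ0 (by linarith)
  have hlt := h.offset_lt hi hci
  have hκ1 : offset ψ (vtx Ψ a i) < κ := by
    rw [hκ, offset_chordPoint]; linarith [mul_pos hy0 (sub_pos.2 hlt)]
  have hκ2 : κ < offset ψ (vtx Ψ a (i + 1)) := by
    rw [hκ, offset_chordPoint]; linarith [mul_pos (sub_pos.2 hy1) (sub_pos.2 hlt)]
  have hκ3 : offset ψ (vtx Ψ a (i + 1)) ≤ 0 := by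
    refine h.offset_vtx_nonpos (i := i + 1) hi ?_
    rw [← cos_neg]
    refine cos_nonpos_of_pi_div_two_le_of_le ?_ ?_ <;> linarith
  have hκ0 : κ < offset ψ (vtx Ψ a 0) := by
    rw [h.vtx_zero]; simp only [offset, zero_mul, sub_zero]; linarith
  obtain ⟨j, hji, hj1, hj2⟩ := exists_last_above (f := fun k => offset ψ (vtx Ψ a k)) hκ0 hκ1
    fun k hk => hgen k (by omega)
  have hj : j < n := by omega
  have hoff : ∀ k, 2 * sin Ψ * offset ψ (vtx Ψ a k) = sin (a k - ψ) + sin (Ψ + ψ) :=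
    fun k => offset_arcPoint hs.ne' ψ (a k)
  have hrange : 2 * sin Ψ * κ - sin (Ψ + ψ) ∈
      Set.Ioo (sin (a i - ψ)) (sin (a (i + 1) - ψ)) := by
    have e1 := hoff i
    have e2 := hoff (i + 1)
    have e3 := mul_pos (mul_pos two_pos hs) (sub_pos.2 hκ1)
    have e4 := mul_pos (mul_pos two_pos hs) (sub_pos.2 hκ2)
    constructor <;> linarith
  -- The outgoing line, extended backwards through the chord, meets the small arc `i` at `αe`; its
  -- other point on the circle is `α'`.
  obtain ⟨αe, ⟨hαe1, hαe2⟩, hαe⟩ := intermediate_value_Ioo (h.part.2.2 i hi).le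
    (f := fun α => sin (α - ψ)) (by fun_prop) hrange
  simp only at hαe
  obtain ⟨α', hα'⟩ : ∃ α', α' = 2 * ψ - π - αe := ⟨_, rfl⟩
  have hα'2 : α' + αe = 2 * mid a i - 2 * φ := by rw [hα', hψ]; ring
  -- For vertices up to the index `i` the second sine is nonpositive. The sign change of the offsets
  -- between `j` and `j + 1` therefore traps `α'` in the small arc `j`.
  have hid : ∀ k, 2 * sin Ψ * (offset ψ (vtx Ψ a k) - κ) =
      2 * sin ((a k - α') / 2) * sin ((a k - αe) / 2) := by
    intro k
    have e1 := hoff k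
    rw [hα', ← sin_sub_sin_reflected, hαe]
    linarith
  have hmono := h.monotone (i := j + 1) (j := i) hji hi.le
  have hjj := h.part.2.2 j hj
  have e1 := h.neg_le hj.le
  have hA1 : α' < a (j + 1) := by
    by_contra hcon
    push Not at hcon
    have s1 : sin ((a (j + 1) - α') / 2) ≤ 0 :=
      sin_nonpos_of_nonpos_of_neg_pi_le (by linarith) (by linarith)
    have s2 : sin ((a (j + 1) - αe) / 2) ≤ 0 :=
      sin_nonpos_of_nonpos_of_neg_pi_le (by linarith) (by linarith)
    have s3 : 2 * sin Ψ * (offset ψ (vtx Ψ a (j + 1)) - κ) < 0 :=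
      mul_neg_of_pos_of_neg (by linarith) (sub_neg.2 hj2)
    rw [hid] at s3
    linarith [mul_nonneg_of_nonpos_of_nonpos s1 s2]
  have hA2 : a j < α' := by
    by_contra hcon
    push Not at hcon
    have s1 : 0 ≤ sin ((a j - α') / 2) :=
      sin_nonneg_of_nonneg_of_le_pi (by linarith) (by linarith)
    have s2 : sin ((a j - αe) / 2) ≤ 0 :=
      sin_nonpos_of_nonpos_of_neg_pi_le (by linarith) (by linarith)
    have s3 : 0 < 2 * sin Ψ * (offset ψ (vtx Ψ a j) - κ) :=
      mul_pos (by linarith) (sub_pos.2 hj1)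
    rw [hid] at s3
    linarith [mul_nonpos_of_nonneg_of_nonpos s1 s2]
  have hD : 0 < offset ψ (vtx Ψ a j) - offset ψ (vtx Ψ a (j + 1)) :=
    sub_pos.2 (lt_trans hj2 hj1)
  refine ⟨j, hj, hji, (offset ψ (vtx Ψ a j) - κ) /
    (offset ψ (vtx Ψ a j) - offset ψ (vtx Ψ a (j + 1))), div_pos (sub_pos.2 hj1) hD, ?_, ?_,
    αe, ⟨hαe1, hαe2⟩, ?_⟩
  · rw [div_lt_one hD]
    linarith [hj2]
  · rw [offset_chordPoint]
    field_simp
    ring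
  · rw [← hα'2, add_sub_cancel_right]
    exact ⟨hA2, hA1⟩

/-- As `mid a j` is close to `mid a i - 2 * φ`, the exit angle is close to `-φ`. The margins `η` at
`±π/2` absorb the error in the position of the second chord; for fixed `Ψ < π / 2` and small `η`
they hold automatically. -/
lemma returns_from_second_chord (h : IsArcPartition Ψ n a) {i j : ℕ} (hi : i < n) (hj : j < n)
    {φ z η α : ℝ} (hφ0 : 0 < φ) (hvis : 2 * φ - π + Ψ ≤ a i) (hz0 : 0 < z) (hz1 : z < 1)
    (hη : ∀ k < n, a (k + 1) - a k ≤ η) (hlo : -(π / 2) + η ≤ a i)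
    (hhi : a (i + 1) ≤ π / 2 - η) (hα : α ∈ Set.Ioo (a i) (a (i + 1)))
    (hα' : 2 * mid a i - 2 * φ - α ∈ Set.Ioo (a j) (a (j + 1)))
    (hcj : cos (π / 2 + mid a i - φ - mid a j) < 0) :
    ReturnsTo (2 * n) (canonicalLine (vtx Ψ a)) (chordPoint Ψ a j z)
      (-heading (π / 2 + mid a i - φ)) (-heading (mid a j - mid a i + φ)) := by
  set ψ := π / 2 + mid a i - φ with hψ
  have hcφ := h.cos_sub_mid_pos hi hφ0 hvis
  obtain ⟨a1, a2⟩ := hα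
  obtain ⟨a3, a4⟩ := hα'
  have h5 := h.le
  have h0 := h.pos
  have hηj := hη j hj
  have hmidj : 2 * mid a j = a j + a (j + 1) := by unfold mid; ring
  have hmj := h.neg_lt_mid hj
  have hmj' := h.mid_lt hj
  have hθ : -heading ψ = heading (ψ - π) := by
    have := neg_heading_eq (ψ - π)
    rw [sub_add_cancel] at this
    rw [this, neg_neg]
  have hψ' : mid a j - mid a i + φ = mid a j - π / 2 - (ψ - π) := by rw [hψ]; ring
  rw [hθ, hψ']
  have hcθ : cos (ψ - π - mid a j) = -cos (ψ - mid a j) := by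
    rw [show ψ - π - mid a j = ψ - mid a j - π by ring, cos_sub_pi]
  refine h.scatter_left hj hz0 hz1 (by rw [hcθ]; linarith) ?_ fun y' h0' h1' =>
    h.leaves hj h0' h1' ?_ ?_ ?_
  -- No splitting at the second impact: in the limit the claim is `sin φ ≤ cos (mid a i - φ)`, and a
  -- product formula shows that it survives the displacement of the chord `j`.
  · rw [sin_sub_pi, neg_neg, hcθ]
    have e2 : cos (ψ - mid a j) = -sin (mid a i - φ - mid a j) := by
      rw [← cos_add_pi_div_two, hψ]; congr 1; ring
    have e3 : sin ψ = cos (mid a i - φ) := by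
      rw [hψ, show π / 2 + mid a i - φ = mid a i - φ + π / 2 by ring, sin_add_pi_div_two]
    have e4 := cos_sub_cos (mid a i - φ) (π / 2 - (mid a i - φ - mid a j))
    rw [cos_pi_div_two_sub] at e4
    have e5 : 0 ≤ sin ((mid a i - φ + (π / 2 - (mid a i - φ - mid a j))) / 2) :=
      sin_nonneg_of_nonneg_of_le_pi (by linarith) (by linarith)
    have e6 : sin ((mid a i - φ - (π / 2 - (mid a i - φ - mid a j))) / 2) ≤ 0 :=
      sin_nonpos_of_nonpos_of_neg_pi_le (by linarith) (by linarith)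
    rw [e2, e3]
    linarith [mul_nonpos_of_nonneg_of_nonpos e5 e6]
  · rw [← hψ', show mid a j - mid a i + φ - mid a j = φ - mid a i by ring]
    exact hcφ
  · rw [← hψ']
    exact cos_nonneg_of_mem_Icc ⟨by linarith, by linarith⟩
  · rw [← hψ']
    exact cos_nonneg_of_mem_Icc ⟨by linarith, by linarith⟩

/-- A particle that leaves a triangle and meets another one to the left of it. -/
lemma leaves_second (h : IsArcPartition Ψ n a) {i : ℕ} (hi : i < n) {φ y η : ℝ}
    (hφ0 : 0 < φ) (hφ1 : φ < π / 2) (hvis : 2 * φ - π + Ψ ≤ a i) (hy0 : 0 < y) (hy1 : y < 1)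
    (hd : 2 * φ ≤ a i + Ψ) (hη : ∀ k < n, a (k + 1) - a k ≤ η)
    (hlo : -(π / 2) + η ≤ a i) (hhi : a (i + 1) ≤ π / 2 - η)
    (hgen : ∀ k ≤ n, offset (π / 2 + mid a i - φ) (chordPoint Ψ a i y) ≠
      offset (π / 2 + mid a i - φ) (vtx Ψ a k)) :
    ∃ j < n, |mid a i - mid a j - 2 * φ| ≤ η ∧ IsProfile.LeavesTo n (vtx Ψ a) i y
      (-heading (π / 2 + mid a i - φ)) (-heading (mid a j - mid a i + φ)) := by
  obtain ⟨j, hj, hji, z, hz0, hz1, hoff, α, hα, hα'⟩ :=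
    h.exists_second_chord hi hφ0 hφ1 hy0 hy1 hd hgen
  have hci : 0 < cos (π / 2 + mid a i - φ - mid a i) := by
    rw [show π / 2 + mid a i - φ - mid a i = π / 2 - φ by ring, cos_pi_div_two_sub]
    exact sin_pos_of_pos_of_lt_pi hφ0 (by linarith)
  refine ⟨j, hj, ?_, h.leaves_chord hi hj hji.ne' hy0 hy1 hz0 hz1 hci hoff fun hcj =>
    h.returns_from_second_chord hi hj hφ0 hvis hz0 hz1 hη hlo hhi hα hα' hcj⟩
  have hηi := hη i hi
  have hηj := hη j hj
  have hmid : 2 * mid a i = a i + a (i + 1) := by unfold mid; ring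
  have hmidj : 2 * mid a j = a j + a (j + 1) := by unfold mid; ring
  obtain ⟨a1, a2⟩ := hα
  obtain ⟨a3, a4⟩ := hα'
  exact abs_le.2 ⟨by linarith, by linarith⟩

end IsArcPartition

end
-- The deficit and its limiting density on the arc.
noncomputable section
open Real MeasureTheory

/-- How much the backward deflection fails to be complete. -/
def deficit (m : ℕ) (x : ℕ → ℝ × ℝ) (φ ξ : ℝ) : ℝ := 1 - cos (exitAngle m x φ ξ - φ)

lemma deficit_nonneg (m : ℕ) (x : ℕ → ℝ × ℝ) (φ ξ : ℝ) : 0 ≤ deficit m x φ ξ :=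
  sub_nonneg.2 (cos_le_one _)

lemma deficit_le_two (m : ℕ) (x : ℕ → ℝ × ℝ) (φ ξ : ℝ) : deficit m x φ ξ ≤ 2 := by
  unfold deficit
  linarith [neg_one_le_cos (exitAngle m x φ ξ - φ)]

lemma IsProfile.measurable_deficit {n : ℕ} {p : ℕ → ℝ × ℝ} (hp : IsProfile n p) :
    Measurable fun z : ℝ × ℝ => deficit (2 * n) (canonicalLine p) z.1 z.2 := by
  have := measurable_exitAngle hp.line_fst_lt hp.line_snd_pos
  unfold deficit
  fun_prop

lemma IsProfile.deficit_eq {n : ℕ} {p : ℕ → ℝ × ℝ} (hp : IsProfile n p) {φ ξ ψ : ℝ}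
    (h : ReturnsTo (2 * n) (canonicalLine p) (ξ, 0) (heading φ) (-heading ψ)) :
    deficit (2 * n) (canonicalLine p) φ ξ = 1 - cos (ψ - φ) := by
  rw [deficit, cos_exitAngle_sub hp.line_fst_lt hp.line_snd_pos h]

lemma intervalIntegrable_of_measurable_of_abs_le {f : ℝ → ℝ} (hf : Measurable f) {C : ℝ}
    (hC : ∀ x, |f x| ≤ C) (a b : ℝ) : IntervalIntegrable f volume a b := by
  rw [intervalIntegrable_iff]
  exact Measure.integrableOn_of_bounded (M := C) (by simp) hf.aestronglyMeasurable
    (Filter.Eventually.of_forall fun x => by rw [norm_eq_abs]; exact hC x)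

lemma IsProfile.intervalIntegrable_deficit {n : ℕ} {p : ℕ → ℝ × ℝ} (hp : IsProfile n p)
    (φ a b : ℝ) : IntervalIntegrable (deficit (2 * n) (canonicalLine p) φ) volume a b := by
  have hm := hp.measurable_deficit.comp (measurable_prodMk_left (x := φ))
  exact intervalIntegrable_of_measurable_of_abs_le (C := 2) hm (fun x => by
    simp only [Function.comp]
    rw [abs_of_nonneg (deficit_nonneg _ _ _ _)]; exact deficit_le_two _ _ _ _) a b

/-- If, outside a finite set, `f` vanishes at a distance more than `K` from the right endpoint, and
is close to `d` at a distance less than `K`, then its integral is known. -/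
lemma abs_integral_sub_min_mul_le {f : ℝ → ℝ} {l r K d η : ℝ} {E : Set ℝ} (hlr : l ≤ r)
    (hK : 0 ≤ K) (hE : E.Countable) (hf : ∀ a b, IntervalIntegrable f volume a b)
    (h0 : ∀ ξ ∈ Set.Ioo l r, ξ ∉ E → K < r - ξ → f ξ = 0)
    (h1 : ∀ ξ ∈ Set.Ioo l r, ξ ∉ E → r - ξ < K → |f ξ - d| ≤ η) :
    |(∫ ξ in l..r, f ξ) - min (r - l) K * d| ≤ min (r - l) K * η := by
  -- The switch between the two regimes, clipped to the interval in case all points are in the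
  -- second one.
  obtain ⟨c, hc⟩ : ∃ c, c = max l (r - K) := ⟨_, rfl⟩
  have hlc : l ≤ c := hc ▸ le_max_left _ _
  have hcr : c ≤ r := hc ▸ max_le hlr (by linarith)
  have hm : min (r - l) K = r - c := by
    rw [hc, ← min_sub_sub_left, sub_sub_cancel]
  have hae : ∀ᵐ ξ : ℝ, ξ ∉ E ∪ {r} := by
    have : volume (E ∪ {r}) = 0 := (hE.union (Set.countable_singleton r)).measure_zero _
    exact measure_eq_zero_iff_ae_notMem.1 this
  have hae' : ∀ᵐ ξ : ℝ, ξ ≠ c := by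
    simpa using measure_eq_zero_iff_ae_notMem.1 (measure_singleton (μ := volume) c)
  have e1 : ∫ ξ in l..c, f ξ = 0 := by
    refine intervalIntegral.integral_zero_ae ?_
    filter_upwards [hae, hae'] with ξ hξ hξc hmem
    rw [Set.uIoc_of_le hlc] at hmem
    simp only [Set.mem_union, Set.mem_singleton_iff, not_or] at hξ
    have hlt : ξ < c := lt_of_le_of_ne hmem.2 hξc
    refine h0 ξ ⟨hmem.1, by linarith⟩ hξ.1 ?_
    rw [hc] at hlt
    rcases lt_max_iff.1 hlt with h | h
    · linarith [hmem.1]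
    · linarith
  have e2 : |∫ ξ in c..r, (f ξ - d)| ≤ η * |r - c| := by
    rw [← norm_eq_abs]
    refine intervalIntegral.norm_integral_le_of_norm_le_const_ae ?_
    filter_upwards [hae] with ξ hξ hmem
    rw [Set.uIoc_of_le hcr] at hmem
    simp only [Set.mem_union, Set.mem_singleton_iff, not_or] at hξ
    rw [norm_eq_abs]
    have h2 : r - K ≤ c := hc ▸ le_max_right _ _
    refine h1 ξ ⟨by linarith [hmem.1], lt_of_le_of_ne hmem.2 hξ.2⟩ hξ.1 ?_
    linarith [hmem.1]
  rw [intervalIntegral.integral_sub (hf _ _) intervalIntegrable_const,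
    intervalIntegral.integral_const, smul_eq_mul, abs_of_nonneg (sub_nonneg.2 hcr)] at e2
  rw [hm, ← intervalIntegral.integral_add_adjacent_intervals (hf l c) (hf c r), e1, zero_add]
  linarith

/-- The density, with respect to the angular parameter on the arc, of the deficit of the
pseudo-billiard. -/
def limitDensity (Ψ φ α : ℝ) : ℝ :=
  if α ≤ 2 * φ - π + Ψ then 0 else
    min (sin φ) (cos (φ - α)) * (if 2 * φ < α + Ψ then 1 - cos (2 * φ) else 1 + sin (α - 2 * φ))

lemma abs_min_sin_cos_le (x y : ℝ) : |min (sin x) (cos y)| ≤ 1 :=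
  abs_le.2 ⟨le_min (neg_one_le_sin _) (neg_one_le_cos _), (min_le_left _ _).trans (sin_le_one _)⟩

lemma abs_limitDensity_le (Ψ φ α : ℝ) : |limitDensity Ψ φ α| ≤ 2 := by
  unfold limitDensity
  split_ifs
  · simp
  · rw [abs_mul]
    have h1 := abs_min_sin_cos_le φ (φ - α)
    have h2 : |1 - cos (2 * φ)| ≤ 2 :=
      abs_le.2 ⟨by linarith [cos_le_one (2 * φ)], by linarith [neg_one_le_cos (2 * φ)]⟩
    nlinarith [abs_nonneg (min (sin φ) (cos (φ - α))), abs_nonneg (1 - cos (2 * φ))]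
  · rw [abs_mul]
    have h1 := abs_min_sin_cos_le φ (φ - α)
    have h2 : |1 + sin (α - 2 * φ)| ≤ 2 :=
      abs_le.2 ⟨by linarith [neg_one_le_sin (α - 2 * φ)], by linarith [sin_le_one (α - 2 * φ)]⟩
    nlinarith [abs_nonneg (min (sin φ) (cos (φ - α))), abs_nonneg (1 + sin (α - 2 * φ))]

lemma measurable_limitDensity (Ψ : ℝ) :
    Measurable fun z : ℝ × ℝ => limitDensity Ψ z.1 z.2 := by
  unfold limitDensity
  refine Measurable.ite (measurableSet_le (by fun_prop) (by fun_prop)) measurable_const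
    (Measurable.mul (Measurable.min (by fun_prop) (by fun_prop)) (Measurable.ite
      (measurableSet_lt (by fun_prop) (by fun_prop)) (by fun_prop) (by fun_prop)))

lemma intervalIntegrable_limitDensity (Ψ φ a b : ℝ) :
    IntervalIntegrable (limitDensity Ψ φ) volume a b :=
  intervalIntegrable_of_measurable_of_abs_le
    ((measurable_limitDensity Ψ).comp (measurable_prodMk_left (x := φ)))
    (abs_limitDensity_le Ψ φ) a b

namespace IsArcPartition

variable {Ψ : ℝ} {n : ℕ} {a : ℕ → ℝ}

/-- The starting point on the line of the axis of the ray with heading `φ` through the division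
point `i`. -/
def foot (Ψ : ℝ) (a : ℕ → ℝ) (φ : ℝ) (i : ℕ) : ℝ := offset φ (vtx Ψ a i) / cos φ

lemma foot_sub (h : IsArcPartition Ψ n a) {i : ℕ} (hi : i < n) (φ : ℝ) :
    foot Ψ a φ (i + 1) - foot Ψ a φ i =
      sin ((a (i + 1) - a i) / 2) / sin Ψ * cos (φ - mid a i) / cos φ := by
  rw [foot, foot, ← sub_div, h.offset_sub hi]

lemma foot_zero (h : IsArcPartition Ψ n a) (φ : ℝ) : foot Ψ a φ 0 = 0 := by
  simp [foot, h.vtx_zero, offset]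

lemma foot_last (h : IsArcPartition Ψ n a) {φ : ℝ} (hφ : cos φ ≠ 0) : foot Ψ a φ n = 1 := by
  simp [foot, h.vtx_last, offset, hφ]

lemma sin_half_pos (h : IsArcPartition Ψ n a) {i : ℕ} (hi : i < n) :
    0 < sin ((a (i + 1) - a i) / 2) := by
  have := h.hypot_pos hi
  rw [(h.hypot_eq hi).1] at this
  exact (div_pos_iff_of_pos_right h.sin_pos).1 this

/-- The particles that meet a visible chord. -/
lemma exists_chordPoint (h : IsArcPartition Ψ n a) {i : ℕ} (hi : i < n) {φ ξ : ℝ}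
    (hφ0 : 0 < φ) (hφ1 : φ < π / 2) (hvis : 2 * φ - π + Ψ ≤ a i)
    (hξ : ξ ∈ Set.Ioo (foot Ψ a φ i) (foot Ψ a φ (i + 1))) :
    ∃ y, 0 < y ∧ y < 1 ∧
      sin ((a (i + 1) - a i) / 2) / sin Ψ * ((1 - y) * cos (φ - mid a i)) / cos φ =
        foot Ψ a φ (i + 1) - ξ ∧
      ∀ w, ReturnsTo (2 * n) (canonicalLine (vtx Ψ a)) (chordPoint Ψ a i y) (heading φ) w →
        ReturnsTo (2 * n) (canonicalLine (vtx Ψ a)) (ξ, 0) (heading φ) w := by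
  have hcφ : 0 < cos φ := cos_pos_of_mem_Ioo ⟨by linarith, hφ1⟩
  have hc := h.cos_sub_mid_pos hi hφ0 hvis
  have hsub := h.foot_sub hi φ
  have h1 := h.neg_le hi.le
  have h2 := h.le_self hi.le
  have h3 := h.neg_le (i := i + 1) hi
  have h4 := h.le_self (i := i + 1) hi
  have h5 := h.le
  have hf0 : 0 ≤ foot Ψ a φ i := div_nonneg (h.offset_vtx_nonneg hi.le
    (cos_nonneg_of_mem_Icc ⟨by linarith, by linarith⟩)) hcφ.le
  have hf1 : foot Ψ a φ (i + 1) ≤ 1 := by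
    rw [foot, div_le_one hcφ]
    exact h.offset_vtx_le (i := i + 1) hi (cos_nonneg_of_mem_Icc ⟨by linarith, by linarith⟩)
  have hw : 0 < foot Ψ a φ (i + 1) - foot Ψ a φ i := by linarith [hξ.1, hξ.2]
  obtain ⟨y, hy⟩ : ∃ y, y * (foot Ψ a φ (i + 1) - foot Ψ a φ i) = ξ - foot Ψ a φ i :=
    ⟨_, div_mul_cancel₀ _ hw.ne'⟩
  have hy0 : 0 < y := by
    by_contra hcon
    push Not at hcon
    nlinarith [hξ.1]
  have hy1 : y < 1 := by
    by_contra hcon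
    push Not at hcon
    nlinarith [hξ.2]
  refine ⟨y, hy0, hy1, ?_, fun w hw' => h.returnsTo_of_chord hi hy0 hy1 ?_ ?_ hc ?_ hw'⟩
  · linear_combination (-(1 - y)) * hsub - hy
  · linarith [hξ.1]
  · linarith [hξ.2]
  · have e1 : foot Ψ a φ (i + 1) * cos φ = offset φ (vtx Ψ a (i + 1)) := div_mul_cancel₀ _ hcφ.ne'
    have e2 : foot Ψ a φ i * cos φ = offset φ (vtx Ψ a i) := div_mul_cancel₀ _ hcφ.ne'
    rw [offset_chordPoint, ← e1, ← e2]
    linear_combination -cos φ * hy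

end IsArcPartition

end
-- The deficit collected by one visible chord.
noncomputable section
open Real MeasureTheory

lemma countable_affine_eq (c r d : ℝ) {m : ℝ} (hm : m ≠ 0) :
    {ξ : ℝ | c - (r - ξ) * m = d}.Countable := by
  apply Set.Subsingleton.countable
  intro ξ hξ ξ' hξ'
  simp only [Set.mem_ofPred_eq] at hξ hξ'
  have : m * (ξ - ξ') = 0 := by linear_combination hξ - hξ'
  linarith [(mul_eq_zero.1 this).resolve_left hm]

namespace IsArcPartition

variable {Ψ : ℝ} {n : ℕ} {a : ℕ → ℝ}

/-- The deficit of the particles that meet a visible chord. -/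
lemma abs_integral_deficit_sub_le (h : IsArcPartition Ψ n a) {i : ℕ} (hi : i < n) {φ η d : ℝ}
    (hφ0 : 0 < φ) (hφ1 : φ < π / 2) (hvis : 2 * φ - π + Ψ ≤ a i)
    (hη : ∀ k < n, a (k + 1) - a k ≤ η)
    (hd : (a (i + 1) + Ψ ≤ 2 * φ ∧ d = 1 + sin (mid a i - 2 * φ)) ∨
      (2 * φ ≤ a i + Ψ ∧ -(π / 2) + η ≤ a i ∧ a (i + 1) ≤ π / 2 - η ∧ d = 1 - cos (2 * φ))) :
    |2 * sin Ψ * cos φ * (∫ ξ in foot Ψ a φ i..foot Ψ a φ (i + 1),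
        deficit (2 * n) (canonicalLine (vtx Ψ a)) φ ξ) -
      2 * sin ((a (i + 1) - a i) / 2) * min (sin φ) (cos (φ - mid a i)) * d| ≤
      2 * sin ((a (i + 1) - a i) / 2) * min (sin φ) (cos (φ - mid a i)) * η := by
  have hcφ : 0 < cos φ := cos_pos_of_mem_Ioo ⟨by linarith, hφ1⟩
  have hsφ : 0 < sin φ := sin_pos_of_pos_of_lt_pi hφ0 (by linarith [pi_pos])
  have hc := h.cos_sub_mid_pos hi hφ0 hvis
  have hs := h.sin_pos
  have hsd := h.sin_half_pos hi
  have hη0 : 0 ≤ η := by linarith [hη i hi, h.part.2.2 i hi]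
  obtain ⟨S, hS⟩ : ∃ S, S = sin ((a (i + 1) - a i) / 2) := ⟨_, rfl⟩
  rw [← hS] at hsd
  -- The chord occupies the length `K₁ * cos (φ - mid a i)` of starting points, and particles
  -- starting within `K₁ * sin φ` of its right foot are reflected once. Both lengths scale with
  -- `K₁`, whence the minimum in the limit density.
  obtain ⟨K₁, hK₁⟩ : ∃ K₁, K₁ = S / sin Ψ / cos φ := ⟨_, rfl⟩
  have hK₁0 : 0 < K₁ := hK₁ ▸ div_pos (div_pos hsd hs) hcφ
  have hK₁' : 2 * sin Ψ * cos φ * K₁ = 2 * S := by rw [hK₁]; field_simp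
  have hsub : foot Ψ a φ (i + 1) - foot Ψ a φ i = K₁ * cos (φ - mid a i) := by
    rw [h.foot_sub hi, hK₁, hS]; ring
  set ψ := π / 2 + mid a i - φ with hψ
  have hci : 0 < cos (ψ - mid a i) := by
    rw [hψ, show π / 2 + mid a i - φ - mid a i = π / 2 - φ by ring, cos_pi_div_two_sub]
    exact hsφ
  have hlt := h.offset_lt hi hci
  set oA := offset ψ (vtx Ψ a i)
  set oC := offset ψ (vtx Ψ a (i + 1))
  set r := foot Ψ a φ (i + 1)
  -- Exceptional starting points: those aimed at the apex, and those whose trajectory after one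
  -- reflection lies on a line through a division point.
  set E : Set ℝ := {ξ | -cos (φ - mid a i) - (r - ξ) * (-(2 / K₁)) = sin φ} ∪
    ⋃ k : ℕ, {ξ | oC - (r - ξ) * ((oC - oA) / (K₁ * sin φ)) = offset ψ (vtx Ψ a k)} with hE
  have hEc : E.Countable := by
    refine (countable_affine_eq _ _ _ (neg_ne_zero.2 (by positivity))).union
      (Set.countable_iUnion fun k => countable_affine_eq _ _ _ ?_)
    exact (div_pos (sub_pos.2 hlt) (by positivity)).ne'
  have key := abs_integral_sub_min_mul_le (f := deficit (2 * n) (canonicalLine (vtx Ψ a)) φ)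
    (l := foot Ψ a φ i) (r := r) (K := K₁ * sin φ) (d := d) (η := η) (E := E) ?_ (by positivity)
    hEc (h.isProfile.intervalIntegrable_deficit φ) ?_ ?_
  · have hmin : 2 * sin Ψ * cos φ * min (r - foot Ψ a φ i) (K₁ * sin φ) =
        2 * S * min (sin φ) (cos (φ - mid a i)) := by
      rw [hsub, ← mul_min_of_nonneg _ _ hK₁0.le, ← mul_assoc, hK₁', min_comm]
    have hpos : 0 < 2 * sin Ψ * cos φ := by positivity
    have := mul_le_mul_of_nonneg_left key hpos.le
    rw [← abs_of_pos hpos, ← abs_mul, abs_of_pos hpos, mul_sub, ← mul_assoc, ← mul_assoc,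
      hmin] at this
    rwa [← hS]
  · have := mul_pos hK₁0 hc
    linarith
  · intro ξ hξ hξE hK
    obtain ⟨y, hy0, hy1, hy, hret⟩ := h.exists_chordPoint hi hφ0 hφ1 hvis hξ
    rw [← hS] at hy
    replace hy : K₁ * ((1 - y) * cos (φ - mid a i)) = r - ξ := by rw [← hy, hK₁]; ring
    have hlt : sin φ < (1 - y) * cos (φ - mid a i) := by
      rw [← hy] at hK
      exact lt_of_mul_lt_mul_left hK hK₁0.le
    rw [h.isProfile.deficit_eq (ψ := φ)]
    · simp
    · refine hret _ (h.returns_double hi hφ0 hφ1 hvis hy0 hy1 hlt fun hne => hξE (Or.inl ?_))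
      simp only [Set.mem_ofPred_eq]
      rw [← hy, hne]
      field_simp
      ring
  · intro ξ hξ hξE hK
    obtain ⟨y, hy0, hy1, hy, hret⟩ := h.exists_chordPoint hi hφ0 hφ1 hvis hξ
    rw [← hS] at hy
    replace hy : K₁ * ((1 - y) * cos (φ - mid a i)) = r - ξ := by rw [← hy, hK₁]; ring
    have hlt : (1 - y) * cos (φ - mid a i) < sin φ := by
      rw [← hy] at hK
      exact lt_of_mul_lt_mul_left hK hK₁0.le
    -- With an immediate return the deficit is exactly `d`. With a second impact it is `1 - cos (mid
    -- a i - mid a j)`, and `leaves_second` bounds the distance of the argument from `2 * φ` by `η`.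
    rcases hd with ⟨hd1, rfl⟩ | ⟨hd1, hd2, hd3, rfl⟩
    · rw [h.isProfile.deficit_eq (ψ := ψ)
        (hret _ (h.returns_single hi hφ0 hφ1 hvis hy0 hy1 hlt hd1)),
        show ψ - φ = (mid a i - 2 * φ) + π / 2 by rw [hψ]; ring, cos_add_pi_div_two]
      simpa using hη0
    · obtain ⟨y', hy'⟩ : ∃ y', sin φ * y' = sin φ - (1 - y) * cos (φ - mid a i) :=
        ⟨_, mul_div_cancel₀ _ hsφ.ne'⟩
      have hy'0 : 0 < y' := by
        by_contra hcon
        push Not at hcon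
        nlinarith
      have hy'1 : y' < 1 := by
        by_contra hcon
        push Not at hcon
        nlinarith [mul_pos (sub_pos.2 hy1) hc]
      have hgen : ∀ k ≤ n, offset ψ (chordPoint Ψ a i y') ≠ offset ψ (vtx Ψ a k) := by
        intro k hk hne
        refine hξE (Or.inr (Set.mem_iUnion.2 ⟨k, ?_⟩))
        rw [offset_chordPoint] at hne
        change (1 - y') * oA + y' * oC = _ at hne
        simp only [Set.mem_ofPred_eq]
        rw [← hne, ← hy]
        have e : (1 - y) * cos (φ - mid a i) = sin φ * (1 - y') := by linear_combination hy'
        rw [e]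
        field_simp
        ring
      obtain ⟨j, hj, hij, hlv⟩ := h.leaves_second hi hφ0 hφ1 hvis hy'0 hy'1 hd1 hη hd2 hd3 hgen
      rw [h.isProfile.deficit_eq (ψ := mid a j - mid a i + φ)
        (hret _ (h.scatter_right hi hy0 hy1 hc hlt fun y'' _ _ he => by
          rwa [mul_left_cancel₀ hsφ.ne' (he.trans hy'.symm)])),
        show mid a j - mid a i + φ - φ = -(mid a i - mid a j) by ring, cos_neg,
        sub_sub_sub_cancel_left]
      refine (Real.abs_cos_sub_cos_le _ _).trans ?_
      rw [abs_sub_comm]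
      exact hij

end IsArcPartition

end
-- Summation of the errors over all chords.
noncomputable section
open Real MeasureTheory

/-- The indicator of the interval with centre `c` and radius `2 * η`. -/
def near (η c : ℝ) : ℝ → ℝ := (Set.Icc (c - 2 * η) (c + 2 * η)).indicator 1

lemma near_nonneg (η c α : ℝ) : 0 ≤ near η c α :=
  Set.indicator_nonneg (fun _ _ => zero_le_one) α

lemma near_eq_one {η c α : ℝ} (h1 : c - 2 * η ≤ α) (h2 : α ≤ c + 2 * η) : near η c α = 1 :=
  Set.indicator_of_mem (show α ∈ Set.Icc _ _ from ⟨h1, h2⟩) _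

lemma measurable_near (η c : ℝ) : Measurable (near η c) :=
  measurable_one.indicator measurableSet_Icc

lemma intervalIntegrable_near (η c a b : ℝ) : IntervalIntegrable (near η c) volume a b :=
  intervalIntegrable_of_measurable_of_abs_le (C := 1) (measurable_near η c) (fun x => by
    unfold near Set.indicator
    split_ifs <;> simp) a b

lemma integral_near_le {η : ℝ} (hη : 0 ≤ η) (c : ℝ) {a b : ℝ} (hab : a ≤ b) :
    ∫ α in a..b, near η c α ≤ 4 * η := by
  rw [intervalIntegral.integral_of_le hab]
  have hi : Integrable (near η c) volume :=
    (integrable_indicator_iff measurableSet_Icc).2 (by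
      exact integrableOn_const (by simp))
  refine (setIntegral_le_integral hi (Filter.Eventually.of_forall (near_nonneg η c))).trans ?_
  rw [near, integral_indicator_one measurableSet_Icc, Real.volume_real_Icc_of_le (by linarith)]
  linarith

/-- A majorant for the error. -/
def errorDensity (Ψ φ η α : ℝ) : ℝ :=
  6 * η + 4 * (near η (2 * φ - π + Ψ) α + near η (2 * φ - Ψ) α + near η (π / 2) α +
    near η (-(π / 2)) α)

lemma intervalIntegrable_errorDensity (Ψ φ η a b : ℝ) :
    IntervalIntegrable (errorDensity Ψ φ η) volume a b :=
  intervalIntegrable_const.add (((((intervalIntegrable_near _ _ _ _).add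
    (intervalIntegrable_near _ _ _ _)).add (intervalIntegrable_near _ _ _ _)).add
      (intervalIntegrable_near _ _ _ _)).const_mul 4)

lemma integral_errorDensity_le (Ψ φ : ℝ) {η : ℝ} (hη : 0 ≤ η) {a b : ℝ} (hab : a ≤ b) :
    ∫ α in a..b, errorDensity Ψ φ η α ≤ 6 * η * (b - a) + 64 * η := by
  have hn := fun c => intervalIntegrable_near η c a b
  have hl := fun c => integral_near_le hη c hab
  unfold errorDensity
  rw [intervalIntegral.integral_add intervalIntegrable_const
    (((((hn _).add (hn _)).add (hn _)).add (hn _)).const_mul 4),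
    intervalIntegral.integral_const_mul (4 : ℝ), intervalIntegral.integral_add
      (((hn _).add (hn _)).add (hn _)) (hn _), intervalIntegral.integral_add
      ((hn _).add (hn _)) (hn _), intervalIntegral.integral_add (hn _) (hn _),
    intervalIntegral.integral_const, smul_eq_mul]
  linarith [hl (2 * φ - π + Ψ), hl (2 * φ - Ψ), hl (π / 2), hl (-(π / 2))]

lemma le_integral_errorDensity {Ψ φ η a b C : ℝ} (hab : a ≤ b)
    (hC : ∀ α ∈ Set.Icc a b, C ≤ errorDensity Ψ φ η α) :
    C * (b - a) ≤ ∫ α in a..b, errorDensity Ψ φ η α := by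
  have := intervalIntegral.integral_mono_on hab (intervalIntegrable_const (c := C))
    (intervalIntegrable_errorDensity Ψ φ η a b) hC
  rwa [intervalIntegral.integral_const, smul_eq_mul, mul_comm] at this

namespace IsArcPartition

variable {Ψ : ℝ} {n : ℕ} {a : ℕ → ℝ}

/-- Freezing the density at the midpoint costs `η` for the deficit factor, multiplied by a minimum
of modulus at most `1`, and `η` for the minimum, multiplied by a deficit of at most `2`. -/
lemma abs_integral_limitDensity_sub_le (h : IsArcPartition Ψ n a) {i : ℕ} (hi : i < n)
    {φ η d : ℝ} (hvis : 2 * φ - π + Ψ ≤ a i) (hη : a (i + 1) - a i ≤ η)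
    (hd : (a (i + 1) + Ψ ≤ 2 * φ ∧ d = 1 + sin (mid a i - 2 * φ)) ∨
      (2 * φ ≤ a i + Ψ ∧ d = 1 - cos (2 * φ))) :
    |(∫ α in a i..a (i + 1), limitDensity Ψ φ α) -
      (a (i + 1) - a i) * (min (sin φ) (cos (φ - mid a i)) * d)| ≤
      3 * η * (a (i + 1) - a i) := by
  have hlt := h.part.2.2 i hi
  have hm := h.mid_mem hi
  set m := min (sin φ) (cos (φ - mid a i)) with hmdef
  have hd0 : |d| ≤ 2 := by
    rcases hd with ⟨-, rfl⟩ | ⟨-, rfl⟩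
    · exact abs_le.2 ⟨by linarith [neg_one_le_sin (mid a i - 2 * φ)],
        by linarith [sin_le_one (mid a i - 2 * φ)]⟩
    · exact abs_le.2 ⟨by linarith [cos_le_one (2 * φ)], by linarith [neg_one_le_cos (2 * φ)]⟩
  have key : ∀ α ∈ Set.uIoc (a i) (a (i + 1)), ‖limitDensity Ψ φ α - m * d‖ ≤ 3 * η := by
    intro α hα
    rw [Set.uIoc_of_le hlt.le] at hα
    have h1 : ¬ α ≤ 2 * φ - π + Ψ := by linarith [hα.1]
    have hαm : |α - mid a i| ≤ η := abs_le.2 ⟨by linarith [hα.1], by linarith [hα.2]⟩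
    have hmm : |min (sin φ) (cos (φ - α)) - m| ≤ η := by
      refine (abs_min_sub_min_le_max _ _ _ _).trans ?_
      rw [sub_self, abs_zero]
      refine max_le (by linarith) ((Real.abs_cos_sub_cos_le _ _).trans ?_)
      rw [sub_sub_sub_cancel_left, abs_sub_comm]
      exact hαm
    obtain ⟨d', hd', hdd⟩ : ∃ d', limitDensity Ψ φ α = min (sin φ) (cos (φ - α)) * d' ∧
        |d' - d| ≤ η := by
      rcases hd with ⟨hd1, rfl⟩ | ⟨hd1, rfl⟩
      · refine ⟨1 + sin (α - 2 * φ), ?_, ?_⟩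
        · rw [limitDensity, if_neg h1, if_neg (by linarith [hα.2])]
        · rw [add_sub_add_left_eq_sub]
          refine (Real.abs_sin_sub_sin_le _ _).trans ?_
          rwa [sub_sub_sub_cancel_right]
      · refine ⟨1 - cos (2 * φ), ?_, ?_⟩
        · rw [limitDensity, if_neg h1, if_pos (by linarith [hα.1])]
        · rw [sub_self, abs_zero]; linarith
    rw [norm_eq_abs, hd', show min (sin φ) (cos (φ - α)) * d' - m * d =
      min (sin φ) (cos (φ - α)) * (d' - d) + (min (sin φ) (cos (φ - α)) - m) * d by ring]
    refine (abs_add_le _ _).trans ?_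
    rw [abs_mul, abs_mul]
    have e1 : |min (sin φ) (cos (φ - α))| * |d' - d| ≤ 1 * η :=
      mul_le_mul (abs_min_sin_cos_le _ _) hdd (abs_nonneg _) zero_le_one
    have e2 : |min (sin φ) (cos (φ - α)) - m| * |d| ≤ η * 2 :=
      mul_le_mul hmm hd0 (abs_nonneg _) (by linarith)
    linarith
  have := intervalIntegral.norm_integral_le_of_norm_le_const key
  rw [intervalIntegral.integral_sub (intervalIntegrable_limitDensity _ _ _ _)
    intervalIntegrable_const, intervalIntegral.integral_const, smul_eq_mul, norm_eq_abs,
    abs_of_pos (sub_pos.2 hlt)] at this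
  exact this

/-- The constant is `6 = 1 + 2 + 3`: the deviation of the actual deficit from `d`, the replacement
of `2 * sin (Δ / 2)` by `Δ` with `|d| ≤ 2`, and the freezing of the density. -/
lemma abs_good_chord_le (h : IsArcPartition Ψ n a) {i : ℕ} (hi : i < n) {φ η d : ℝ}
    (hφ0 : 0 < φ) (hφ1 : φ < π / 2) (hvis : 2 * φ - π + Ψ ≤ a i)
    (hη : ∀ k < n, a (k + 1) - a k ≤ η) (hη1 : η ≤ 1)
    (hd : (a (i + 1) + Ψ ≤ 2 * φ ∧ d = 1 + sin (mid a i - 2 * φ)) ∨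
      (2 * φ ≤ a i + Ψ ∧ -(π / 2) + η ≤ a i ∧ a (i + 1) ≤ π / 2 - η ∧ d = 1 - cos (2 * φ))) :
    |2 * sin Ψ * cos φ * (∫ ξ in foot Ψ a φ i..foot Ψ a φ (i + 1),
        deficit (2 * n) (canonicalLine (vtx Ψ a)) φ ξ) -
      ∫ α in a i..a (i + 1), limitDensity Ψ φ α| ≤ 6 * η * (a (i + 1) - a i) := by
  have k1 := h.abs_integral_deficit_sub_le hi hφ0 hφ1 hvis hη hd
  have hd' : (a (i + 1) + Ψ ≤ 2 * φ ∧ d = 1 + sin (mid a i - 2 * φ)) ∨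
      (2 * φ ≤ a i + Ψ ∧ d = 1 - cos (2 * φ)) := hd.imp_right fun hd => ⟨hd.1, hd.2.2.2⟩
  have k2 := h.abs_integral_limitDensity_sub_le hi hvis (hη i hi) hd'
  have hd2 : |d| ≤ 2 := by
    rcases hd' with ⟨-, rfl⟩ | ⟨-, rfl⟩
    · exact abs_le.2 ⟨by linarith [neg_one_le_sin (mid a i - 2 * φ)],
        by linarith [sin_le_one (mid a i - 2 * φ)]⟩
    · exact abs_le.2 ⟨by linarith [cos_le_one (2 * φ)], by linarith [neg_one_le_cos (2 * φ)]⟩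
  have hlt := h.part.2.2 i hi
  have hηi := hη i hi
  set m := min (sin φ) (cos (φ - mid a i)) with hm
  have hm1 : |m| ≤ 1 := abs_min_sin_cos_le _ _
  set Δ := a (i + 1) - a i with hΔ
  have hΔ0 : 0 < Δ := sub_pos.2 hlt
  have hs := h.sin_half_pos hi
  have hs1 : sin (Δ / 2) ≤ Δ / 2 := sin_le (by linarith)
  have hs2 : Δ / 2 - (Δ / 2) ^ 3 / 6 < sin (Δ / 2) := sin_gt_sub_cube (by linarith)
  have hs3 : |2 * sin (Δ / 2) - Δ| ≤ η * Δ := by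
    rw [abs_le]
    constructor
    · have : Δ ^ 2 ≤ η := by nlinarith
      have : Δ ^ 3 ≤ η * Δ := by nlinarith
      nlinarith
    · nlinarith
  have e1 : |2 * sin (Δ / 2) * m * d - Δ * (m * d)| ≤ η * Δ * 2 := by
    rw [show 2 * sin (Δ / 2) * m * d - Δ * (m * d) = (2 * sin (Δ / 2) - Δ) * (m * d) by ring,
      abs_mul, abs_mul m d]
    have : |m| * |d| ≤ 1 * 2 := mul_le_mul hm1 hd2 (abs_nonneg _) zero_le_one
    exact mul_le_mul hs3 (by linarith) (by positivity) (by nlinarith)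
  have e2 : 2 * sin (Δ / 2) * m * η ≤ Δ * η := by
    have h1 := (abs_le.1 hm1).2
    have hη0 : 0 ≤ η := by linarith
    have : 2 * sin (Δ / 2) * m ≤ Δ := by nlinarith
    exact mul_le_mul_of_nonneg_right this hη0
  rw [abs_le] at *
  constructor <;> linarith [k1.1, k1.2, k2.1, k2.2, e1.1, e1.2]

lemma foot_nonpos (h : IsArcPartition Ψ n a) {i : ℕ} (hi : i ≤ n) {φ : ℝ} (hφ0 : 0 < φ)
    (hφ1 : φ < π / 2) (hinv : a i ≤ 2 * φ - π + Ψ) : foot Ψ a φ i ≤ 0 := by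
  have hcφ : 0 < cos φ := cos_pos_of_mem_Ioo ⟨by linarith, hφ1⟩
  refine div_nonpos_of_nonpos_of_nonneg (h.offset_vtx_nonpos hi ?_) hcφ.le
  rw [← cos_neg]
  refine cos_nonpos_of_pi_div_two_le_of_le ?_ ?_
  · linarith
  · linarith [h.neg_le hi, h.le]

lemma foot_nonneg (h : IsArcPartition Ψ n a) {i : ℕ} (hi : i ≤ n) {φ : ℝ} (hφ0 : 0 < φ)
    (hφ1 : φ < π / 2) (hvis : 2 * φ - π + Ψ ≤ a i) : 0 ≤ foot Ψ a φ i := by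
  have hcφ : 0 < cos φ := cos_pos_of_mem_Ioo ⟨by linarith, hφ1⟩
  refine div_nonneg (h.offset_vtx_nonneg hi ?_) hcφ.le
  exact cos_nonneg_of_mem_Icc ⟨by linarith, by linarith [h.le_self hi, h.le]⟩

/-- Each of the two terms is trivially at most twice the angular step. Truncation by `max 0` keeps
the starting points on the axis when the chord is not, or only partly, visible. -/
lemma abs_bad_chord_le (h : IsArcPartition Ψ n a) {i : ℕ} (hi : i < n) {φ : ℝ}
    (hφ0 : 0 < φ) (hφ1 : φ < π / 2) :
    |2 * sin Ψ * cos φ * (∫ ξ in max 0 (foot Ψ a φ i)..max 0 (foot Ψ a φ (i + 1)),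
        deficit (2 * n) (canonicalLine (vtx Ψ a)) φ ξ) -
      ∫ α in a i..a (i + 1), limitDensity Ψ φ α| ≤ 4 * (a (i + 1) - a i) := by
  have hcφ : 0 < cos φ := cos_pos_of_mem_Ioo ⟨by linarith, hφ1⟩
  have hlt := h.part.2.2 i hi
  have hs := h.sin_pos
  have hsh := h.sin_half_pos hi
  have k1 := intervalIntegral.norm_integral_le_of_norm_le_const (C := 2)
    (f := deficit (2 * n) (canonicalLine (vtx Ψ a)) φ) (a := max 0 (foot Ψ a φ i))
    (b := max 0 (foot Ψ a φ (i + 1))) fun ξ _ =>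
      (abs_of_nonneg (deficit_nonneg _ _ φ ξ)).trans_le (deficit_le_two _ _ φ ξ)
  rw [norm_eq_abs] at k1
  have k2 := intervalIntegral.norm_integral_le_of_norm_le_const (C := 2)
    (f := limitDensity Ψ φ) (a := a i) (b := a (i + 1)) fun α _ => abs_limitDensity_le Ψ φ α
  rw [norm_eq_abs] at k2
  rw [abs_of_pos (sub_pos.2 hlt)] at k2
  have k3 : 2 * sin Ψ * cos φ * |max 0 (foot Ψ a φ (i + 1)) - max 0 (foot Ψ a φ i)| ≤
      a (i + 1) - a i := by
    have e1 : |max 0 (foot Ψ a φ (i + 1)) - max 0 (foot Ψ a φ i)| ≤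
        |foot Ψ a φ (i + 1) - foot Ψ a φ i| := by
      refine (abs_max_sub_max_le_max _ _ _ _).trans ?_
      simp
    have e2 : 2 * sin Ψ * cos φ * |foot Ψ a φ (i + 1) - foot Ψ a φ i| =
        2 * sin ((a (i + 1) - a i) / 2) * |cos (φ - mid a i)| := by
      rw [h.foot_sub hi, abs_div, abs_mul, abs_of_pos hcφ, abs_of_pos (div_pos hsh hs)]
      field_simp
    have e3 := sin_le (x := (a (i + 1) - a i) / 2) (by linarith)
    have e4 := abs_cos_le_one (φ - mid a i)
    calc _ ≤ 2 * sin Ψ * cos φ * |foot Ψ a φ (i + 1) - foot Ψ a φ i| := by gcongr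
      _ = _ := e2
      _ ≤ 2 * sin ((a (i + 1) - a i) / 2) * 1 := by gcongr
      _ ≤ _ := by linarith
  refine (abs_sub _ _).trans ?_
  rw [abs_mul, abs_of_pos (by positivity : 0 < 2 * sin Ψ * cos φ)]
  have : 2 * sin Ψ * cos φ * |∫ ξ in max 0 (foot Ψ a φ i)..max 0 (foot Ψ a φ (i + 1)),
      deficit (2 * n) (canonicalLine (vtx Ψ a)) φ ξ| ≤ 2 * sin Ψ * cos φ *
        (2 * |max 0 (foot Ψ a φ (i + 1)) - max 0 (foot Ψ a φ i)|) := by gcongr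
  linarith

/-- A chord is bad only near the boundary of visibility, near the switch between one and two
impacts, or near `±π/2`. The number of bad chords is not controlled, since steps may be arbitrarily
small, but their total angular length is; hence the majorant is a density rather than a count. -/
lemma abs_chord_le (h : IsArcPartition Ψ n a) {i : ℕ} (hi : i < n) {φ η : ℝ}
    (hφ0 : 0 < φ) (hφ1 : φ < π / 2) (hη : ∀ k < n, a (k + 1) - a k ≤ η) (hη1 : η ≤ 1) :
    |2 * sin Ψ * cos φ * (∫ ξ in max 0 (foot Ψ a φ i)..max 0 (foot Ψ a φ (i + 1)),
        deficit (2 * n) (canonicalLine (vtx Ψ a)) φ ξ) -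
      ∫ α in a i..a (i + 1), limitDensity Ψ φ α| ≤
      ∫ α in a i..a (i + 1), errorDensity Ψ φ η α := by
  have hlt := h.part.2.2 i hi
  have hηi := hη i hi
  have hη0 : 0 ≤ η := by linarith
  have hn := near_nonneg η
  have h1 := h.neg_le hi.le
  have h4 := h.le_self (i := i + 1) hi
  have h5 := h.le
  have bad : (∀ α ∈ Set.Icc (a i) (a (i + 1)), 4 ≤ errorDensity Ψ φ η α) → |2 * sin Ψ * cos φ *
      (∫ ξ in max 0 (foot Ψ a φ i)..max 0 (foot Ψ a φ (i + 1)),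
        deficit (2 * n) (canonicalLine (vtx Ψ a)) φ ξ) -
      ∫ α in a i..a (i + 1), limitDensity Ψ φ α| ≤
      ∫ α in a i..a (i + 1), errorDensity Ψ φ η α := fun hb =>
    (h.abs_bad_chord_le hi hφ0 hφ1).trans (le_integral_errorDensity hlt.le hb)
  have good : ∀ α ∈ Set.Icc (a i) (a (i + 1)), 6 * η ≤ errorDensity Ψ φ η α := fun α _ => by
    unfold errorDensity
    linarith [hn (2 * φ - π + Ψ) α, hn (2 * φ - Ψ) α, hn (π / 2) α, hn (-(π / 2)) α]
  have hgood : 6 * η * (a (i + 1) - a i) ≤ _ := le_integral_errorDensity hlt.le good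
  rcases le_or_gt (a (i + 1)) (2 * φ - π + Ψ) with hinv | hinv
  · rw [max_eq_left (h.foot_nonpos hi.le hφ0 hφ1 (by linarith)),
      max_eq_left (h.foot_nonpos (i := i + 1) hi hφ0 hφ1 hinv), intervalIntegral.integral_same,
      mul_zero, zero_sub, abs_neg]
    have : ∫ α in a i..a (i + 1), limitDensity Ψ φ α = 0 := by
      rw [intervalIntegral.integral_of_le hlt.le]
      refine setIntegral_eq_zero_of_forall_eq_zero fun α hα => ?_
      rw [limitDensity, if_pos (hα.2.trans hinv)]
    rw [this, abs_zero]
    refine le_trans ?_ hgood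
    have := sub_pos.2 hlt
    positivity
  rcases lt_or_ge (a i) (2 * φ - π + Ψ) with hp | hvis
  · refine bad fun α hα => ?_
    have := near_eq_one (η := η) (c := 2 * φ - π + Ψ) (α := α) (by linarith [hα.1])
      (by linarith [hα.2])
    unfold errorDensity
    linarith [hn (2 * φ - Ψ) α, hn (π / 2) α, hn (-(π / 2)) α]
  rw [max_eq_right (h.foot_nonneg hi.le hφ0 hφ1 hvis),
    max_eq_right (h.foot_nonneg (i := i + 1) hi hφ0 hφ1 hinv.le)] at *
  rcases le_or_gt (a (i + 1) + Ψ) (2 * φ) with hd | hd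
  · exact (h.abs_good_chord_le hi hφ0 hφ1 hvis hη hη1 (Or.inl ⟨hd, rfl⟩)).trans hgood
  rcases lt_or_ge (a i + Ψ) (2 * φ) with hd' | hd'
  · refine bad fun α hα => ?_
    have := near_eq_one (η := η) (c := 2 * φ - Ψ) (α := α) (by linarith [hα.1])
      (by linarith [hα.2])
    unfold errorDensity
    linarith [hn (2 * φ - π + Ψ) α, hn (π / 2) α, hn (-(π / 2)) α]
  rcases lt_or_ge (a i) (-(π / 2) + η) with hl | hl
  · refine bad fun α hα => ?_
    have := near_eq_one (η := η) (c := -(π / 2)) (α := α) (by linarith [hα.1])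
      (by linarith [hα.2])
    unfold errorDensity
    linarith [hn (2 * φ - π + Ψ) α, hn (π / 2) α, hn (2 * φ - Ψ) α]
  rcases lt_or_ge (π / 2 - η) (a (i + 1)) with hr | hr
  · refine bad fun α hα => ?_
    have := near_eq_one (η := η) (c := π / 2) (α := α) (by linarith [hα.1])
      (by linarith [hα.2])
    unfold errorDensity
    linarith [hn (2 * φ - π + Ψ) α, hn (-(π / 2)) α, hn (2 * φ - Ψ) α]
  exact (h.abs_good_chord_le hi hφ0 hφ1 hvis hη hη1 (Or.inr ⟨hd', hl, hr, rfl⟩)).trans hgood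

/-- The deficit for a fixed direction of the velocity. -/
theorem abs_deficit_sub_limit_le (h : IsArcPartition Ψ n a) {φ η : ℝ}
    (hφ0 : 0 < φ) (hφ1 : φ < π / 2) (hη : ∀ k < n, a (k + 1) - a k ≤ η) (hη1 : η ≤ 1) :
    |2 * sin Ψ * cos φ * (∫ ξ in (0 : ℝ)..1,
        deficit (2 * n) (canonicalLine (vtx Ψ a)) φ ξ) -
      ∫ α in (-Ψ)..Ψ, limitDensity Ψ φ α| ≤ 84 * η := by
  have hcφ : 0 < cos φ := cos_pos_of_mem_Ioo ⟨by linarith, hφ1⟩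
  have hη0 : 0 ≤ η := by
    have := h.part.2.2 0 (by linarith [h.two_le])
    linarith [hη 0 (by linarith [h.two_le])]
  have s1 := intervalIntegral.sum_integral_adjacent_intervals
    (f := deficit (2 * n) (canonicalLine (vtx Ψ a)) φ) (μ := volume)
    (a := fun i => max 0 (foot Ψ a φ i)) (n := n)
    fun k _ => h.isProfile.intervalIntegrable_deficit φ _ _
  have s2 := intervalIntegral.sum_integral_adjacent_intervals
    (f := limitDensity Ψ φ) (μ := volume) (a := a) (n := n)
    fun k _ => intervalIntegrable_limitDensity Ψ φ _ _
  have s3 := intervalIntegral.sum_integral_adjacent_intervals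
    (f := errorDensity Ψ φ η) (μ := volume) (a := a) (n := n)
    fun k _ => intervalIntegrable_errorDensity Ψ φ η _ _
  simp only [h.foot_zero, h.foot_last hcφ.ne', max_self, max_eq_right zero_le_one] at s1
  rw [h.part.1, h.part.2.1] at s2 s3
  rw [← s1, ← s2, Finset.mul_sum, ← Finset.sum_sub_distrib]
  refine (Finset.abs_sum_le_sum_abs _ _).trans
    ((Finset.sum_le_sum fun i hi => h.abs_chord_le (Finset.mem_range.1 hi) hφ0 hφ1 hη hη1).trans ?_)
  rw [s3]
  refine (integral_errorDensity_le Ψ φ hη0 (by linarith [h.pos])).trans ?_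
  -- The interval has length `2 * Ψ ≤ π`, and `6 * π + 64 < 84`.
  nlinarith [h.le, pi_lt_d2]

end IsArcPartition

end
noncomputable section
open Real MeasureTheory

/-! ### Reflection in the vertical line through the middle of the axis -/

/-- The reflection of points. -/
def flipPt (q : ℝ × ℝ) : ℝ × ℝ := (1 - q.1, q.2)

/-- The reflection of vectors. -/
def flipVec (u : ℝ × ℝ) : ℝ × ℝ := (-u.1, u.2)

lemma flip_add_smul (p u : ℝ × ℝ) (t : ℝ) : flipPt (p + t • u) = flipPt p + t • flipVec u := by
  ext <;> simp [flipPt, flipVec]; ring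

lemma flip_comb {s t : ℝ} (h : s + t = 1) (p q : ℝ × ℝ) :
    flipPt (s • p + t • q) = s • flipPt p + t • flipPt q := by
  ext <;> simp [flipPt]
  linear_combination -h

lemma flip_mem_segment {p q r : ℝ × ℝ} (h : r ∈ segment ℝ p q) :
    flipPt r ∈ segment ℝ (flipPt q) (flipPt p) := by
  obtain ⟨s, t, hs, ht, hst, rfl⟩ := h
  rw [segment_symm]
  exact ⟨s, t, hs, ht, hst, (flip_comb hst p q).symm⟩

lemma flip_mem_openSegment {p q r : ℝ × ℝ} (h : r ∈ openSegment ℝ p q) :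
    flipPt r ∈ openSegment ℝ (flipPt q) (flipPt p) := by
  obtain ⟨s, t, hs, ht, hst, rfl⟩ := h
  rw [openSegment_symm]
  exact ⟨s, t, hs, ht, hst, (flip_comb hst p q).symm⟩

lemma flipPt_flipPt (q : ℝ × ℝ) : flipPt (flipPt q) = q := by
  ext <;> simp [flipPt]

lemma mirror_flip (p q u : ℝ × ℝ) :
    mirror (flipPt p - flipPt q) (flipVec u) = flipVec (mirror (q - p) u) := by
  have h1 : dot (flipVec u) (flipPt p - flipPt q) = -dot u (q - p) := by
    simp [dot, flipPt, flipVec]; ring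
  have h2 : dot (flipPt p - flipPt q) (flipPt p - flipPt q) = dot (q - p) (q - p) := by
    simp [dot, flipPt]; ring
  rw [mirror, mirror, h1, h2]
  ext <;> simp [flipPt, flipVec] <;> ring

/-- The vertices `x'` are the mirror images of the vertices `x`, in the opposite order. -/
def IsFlipped (m : ℕ) (x x' : ℕ → ℝ × ℝ) : Prop := ∀ k ≤ m, x' k = flipPt (x (m - k))

lemma IsFlipped.symm {m : ℕ} {x x' : ℕ → ℝ × ℝ} (h : IsFlipped m x x') : IsFlipped m x' x := by
  intro k hk
  rw [h (m - k) (Nat.sub_le m k), Nat.sub_sub_self hk, flipPt_flipPt]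

lemma IsFlipped.vertices {m : ℕ} {x x' : ℕ → ℝ × ℝ} (h : IsFlipped m x x') {k : ℕ} (hk : k < m) :
    x' (m - 1 - k) = flipPt (x (k + 1)) ∧ x' (m - 1 - k + 1) = flipPt (x k) := by
  rw [h _ (by omega), h _ (by omega), show m - (m - 1 - k) = k + 1 by omega,
    show m - (m - 1 - k + 1) = k by omega]
  exact ⟨rfl, rfl⟩

lemma IsFlipped.mem_brokenLine {m : ℕ} {x x' : ℕ → ℝ × ℝ} (h : IsFlipped m x x') {q : ℝ × ℝ}
    (hq : q ∈ brokenLine m x) : flipPt q ∈ brokenLine m x' := by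
  obtain ⟨k, hk, hq⟩ := hq
  refine ⟨m - 1 - k, by omega, ?_⟩
  rw [(h.vertices hk).1, (h.vertices hk).2]
  exact flip_mem_segment hq

lemma IsFlipped.freeFlight {m : ℕ} {x x' : ℕ → ℝ × ℝ} (h : IsFlipped m x x') {p u : ℝ × ℝ} {t : ℝ}
    (hf : FreeFlight m x p u t) : FreeFlight m x' (flipPt p) (flipVec u) t := by
  refine ⟨hf.1, fun s hs hst => ?_⟩
  obtain ⟨h1, h2⟩ := hf.2 s hs hst
  rw [← flip_add_smul]
  refine ⟨h1, fun hm => h2 ?_⟩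
  rw [← flipPt_flipPt (p + s • u)]
  exact h.symm.mem_brokenLine hm

lemma IsFlipped.returnsTo {m : ℕ} {x x' : ℕ → ℝ × ℝ} (h : IsFlipped m x x') {p u w : ℝ × ℝ}
    (hr : ReturnsTo m x p u w) : ReturnsTo m x' (flipPt p) (flipVec u) (flipVec w) := by
  induction hr with
  | arrive p u t hfree h0 h1 =>
    refine .arrive _ _ t (h.freeFlight hfree) ?_ ?_ <;> rw [← flip_add_smul]
    · exact h0
    · have := h1.1
      have := h1.2
      simp only [flipPt]
      exact ⟨by linarith, by linarith⟩
  | bounce p u w t k hk hfree hit hnext ih =>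
    obtain ⟨e1, e2⟩ := h.vertices hk
    refine .bounce _ _ _ t (m - 1 - k) (by omega) (h.freeFlight hfree) ?_ ?_
    · rw [← flip_add_smul, e1, e2]
      exact flip_mem_openSegment hit
    · rw [← flip_add_smul, e1, e2, mirror_flip]
      exact ih

lemma flipVec_heading (φ : ℝ) : flipVec (heading φ) = heading (-φ) := by
  ext <;> simp [flipVec, heading]

lemma IsFlipped.exitAngle {m : ℕ} {x x' : ℕ → ℝ × ℝ} (h : IsFlipped m x x')
    (hx : ∀ k < m, (x k).1 < (x (k + 1)).1)
    (hy : ∀ k < m, ∀ q ∈ openSegment ℝ (x k) (x (k + 1)), 0 < q.2)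
    (hx' : ∀ k < m, (x' k).1 < (x' (k + 1)).1)
    (hy' : ∀ k < m, ∀ q ∈ openSegment ℝ (x' k) (x' (k + 1)), 0 < q.2) (φ ξ : ℝ) :
    exitAngle m x' (-φ) (1 - ξ) = -exitAngle m x φ ξ := by
  by_cases hr : ∃ w, ReturnsTo m x (ξ, 0) (heading φ) w
  · obtain ⟨w, hw⟩ := hr
    have hw' := h.returnsTo hw
    rw [flipVec_heading] at hw'
    rw [exitAngle_eq hx hy hw, exitAngle_eq hx' hy' (ξ := 1 - ξ) hw', ← arcsin_neg]
    simp [flipVec]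
  · rw [_root_.exitAngle, dif_neg, _root_.exitAngle, dif_neg, neg_zero]
    · rintro ⟨ψ, -, hψ⟩
      exact hr ⟨_, hψ⟩
    · rintro ⟨ψ, -, hψ⟩
      have := h.symm.returnsTo hψ
      rw [flipVec_heading, neg_neg] at this
      simp only [flipPt, sub_sub_cancel] at this
      exact hr ⟨_, this⟩

lemma IsFlipped.canonicalLine {n : ℕ} {p p' : ℕ → ℝ × ℝ} (h : IsFlipped n p p') :
    IsFlipped (2 * n) (canonicalLine p) (canonicalLine p') := by
  intro k hk
  rcases Nat.even_or_odd' k with ⟨i, rfl | rfl⟩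
  · rw [canonicalLine_even, ← Nat.mul_sub, canonicalLine_even, h i (by omega)]
  · have e : 2 * n - (2 * i + 1) = 2 * (n - 1 - i) + 1 := by omega
    rw [e, canonicalLine_odd, canonicalLine_odd, h i (by omega), h (i + 1) (by omega),
      show n - i = n - 1 - i + 1 by omega, show n - (i + 1) = n - 1 - i by omega]
    ext
    · simp [canonicalApex, flipPt]; ring
    · simp only [canonicalApex, flipPt]
      rw [show (1 - (p (n - 1 - i)).1 - (1 - (p (n - 1 - i + 1)).1)) ^ 2 =
        ((p (n - 1 - i + 1)).1 - (p (n - 1 - i)).1) ^ 2 by ring,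
        show ((p (n - 1 - i)).2 - (p (n - 1 - i + 1)).2) ^ 2 =
        ((p (n - 1 - i + 1)).2 - (p (n - 1 - i)).2) ^ 2 by ring]
      ring

lemma IsProfile.deficit_flip {n : ℕ} {p p' : ℕ → ℝ × ℝ} (hp : IsProfile n p)
    (hp' : IsProfile n p') (h : IsFlipped n p p') (φ ξ : ℝ) :
    deficit (2 * n) (_root_.canonicalLine p') (-φ) (1 - ξ) =
      deficit (2 * n) (_root_.canonicalLine p) φ ξ := by
  rw [deficit, deficit, h.canonicalLine.exitAngle hp.line_fst_lt hp.line_snd_pos hp'.line_fst_lt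
    hp'.line_snd_pos, ← cos_neg]
  congr 2
  ring

/-! ### The resistance as an integral over the directions -/

/-- The deficit averaged over the starting points. -/
def meanDeficit (m : ℕ) (x : ℕ → ℝ × ℝ) (φ : ℝ) : ℝ := ∫ ξ in (0 : ℝ)..1, deficit m x φ ξ

lemma intervalIntegrable_integral_of_measurable {f : ℝ × ℝ → ℝ} (hf : Measurable f) {C : ℝ}
    (hC : ∀ z, |f z| ≤ C) (c d a b : ℝ) :
    IntervalIntegrable (fun φ => ∫ α in c..d, f (φ, α)) volume a b := by
  have hm : ∀ s : Set ℝ, Measurable fun φ => ∫ α in s, f (φ, α) := fun s =>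
    (hf.stronglyMeasurable.integral_prod_right' (ν := volume.restrict s)).measurable
  refine intervalIntegrable_of_measurable_of_abs_le (C := C * |d - c|) ?_ (fun φ => ?_) a b
  · unfold intervalIntegral
    exact (hm _).sub (hm _)
  · rw [← norm_eq_abs]
    exact intervalIntegral.norm_integral_le_of_norm_le_const (f := fun α => f (φ, α))
      fun α _ => hC (φ, α)

lemma IsProfile.intervalIntegrable_meanDeficit {n : ℕ} {p : ℕ → ℝ × ℝ} (hp : IsProfile n p)
    (a b : ℝ) : IntervalIntegrable (meanDeficit (2 * n) (canonicalLine p)) volume a b :=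
  intervalIntegrable_integral_of_measurable hp.measurable_deficit (C := 2) (fun z => by
    rw [abs_of_nonneg (deficit_nonneg _ _ _ _)]; exact deficit_le_two _ _ _ _) 0 1 a b

lemma IsProfile.intervalIntegrable_cos_mul_meanDeficit {n : ℕ} {p : ℕ → ℝ × ℝ}
    (hp : IsProfile n p) (a b : ℝ) :
    IntervalIntegrable (fun φ => cos φ * meanDeficit (2 * n) (canonicalLine p) φ) volume a b :=
  (hp.intervalIntegrable_meanDeficit a b).continuousOn_mul continuous_cos.continuousOn

lemma IsProfile.meanDeficit_flip {n : ℕ} {p p' : ℕ → ℝ × ℝ} (hp : IsProfile n p)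
    (hp' : IsProfile n p') (h : IsFlipped n p p') (φ : ℝ) :
    meanDeficit (2 * n) (_root_.canonicalLine p) (-φ) =
      meanDeficit (2 * n) (_root_.canonicalLine p') φ := by
  unfold meanDeficit
  have := intervalIntegral.integral_comp_sub_left (a := 0) (b := 1)
    (fun ξ => deficit (2 * n) (_root_.canonicalLine p') φ ξ) 1
  simp only [sub_self, sub_zero] at this
  rw [← this]
  congr 1
  ext ξ
  rw [← hp.deficit_flip hp' h, neg_neg]

/-- The value `3/2` belongs to zero deficit. Headings `φ < 0` become headings `φ > 0` for the
mirrored line, so only particles moving to the right have to be studied. -/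
lemma IsProfile.resistance_eq {n : ℕ} {p p' : ℕ → ℝ × ℝ} (hp : IsProfile n p)
    (hp' : IsProfile n p') (h : IsFlipped n p p') :
    resistance (2 * n) (_root_.canonicalLine p) = 3 / 2 - 3 / 8 *
      ((∫ φ in (0 : ℝ)..(π / 2), cos φ * meanDeficit (2 * n) (_root_.canonicalLine p) φ) +
        ∫ φ in (0 : ℝ)..(π / 2), cos φ * meanDeficit (2 * n) (_root_.canonicalLine p') φ) := by
  have hint := fun a b => hp.intervalIntegrable_cos_mul_meanDeficit a b
  have e1 : ∀ φ : ℝ, ∫ ξ in (0 : ℝ)..1,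
      (1 + cos (exitAngle (2 * n) (_root_.canonicalLine p) φ ξ - φ)) * cos φ =
        2 * cos φ - cos φ * meanDeficit (2 * n) (_root_.canonicalLine p) φ := by
    intro φ
    have : ∀ ξ : ℝ, (1 + cos (exitAngle (2 * n) (_root_.canonicalLine p) φ ξ - φ)) * cos φ =
        2 * cos φ - cos φ * deficit (2 * n) (_root_.canonicalLine p) φ ξ := fun ξ => by
      unfold deficit; ring
    simp only [this]
    rw [intervalIntegral.integral_sub intervalIntegrable_const
      ((hp.intervalIntegrable_deficit φ 0 1).const_mul _), intervalIntegral.integral_const_mul,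
      meanDeficit]
    simp
  have e2 : ∫ φ in (-(π / 2))..0, cos φ * meanDeficit (2 * n) (_root_.canonicalLine p) φ =
      ∫ φ in (0 : ℝ)..(π / 2), cos φ * meanDeficit (2 * n) (_root_.canonicalLine p') φ := by
    have := intervalIntegral.integral_comp_neg (a := 0) (b := π / 2)
      (fun φ => cos φ * meanDeficit (2 * n) (_root_.canonicalLine p) φ)
    rw [neg_zero] at this
    rw [← this]
    congr 1
    ext φ
    rw [cos_neg, hp.meanDeficit_flip hp' h]
  have h2 : IntervalIntegrable (fun φ => 2 * cos φ) volume (-(π / 2)) (π / 2) :=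
    (continuous_const.mul continuous_cos).intervalIntegrable _ _
  rw [resistance]
  simp only [e1]
  rw [intervalIntegral.integral_sub h2 (hint _ _),
    ← intervalIntegral.integral_add_adjacent_intervals (hint (-(π / 2)) 0)
      (hint 0 (π / 2)), e2, intervalIntegral.integral_const_mul, integral_cos, sin_neg,
      sin_pi_div_two]
  ring

namespace IsArcPartition

variable {Ψ : ℝ} {n : ℕ} {a : ℕ → ℝ}

lemma isFlipped (h : IsArcPartition Ψ n a) :
    IsFlipped n (vtx Ψ a) (vtx Ψ fun i => -a (n - i)) := by
  intro k _
  have := h.sin_pos.ne'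
  ext
  · simp only [vtx, arcPoint, flipPt, sin_neg]
    field_simp
    ring
  · simp [vtx, arcPoint, flipPt]

lemma flipped (h : IsArcPartition Ψ n a) : IsArcPartition Ψ n fun i => -a (n - i) := by
  refine ⟨h.pos, h.le, h.two_le, ?_, ?_, fun i hi => ?_⟩
  · simp [h.part.2.1]
  · simp [h.part.1]
  · have := h.part.2.2 (n - (i + 1)) (by omega)
    rw [show n - (i + 1) + 1 = n - i by omega] at this
    linarith

/-- The resistance of the canonical line differs from its limit by at most a constant times the
length of the small arcs. -/
theorem abs_resistance_sub_le (h : IsArcPartition Ψ n a) {η : ℝ}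
    (hη : ∀ k < n, a (k + 1) - a k ≤ η) (hη1 : η ≤ 1) :
    |resistance (2 * n) (canonicalLine (vtx Ψ a)) - (3 / 2 - 3 / (8 * sin Ψ) *
      ∫ φ in (0 : ℝ)..(π / 2), ∫ α in (-Ψ)..Ψ, limitDensity Ψ φ α)| ≤ 50 / sin Ψ * η := by
  have hs := h.sin_pos
  set J := ∫ φ in (0 : ℝ)..(π / 2), ∫ α in (-Ψ)..Ψ, limitDensity Ψ φ α with hJ
  have hV : IntervalIntegrable (fun φ => ∫ α in (-Ψ)..Ψ, limitDensity Ψ φ α) volume 0 (π / 2) :=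
    intervalIntegrable_integral_of_measurable (measurable_limitDensity Ψ)
      (fun z => abs_limitDensity_le Ψ z.1 z.2) (-Ψ) Ψ 0 (π / 2)
  have key : ∀ b : ℕ → ℝ, IsArcPartition Ψ n b → (∀ k < n, b (k + 1) - b k ≤ η) →
      |2 * sin Ψ * (∫ φ in (0 : ℝ)..(π / 2),
        cos φ * meanDeficit (2 * n) (canonicalLine (vtx Ψ b)) φ) - J| ≤ 84 * η * (π / 2) := by
    intro b hb hbη
    have hint := (hb.isProfile.intervalIntegrable_cos_mul_meanDeficit 0 (π / 2)).const_mul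
      (2 * sin Ψ)
    have := intervalIntegral.norm_integral_le_of_norm_le_const_ae (a := 0) (b := π / 2)
      (C := 84 * η)
      (f := fun φ => 2 * sin Ψ * (cos φ * meanDeficit (2 * n) (canonicalLine (vtx Ψ b)) φ) -
        ∫ α in (-Ψ)..Ψ, limitDensity Ψ φ α) ?_
    · rwa [intervalIntegral.integral_sub hint hV, intervalIntegral.integral_const_mul, sub_zero,
        abs_of_pos (by positivity), norm_eq_abs] at this
    · have hae : ∀ᵐ φ : ℝ, φ ≠ π / 2 := by
        simpa using measure_eq_zero_iff_ae_notMem.1 (measure_singleton (μ := volume) (π / 2))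
      filter_upwards [hae] with φ hφ hmem
      rw [Set.uIoc_of_le (by positivity)] at hmem
      have := hb.abs_deficit_sub_limit_le hmem.1 (lt_of_le_of_ne hmem.2 hφ) hbη hη1
      rw [norm_eq_abs, ← mul_assoc]
      exact this
  have k1 := key a h hη
  have k2 := key _ h.flipped fun k hk => by
    have := hη (n - (k + 1)) (by omega)
    rw [show n - (k + 1) + 1 = n - k by omega] at this
    linarith
  rw [h.isProfile.resistance_eq h.flipped.isProfile h.isFlipped]
  set A := ∫ φ in (0 : ℝ)..(π / 2), cos φ * meanDeficit (2 * n) (canonicalLine (vtx Ψ a)) φ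
  set B := ∫ φ in (0 : ℝ)..(π / 2),
    cos φ * meanDeficit (2 * n) (canonicalLine (vtx Ψ fun i => -a (n - i))) φ
  have e : 3 / 2 - 3 / 8 * (A + B) - (3 / 2 - 3 / (8 * sin Ψ) * J) =
      -(3 / 16 / sin Ψ) * ((2 * sin Ψ * A - J) + (2 * sin Ψ * B - J)) := by
    field_simp
    ring
  have hη0 : 0 ≤ η := by
    have := h.part.2.2 0 (by linarith [h.two_le])
    linarith [hη 0 (by linarith [h.two_le])]
  have e2 : |(2 * sin Ψ * A - J) + (2 * sin Ψ * B - J)| ≤ 84 * η * π := by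
    refine (abs_add_le _ _).trans ?_
    linarith
  rw [e, abs_mul, abs_neg, abs_of_pos (by positivity)]
  calc 3 / 16 / sin Ψ * |(2 * sin Ψ * A - J) + (2 * sin Ψ * B - J)|
      ≤ 3 / 16 / sin Ψ * (84 * η * π) := by gcongr
    _ = (3 / 16 * 84 * π) / sin Ψ * η := by ring
    -- Numerically `3/16 * 84 * π < 50`.
    _ ≤ 50 / sin Ψ * η := by
      gcongr
      linarith [pi_lt_d2]

end IsArcPartition

end
noncomputable section
open Real MeasureTheory

/-! ### The limit value of the resistance -/

section LimitValue

variable {Ψ α : ℝ}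

lemma intervalIntegrable_limitDensity_left (Ψ α a b : ℝ) :
    IntervalIntegrable (fun φ => limitDensity Ψ φ α) volume a b :=
  intervalIntegrable_of_measurable_of_abs_le
    ((measurable_limitDensity Ψ).comp (measurable_prodMk_right (y := α)))
    (fun φ => abs_limitDensity_le Ψ φ α) a b

lemma limitDensity_of_lt_double (hΨ : Ψ ≤ π / 2) (hα1 : -Ψ < α) (hα2 : α < Ψ) {φ : ℝ}
    (h0 : 0 ≤ φ) (h : φ < (α + Ψ) / 2) : limitDensity Ψ φ α = 2 * sin φ ^ 3 := by
  rw [limitDensity, if_neg (by linarith), if_pos (by linarith), min_eq_left, cos_two_mul, cos_sq']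
  · ring
  · rw [← cos_pi_div_two_sub, ← cos_abs (φ - α)]
    refine cos_le_cos_of_nonneg_of_le_pi (abs_nonneg _) (by linarith) (abs_le.2 ⟨?_, ?_⟩) <;>
      linarith

lemma limitDensity_of_le_quarter (hα1 : -Ψ < α) (hα2 : α < Ψ) {φ : ℝ}
    (h : (α + Ψ) / 2 < φ) (h' : φ < (α + π / 2) / 2) :
    limitDensity Ψ φ α = sin φ * (1 + sin (α - 2 * φ)) := by
  rw [limitDensity, if_neg (by linarith), if_neg (by linarith), min_eq_left]
  rw [← cos_pi_div_two_sub, ← cos_abs (φ - α)]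
  refine cos_le_cos_of_nonneg_of_le_pi (abs_nonneg _) (by linarith) (abs_le.2 ⟨?_, ?_⟩) <;>
    linarith

lemma limitDensity_of_ge_quarter (hα1 : -Ψ < α) (hα2 : α < Ψ) {φ : ℝ}
    (h : (α + π / 2) / 2 < φ) (h' : φ < (α + π - Ψ) / 2) :
    limitDensity Ψ φ α = cos (φ - α) * (1 + sin (α - 2 * φ)) := by
  rw [limitDensity, if_neg (by linarith), if_neg (by linarith), min_eq_right]
  rw [← cos_pi_div_two_sub, ← cos_abs (π / 2 - φ)]
  refine cos_le_cos_of_nonneg_of_le_pi (abs_nonneg _) (by linarith) (abs_le.2 ⟨?_, ?_⟩) <;>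
    linarith

lemma integral_two_mul_sin_pow_three (u : ℝ) :
    ∫ φ in (0 : ℝ)..u, 2 * sin φ ^ 3 = -2 * cos u + 2 / 3 * cos u ^ 3 + 4 / 3 := by
  rw [intervalIntegral.integral_eq_sub_of_hasDerivAt
    (f := fun x => -2 * cos x + 2 / 3 * cos x ^ 3) (fun x _ => ?_)
    (Continuous.intervalIntegrable (by fun_prop) _ _)]
  · simp; ring
  · refine HasDerivAt.congr_deriv (((hasDerivAt_cos x).const_mul (-2)).add
      (((hasDerivAt_cos x).pow 3).const_mul (2 / 3))) ?_
    have := sin_sq_add_cos_sq x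
    simp
    linear_combination (-2 * sin x) * this

lemma integral_sin_mul_density (α u v : ℝ) :
    ∫ φ in u..v, sin φ * (1 + sin (α - 2 * φ)) =
      (-cos v + sin (3 * v - α) / 6 - sin (v - α) / 2) -
        (-cos u + sin (3 * u - α) / 6 - sin (u - α) / 2) := by
  rw [intervalIntegral.integral_eq_sub_of_hasDerivAt
    (f := fun x => -cos x + sin (3 * x - α) / 6 - sin (x - α) / 2) (fun x _ => ?_)
    (Continuous.intervalIntegrable (by fun_prop) _ _)]
  have h3 : HasDerivAt (fun x : ℝ => sin (3 * x - α)) (cos (3 * x - α) * 3) x := by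
    simpa using (((hasDerivAt_id x).const_mul 3).sub_const α).sin
  have h1 : HasDerivAt (fun x : ℝ => sin (x - α)) (cos (x - α)) x := by
    simpa using ((hasDerivAt_id x).sub_const α).sin
  refine HasDerivAt.congr_deriv (((hasDerivAt_cos x).neg.add (h3.div_const 6)).sub
    (h1.div_const 2)) ?_
  rw [show 3 * x - α = x - (α - 2 * x) by ring, show x - α = -((α - 2 * x) + x) by ring, cos_neg,
    cos_sub, cos_add]
  ring

lemma integral_cos_mul_density (α u v : ℝ) :
    ∫ φ in u..v, cos (φ - α) * (1 + sin (α - 2 * φ)) =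
      (sin (v - α) + cos v / 2 + cos (3 * v - 2 * α) / 6) -
        (sin (u - α) + cos u / 2 + cos (3 * u - 2 * α) / 6) := by
  rw [intervalIntegral.integral_eq_sub_of_hasDerivAt
    (f := fun x => sin (x - α) + cos x / 2 + cos (3 * x - 2 * α) / 6) (fun x _ => ?_)
    (Continuous.intervalIntegrable (by fun_prop) _ _)]
  have h3 : HasDerivAt (fun x : ℝ => cos (3 * x - 2 * α)) (-sin (3 * x - 2 * α) * 3) x := by
    simpa using (((hasDerivAt_id x).const_mul 3).sub_const (2 * α)).cos
  have h1 : HasDerivAt (fun x : ℝ => sin (x - α)) (cos (x - α)) x := by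
    simpa using ((hasDerivAt_id x).sub_const α).sin
  refine HasDerivAt.congr_deriv ((h1.add ((hasDerivAt_cos x).div_const 2)).add
    (h3.div_const 6)) ?_
  have e1 : sin (3 * x - 2 * α) = sin ((x - α) - (α - 2 * x)) := by congr 1; ring
  have e2 : sin x = -sin ((α - 2 * x) + (x - α)) := by rw [← sin_neg]; congr 1; ring
  rw [e1, e2, sin_sub, sin_add]
  ring

/-- For fixed `α` the density is elementary on four intervals of `φ`: two impacts up to `(α + Ψ) /
2`; then one impact with splitting up to `(α + π / 2) / 2`, where `sin φ = cos (φ - α)`; then one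
impact without splitting up to `(α + π - Ψ) / 2`; beyond that the point is invisible. -/
lemma integral_limitDensity_left (hΨ : Ψ ≤ π / 2) (hα1 : -Ψ < α) (hα2 : α < Ψ) :
    ∫ φ in (0 : ℝ)..(π / 2), limitDensity Ψ φ α =
      4 / 3 + 2 / 3 * cos ((α + Ψ) / 2) ^ 3 - 8 / 3 * cos (α / 2 + π / 4) + sin ((Ψ - α) / 2) -
        1 / 3 * sin ((α + 3 * Ψ) / 2) := by
  have hint := intervalIntegrable_limitDensity_left Ψ α
  have i1 : ∫ φ in (0 : ℝ)..((α + Ψ) / 2), limitDensity Ψ φ α = ∫ φ in (0 : ℝ)..((α + Ψ) / 2),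
      2 * sin φ ^ 3 := by
    refine intervalIntegral.integral_congr_Ioo_of_le (by linarith) fun φ hφ => ?_
    exact limitDensity_of_lt_double hΨ hα1 hα2 hφ.1.le hφ.2
  have i2 : ∫ φ in ((α + Ψ) / 2)..((α + π / 2) / 2), limitDensity Ψ φ α =
      ∫ φ in ((α + Ψ) / 2)..((α + π / 2) / 2), sin φ * (1 + sin (α - 2 * φ)) := by
    refine intervalIntegral.integral_congr_Ioo_of_le (by linarith) fun φ hφ => ?_
    exact limitDensity_of_le_quarter hα1 hα2 hφ.1 hφ.2
  have i3 : ∫ φ in ((α + π / 2) / 2)..((α + π - Ψ) / 2), limitDensity Ψ φ α =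
      ∫ φ in ((α + π / 2) / 2)..((α + π - Ψ) / 2), cos (φ - α) * (1 + sin (α - 2 * φ)) := by
    refine intervalIntegral.integral_congr_Ioo_of_le (by linarith) fun φ hφ => ?_
    exact limitDensity_of_ge_quarter hα1 hα2 hφ.1 hφ.2
  have i4 : ∫ φ in ((α + π - Ψ) / 2)..(π / 2), limitDensity Ψ φ α =
      ∫ φ in ((α + π - Ψ) / 2)..(π / 2), (0 : ℝ) := by
    refine intervalIntegral.integral_congr_Ioo_of_le (by linarith) fun φ hφ => ?_
    exact if_pos (by linarith [hφ.1])
  rw [← intervalIntegral.integral_add_adjacent_intervals (hint 0 ((α + π - Ψ) / 2)) (hint _ _),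
    ← intervalIntegral.integral_add_adjacent_intervals (hint 0 ((α + π / 2) / 2)) (hint _ _),
    ← intervalIntegral.integral_add_adjacent_intervals (hint 0 ((α + Ψ) / 2)) (hint _ _),
    i1, i2, i3, i4, integral_two_mul_sin_pow_three, integral_sin_mul_density,
    integral_cos_mul_density, intervalIntegral.integral_zero]
  have e1 : (α + π / 2) / 2 = α / 2 + π / 4 := by ring
  have e2 : sin (3 * (α / 2 + π / 4) - α) = cos (α / 2 + π / 4) := by
    rw [← sin_pi_div_two_sub, ← sin_pi_sub]; congr 1; ring
  have e3 : sin (α / 2 + π / 4 - α) = cos (α / 2 + π / 4) := by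
    rw [← sin_pi_div_two_sub]; congr 1; ring
  have e4 : cos (3 * (α / 2 + π / 4) - 2 * α) = -cos (α / 2 + π / 4) := by
    rw [← cos_pi_sub]; congr 1; ring
  have e5 : sin ((α + π - Ψ) / 2 - α) = cos ((α + Ψ) / 2) := by
    rw [← sin_pi_div_two_sub]; congr 1; ring
  have e6 : cos ((α + π - Ψ) / 2) = sin ((Ψ - α) / 2) := by
    rw [← cos_pi_div_two_sub]; congr 1; ring
  have e7 : cos (3 * ((α + π - Ψ) / 2) - 2 * α) = -sin ((α + 3 * Ψ) / 2) := by
    rw [← cos_pi_div_two_sub, ← cos_pi_sub, ← cos_neg, ← cos_add_two_pi]; congr 1; ring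
  have e8 : 3 * ((α + Ψ) / 2) - α = (α + 3 * Ψ) / 2 := by ring
  have e9 : sin ((α + Ψ) / 2 - α) = sin ((Ψ - α) / 2) := by congr 1; ring
  rw [e1, e2, e3, e4, e5, e6, e7, e8, e9]
  ring

lemma integral_limitDensity_swap (hΨ : 0 ≤ Ψ) :
    ∫ φ in (0 : ℝ)..(π / 2), ∫ α in (-Ψ)..Ψ, limitDensity Ψ φ α =
      ∫ α in (-Ψ)..Ψ, ∫ φ in (0 : ℝ)..(π / 2), limitDensity Ψ φ α := by
  have hpi : (0 : ℝ) ≤ π / 2 := by positivity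
  simp only [intervalIntegral.integral_of_le hpi,
    intervalIntegral.integral_of_le (show -Ψ ≤ Ψ by linarith)]
  refine integral_integral_swap (f := fun φ α => limitDensity Ψ φ α) ?_
  refine Integrable.of_bound (C := 2) (measurable_limitDensity Ψ).aestronglyMeasurable ?_
  exact Filter.Eventually.of_forall fun z => abs_limitDensity_le Ψ z.1 z.2

lemma integral_integral_limitDensity (h0 : 0 < Ψ) (hΨ : Ψ ≤ π / 2) :
    ∫ φ in (0 : ℝ)..(π / 2), ∫ α in (-Ψ)..Ψ, limitDensity Ψ φ α =
      8 / 3 * Ψ + 4 / 3 * (sin Ψ - sin Ψ ^ 3 / 3) - 16 / 3 * √2 * sin (Ψ / 2) +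
        2 * (1 - cos Ψ) - 2 / 3 * (cos Ψ - cos (2 * Ψ)) := by
  rw [integral_limitDensity_swap h0.le, intervalIntegral.integral_congr_Ioo_of_le (by linarith)
    fun α hα => integral_limitDensity_left hΨ hα.1 hα.2]
  rw [intervalIntegral.integral_eq_sub_of_hasDerivAt
    (f := fun α => 4 / 3 * α + 2 / 3 * (2 * sin ((α + Ψ) / 2) - 2 / 3 * sin ((α + Ψ) / 2) ^ 3) -
      16 / 3 * sin (α / 2 + π / 4) + 2 * cos ((Ψ - α) / 2) + 2 / 3 * cos ((α + 3 * Ψ) / 2))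
    (fun x _ => ?_) (Continuous.intervalIntegrable (by fun_prop) _ _)]
  · have e1 : sin (Ψ / 2 + π / 4) - sin (-Ψ / 2 + π / 4) = √2 * sin (Ψ / 2) := by
      rw [neg_div, sin_add, sin_add, sin_neg, cos_neg, cos_pi_div_four, sin_pi_div_four]; ring
    rw [show (Ψ + Ψ) / 2 = Ψ by ring, show (-Ψ + Ψ) / 2 = 0 by ring,
      show (Ψ - Ψ) / 2 = 0 by ring, show (Ψ - -Ψ) / 2 = Ψ by ring,
      show (Ψ + 3 * Ψ) / 2 = 2 * Ψ by ring, show (-Ψ + 3 * Ψ) / 2 = Ψ by ring, sin_zero, cos_zero]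
    linear_combination (-16 / 3) * e1
  · have h1 : HasDerivAt (fun x : ℝ => (x + Ψ) / 2) (1 / 2) x :=
      ((hasDerivAt_id x).add_const Ψ).div_const 2
    have h2 : HasDerivAt (fun x : ℝ => x / 2 + π / 4) (1 / 2) x :=
      ((hasDerivAt_id x).div_const 2).add_const _
    have h3 : HasDerivAt (fun x : ℝ => (Ψ - x) / 2) (-1 / 2) x :=
      ((hasDerivAt_id x).const_sub Ψ).div_const 2
    have h4 : HasDerivAt (fun x : ℝ => (x + 3 * Ψ) / 2) (1 / 2) x :=
      ((hasDerivAt_id x).add_const _).div_const 2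
    refine HasDerivAt.congr_deriv ((((((hasDerivAt_id x).const_mul (4 / 3)).add
      (((h1.sin.const_mul 2).sub ((h1.sin.pow 3).const_mul (2 / 3))).const_mul (2 / 3))).sub
      (h2.sin.const_mul (16 / 3))).add (h3.cos.const_mul 2)).add (h4.cos.const_mul (2 / 3))) ?_
    have := sin_sq_add_cos_sq ((x + Ψ) / 2)
    simp
    linear_combination (-2 / 3 * cos ((x + Ψ) / 2)) * this

/-- The limit resistance in terms of the density of the deficit. -/
theorem limitResistance_eq (h0 : 0 < Ψ) (hΨ : Ψ ≤ π / 2) :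
    limitResistance Ψ = 3 / 2 - 3 / (8 * sin Ψ) *
      ∫ φ in (0 : ℝ)..(π / 2), ∫ α in (-Ψ)..Ψ, limitDensity Ψ φ α := by
  have hs : sin Ψ ≠ 0 := (sin_pos_of_pos_of_lt_pi h0 (by linarith [pi_pos])).ne'
  have hc : cos Ψ = 1 - 2 * sin (Ψ / 2) ^ 2 := by
    rw [← cos_sq_add_sin_sq (Ψ / 2)]
    conv_lhs => rw [show Ψ = 2 * (Ψ / 2) by ring, cos_two_mul']
    ring_nf
  rw [integral_integral_limitDensity h0 hΨ, limitResistance, cos_two_mul, hc]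
  field_simp
  ring

end LimitValue

end
noncomputable section
open Real MeasureTheory

/-! ### The pseudo-billiard -/

section PseudoBilliard

variable {Ψ : ℝ} {p : ℝ × ℝ} {θ α β φ : ℝ}

lemma HitsArc.congr (h : HitsArc Ψ p θ α) {θ' : ℝ} (e : heading θ = heading θ') :
    HitsArc Ψ p θ' α := by
  obtain ⟨h1, t, ht, h2⟩ := h
  exact ⟨h1, t, ht, e ▸ h2⟩

lemma flipPt_arcPoint (hs : sin Ψ ≠ 0) (α : ℝ) : flipPt (arcPoint Ψ α) = arcPoint Ψ (-α) := by
  ext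
  · simp only [arcPoint, flipPt, sin_neg]
    field_simp
    ring
  · simp [arcPoint, flipPt]

lemma HitsArc.flip (hs : sin Ψ ≠ 0) (h : HitsArc Ψ p θ α) : HitsArc Ψ (flipPt p) (-θ) (-α) := by
  obtain ⟨h1, t, ht, h2⟩ := h
  refine ⟨⟨by linarith [h1.2], by linarith [h1.1]⟩, t, ht, ?_⟩
  rw [← flipVec_heading, ← flip_add_smul, h2, flipPt_arcPoint hs]

lemma HitsArc.of_flip (hs : sin Ψ ≠ 0) (h : HitsArc Ψ (flipPt p) (-θ) β) :
    HitsArc Ψ p θ (-β) := by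
  simpa [flipPt_flipPt] using h.flip hs

/-- The chord from a point of the arc to another one determines the heading. -/
lemma HitsArc.cos_eq_one (hs : 0 < sin Ψ) (hΨ : Ψ ≤ π / 2) (hα : α ∈ Set.Ioo (-Ψ) Ψ)
    (h : HitsArc Ψ (arcPoint Ψ α) θ β) :
    (α < β ∧ cos ((α + β) / 2 + π / 2 - θ) = 1) ∨
      (β < α ∧ cos ((α + β) / 2 - π / 2 - θ) = 1) := by
  obtain ⟨hβ, t, ht, h2⟩ := h
  have x1 := congr_arg Prod.fst h2
  have x2 := congr_arg Prod.snd h2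
  simp only [arcPoint, heading, Prod.fst_add, Prod.snd_add, Prod.smul_fst, Prod.smul_snd,
    smul_eq_mul] at x1 x2
  set c := 2 * sin ((β - α) / 2) with hc
  set m := (α + β) / 2 with hm
  have y1 : 2 * sin Ψ * t * sin θ = c * cos m := by
    have : sin β - sin α = c * cos m := by rw [sin_sub_sin, add_comm β α]
    rw [← this]
    field_simp at x1
    linarith
  have y2 : 2 * sin Ψ * t * cos θ = -(c * sin m) := by
    have : cos β - cos α = -(c * sin m) := by rw [cos_sub_cos, add_comm β α, hc]; ring
    rw [← this]
    field_simp at x2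
    linarith
  set T := 2 * sin Ψ * t with hT
  have hTpos : 0 < T := by positivity
  have z0 : cos (m + π / 2 - θ) = cos m * sin θ - sin m * cos θ := by
    rw [show m + π / 2 - θ = π / 2 - (θ - m) by ring, cos_pi_div_two_sub, sin_sub]; ring
  have z1 : cos (m - π / 2 - θ) = -cos (m + π / 2 - θ) := by
    rw [← cos_sub_pi]; congr 1; ring
  set X := cos (m + π / 2 - θ)
  have e1 : T = c * X := by
    linear_combination sin θ * y1 + cos θ * y2 - T * sin_sq_add_cos_sq θ - c * z0
  have e2 : T ^ 2 = c ^ 2 := by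
    linear_combination (T * sin θ + c * cos m) * y1 + (T * cos θ - c * sin m) * y2 -
      T ^ 2 * sin_sq_add_cos_sq θ + c ^ 2 * sin_sq_add_cos_sq m
  have hX : X ^ 2 = 1 := by
    have : c ^ 2 * (X ^ 2 - 1) = 0 := by
      rw [← e2]
      linear_combination (-(T + c * X)) * e1 + X ^ 2 * e2
    rcases mul_eq_zero.1 this with h | h
    · rw [← e2] at h; exact absurd h (by positivity)
    · linarith
  have hle := cos_le_one (m + π / 2 - θ)
  rcases lt_trichotomy α β with hlt | heq | hlt
  · refine .inl ⟨hlt, ?_⟩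
    -- The relation `X ^ 2 = 1` leaves a sign. Since `T = c * X` and `T > 0`, it is the sign of `c`,
    -- that is, of `β - α`.
    have : 0 < c := mul_pos two_pos
      (sin_pos_of_pos_of_lt_pi (by linarith) (by linarith [hα.1, hβ.2]))
    have : 0 < X := pos_of_mul_pos_right (e1 ▸ hTpos) this.le
    nlinarith
  · rw [heq, sub_self, zero_div, sin_zero, mul_zero] at hc
    rw [e1, hc, zero_mul] at hTpos
    exact absurd hTpos (lt_irrefl 0)
  · refine .inr ⟨hlt, ?_⟩
    have : c < 0 := mul_neg_of_pos_of_neg two_pos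
      (sin_neg_of_neg_of_neg_pi_lt (by linarith) (by linarith [hα.2, hβ.1]))
    have : X < 0 := by
      by_contra! hX0
      linarith [mul_nonpos_of_nonpos_of_nonneg this.le hX0]
    rw [z1]
    nlinarith [neg_one_le_cos (m + π / 2 - θ)]

/-- The inscribed angle theorem: the outgoing line meets the circle again at `α - 2 * φ`, and the
only question is whether this point belongs to the arc. The flight time `sin φ / sin Ψ` is the
length of that chord of the circle of radius `1 / (2 * sin Ψ)`. -/
lemma hitsArc_second_iff (h0 : 0 < Ψ) (hΨ : Ψ ≤ π / 2) (hφ0 : 0 < φ) (hφ1 : φ < π / 2)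
    (hα : α ∈ Set.Ioo (-Ψ) Ψ) :
    HitsArc Ψ (arcPoint Ψ α) (π / 2 + α - φ + π) β ↔ β = α - 2 * φ ∧ 2 * φ < α + Ψ := by
  have hs : 0 < sin Ψ := sin_pos_of_pos_of_lt_pi h0 (by linarith [pi_pos])
  constructor
  · intro h
    have hβ := h.1
    rcases h.cos_eq_one hs hΨ hα with ⟨hlt, h1⟩ | ⟨hlt, h1⟩
    · have e : (α + β) / 2 + π / 2 - (π / 2 + α - φ + π) = (β - α) / 2 + φ - π := by ring
      rw [e, cos_eq_one_iff_of_lt_of_lt (by linarith) (by linarith [hβ.2, hα.1])] at h1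
      linarith [hβ.2, hα.1]
    · have e : (α + β) / 2 - π / 2 - (π / 2 + α - φ + π) = (β - α) / 2 + φ - 2 * π := by ring
      rw [e, cos_sub_two_pi, cos_eq_one_iff_of_lt_of_lt (by linarith [hβ.1, hα.2])
        (by linarith [hβ.2, hα.1])] at h1
      exact ⟨by linarith, by linarith [hβ.1]⟩
  · rintro ⟨rfl, h⟩
    refine ⟨⟨by linarith, by linarith [hα.2]⟩, sin φ / sin Ψ, ?_, ?_⟩
    · exact div_pos (sin_pos_of_pos_of_lt_pi hφ0 (by linarith)) hs
    · have e1 : sin (π / 2 + α - φ + π) = -cos (α - φ) := by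
        rw [sin_add_pi, add_sub_assoc, add_comm, sin_add_pi_div_two]
      have e2 : cos (π / 2 + α - φ + π) = sin (α - φ) := by
        rw [cos_add_pi, add_sub_assoc, add_comm, cos_add_pi_div_two, neg_neg]
      have e3 : sin (α - 2 * φ) = sin ((α - φ) - φ) := by congr 1; ring
      have e4 : cos (α - 2 * φ) = cos ((α - φ) - φ) := by congr 1; ring
      have e5 : sin α = sin ((α - φ) + φ) := by congr 1; ring
      have e6 : cos α = cos ((α - φ) + φ) := by congr 1; ring
      ext
      · simp only [arcPoint, heading, Prod.fst_add, Prod.smul_fst, smul_eq_mul, e1, e3, e5]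
        rw [sin_add (α - φ), sin_sub (α - φ)]
        field_simp
        ring
      · simp only [arcPoint, heading, Prod.snd_add, Prod.smul_snd, smul_eq_mul, e2, e4, e6]
        rw [cos_add (α - φ), cos_sub (α - φ)]
        field_simp
        ring

/-- The other point of the circle on this line has the parameter `π - α`, which exceeds `Ψ` because
`α < Ψ ≤ π / 2`. -/
lemma not_hitsArc_third (h0 : 0 < Ψ) (hΨ : Ψ ≤ π / 2) (hφ0 : 0 < φ)
    (hα : α < Ψ) (h2 : 2 * φ < α + Ψ) :
    ¬ HitsArc Ψ (arcPoint Ψ (α - 2 * φ)) (-φ + π) β := by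
  have hs : 0 < sin Ψ := sin_pos_of_pos_of_lt_pi h0 (by linarith [pi_pos])
  intro h
  have hβ := h.1
  rcases h.cos_eq_one hs hΨ ⟨by linarith, by linarith⟩ with ⟨hlt, h1⟩ | ⟨hlt, h1⟩
  · have e : (α - 2 * φ + β) / 2 + π / 2 - (-φ + π) = (α + β) / 2 - π / 2 := by ring
    rw [e, cos_eq_one_iff_of_lt_of_lt (by linarith [hβ.1]) (by linarith [hβ.2])] at h1
    linarith [hβ.2]
  · have e : (α - 2 * φ + β) / 2 - π / 2 - (-φ + π) = (α + β) / 2 - 3 * π / 2 := by ring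
    rw [e, cos_eq_one_iff_of_lt_of_lt (by linarith [hβ.1]) (by linarith [hβ.2])] at h1
    linarith [hβ.2]

/-- The other point of the circle on this line has the parameter `2 * φ - π - α`; by `hlo` it is
below `-Ψ`. -/
lemma not_hitsArc_back (h0 : 0 < Ψ) (hΨ : Ψ ≤ π / 2) (hφ0 : 0 < φ) (hφ1 : φ < π / 2)
    (hα : α ∈ Set.Ioo (-Ψ) Ψ) (hlo : 2 * φ - π + Ψ < α) :
    ¬ HitsArc Ψ (arcPoint Ψ α) (φ + π) β := by
  have hs : 0 < sin Ψ := sin_pos_of_pos_of_lt_pi h0 (by linarith [pi_pos])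
  intro h
  have hβ := h.1
  rcases h.cos_eq_one hs hΨ hα with ⟨hlt, h1⟩ | ⟨hlt, h1⟩
  · have e : (α + β) / 2 + π / 2 - (φ + π) = (α + β) / 2 - φ - π / 2 := by ring
    rw [e, cos_eq_one_iff_of_lt_of_lt (by linarith [hβ.1, hα.1]) (by linarith [hβ.2, hα.2])] at h1
    linarith [hβ.2, hα.2]
  · have e : (α + β) / 2 - π / 2 - (φ + π) = (α + β) / 2 - φ + π / 2 - 2 * π := by ring
    rw [e, cos_sub_two_pi, cos_eq_one_iff_of_lt_of_lt (by linarith [hβ.1, hα.1])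
      (by linarith [hβ.2, hα.2])] at h1
    linarith [hβ.1, hα.1]

/-! ### Sums over the splinters -/

lemma hasSum_splinterSum_of_not_hits (g : ℝ → ℝ) (h : ∀ α, ¬ HitsArc Ψ p θ α) :
    HasSum (fun r => splinterSum Ψ g r p θ) (g (θ - π)) := by
  have h' : ¬ ∃ α, HitsArc Ψ p θ α := fun ⟨α, hα⟩ => h α hα
  have : ∀ r, r ≠ 0 → splinterSum Ψ g r p θ = 0 := by
    intro r hr
    obtain ⟨r, rfl⟩ := Nat.exists_eq_succ_of_ne_zero hr
    rw [splinterSum, dif_neg h']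
  convert hasSum_single 0 this using 1
  rw [splinterSum, if_neg h']

lemma splinterSum_zero_of_hits (g : ℝ → ℝ) (h : HitsArc Ψ p θ α) :
    splinterSum Ψ g 0 p θ = 0 := by
  rw [splinterSum, if_pos ⟨α, h⟩]

/-- The point of impact in `splinterSum` is a chosen one, so uniqueness `hu` is needed to identify
it. An impact shifts the count of reflections by one, and the term for zero reflections vanishes. -/
lemma hasSum_splinterSum_whole {g : ℝ → ℝ} (h : HitsArc Ψ p θ α)
    (hu : ∀ β, HitsArc Ψ p θ β → β = α) {ψ S : ℝ}
    (hψ : (if 0 < sin θ then π / 2 else -(π / 2)) + α - θ = ψ) (hm : ¬ |sin θ| < cos (θ - α))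
    (hS : HasSum (fun r => splinterSum Ψ g r (arcPoint Ψ α) (ψ + π)) S) :
    HasSum (fun r => splinterSum Ψ g r p θ) S := by
  have hex : ∃ β, HitsArc Ψ p θ β := ⟨α, h⟩
  have hc : hex.choose = α := hu _ hex.choose_spec
  have hr : ∀ r, splinterSum Ψ g (r + 1) p θ = splinterSum Ψ g r (arcPoint Ψ α) (ψ + π) := by
    intro r
    rw [splinterSum, dif_pos hex]
    simp only [hc, if_neg hm, ← hψ]
  have := (hasSum_nat_add_iff (f := fun r => splinterSum Ψ g r p θ) 1).1
    (by simpa only [hr] using hS)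
  simpa [splinterSum_zero_of_hits g h] using this

lemma hasSum_splinterSum_split {g : ℝ → ℝ} (h : HitsArc Ψ p θ α)
    (hu : ∀ β, HitsArc Ψ p θ β → β = α) {ψ S S' : ℝ}
    (hψ : (if 0 < sin θ then π / 2 else -(π / 2)) + α - θ = ψ) (hm : |sin θ| < cos (θ - α))
    (hS : HasSum (fun r => splinterSum Ψ g r (arcPoint Ψ α) (ψ + π)) S)
    (hS' : HasSum (fun r => splinterSum Ψ g r (arcPoint Ψ α) (θ + π)) S') :
    HasSum (fun r => splinterSum Ψ g r p θ)
      (|sin θ| / cos (θ - α) * S + (1 - |sin θ| / cos (θ - α)) * S') := by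
  have hex : ∃ β, HitsArc Ψ p θ β := ⟨α, h⟩
  have hc : hex.choose = α := hu _ hex.choose_spec
  have hr : ∀ r, splinterSum Ψ g (r + 1) p θ =
      |sin θ| / cos (θ - α) * splinterSum Ψ g r (arcPoint Ψ α) (ψ + π) +
        (1 - |sin θ| / cos (θ - α)) * splinterSum Ψ g r (arcPoint Ψ α) (θ + π) := by
    intro r
    rw [splinterSum, dif_pos hex]
    simp only [hc, if_pos hm, ← hψ]
  have hsum := (hS.mul_left (|sin θ| / cos (θ - α))).add
    (hS'.mul_left (1 - |sin θ| / cos (θ - α)))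
  have := (hasSum_nat_add_iff (f := fun r => splinterSum Ψ g r p θ) 1).1
    (by simpa only [hr] using hsum)
  simpa [splinterSum_zero_of_hits g h] using this

end PseudoBilliard

end
noncomputable section
open Real MeasureTheory

section PseudoBilliard

variable {Ψ : ℝ} {p : ℝ × ℝ} {θ α β φ : ℝ}

/-- The deficit of the splinter that is reflected first by the mirror law. -/
lemma limitDensity_eq_mul (hφ : 0 < cos (φ - α)) (hlo : 2 * φ - π + Ψ < α) :
    2 - limitDensity Ψ φ α / cos (φ - α) =
      if sin φ < cos (φ - α) then
        sin φ / cos (φ - α) *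
          (2 - if 2 * φ < α + Ψ then 1 - cos (2 * φ) else 1 + sin (α - 2 * φ)) +
          (1 - sin φ / cos (φ - α)) * 2
      else 2 - if 2 * φ < α + Ψ then 1 - cos (2 * φ) else 1 + sin (α - 2 * φ) := by
  rw [limitDensity, if_neg (not_le.2 hlo)]
  by_cases hm : sin φ < cos (φ - α)
  · rw [if_pos hm, min_eq_left hm.le]
    field_simp
    ring
  · rw [if_neg hm, min_eq_right (not_lt.1 hm)]
    field_simp

/-- The first impact exchanges `sin φ` and `cos (φ - α)`. At the second impact this inequality
therefore excludes a further splitting. -/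
lemma sin_lt_cos_sub (hΨ : Ψ ≤ π / 2) (hφ0 : 0 < φ) (hα : α < Ψ) (h2 : 2 * φ < α + Ψ) :
    sin φ < cos (φ - α) := by
  rw [← cos_pi_div_two_sub]
  refine cos_sub_cos_lt_of_abs ?_ (abs_le.2 ⟨by linarith [pi_pos], by linarith [pi_pos]⟩)
  rw [abs_of_pos (show 0 < π / 2 - φ by linarith)]
  exact abs_lt.2 ⟨by linarith, by linarith⟩

/-- The total of the splinters of a particle that moves to the right. -/
lemma hasSum_splinterSum_right (h0 : 0 < Ψ) (hΨ : Ψ ≤ π / 2) (hφ0 : 0 < φ) (hφ1 : φ < π / 2)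
    (hlo : 2 * φ - π + Ψ < α) (h : HitsArc Ψ p φ α) (hu : ∀ β, HitsArc Ψ p φ β → β = α) :
    HasSum (fun r => splinterSum Ψ (fun ψ => 1 + cos (ψ - φ)) r p φ)
      (2 - limitDensity Ψ φ α / cos (φ - α)) := by
  have hα := h.1
  have hsin : 0 < sin φ := sin_pos_of_pos_of_lt_pi hφ0 (by linarith)
  have hcos : 0 < cos (φ - α) :=
    cos_pos_of_mem_Ioo ⟨by linarith [hα.2], by linarith [hα.1]⟩
  have hψ : (if 0 < sin φ then π / 2 else -(π / 2)) + α - φ = π / 2 + α - φ := by rw [if_pos hsin]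
  have hS : HasSum (fun r => splinterSum Ψ (fun ψ => 1 + cos (ψ - φ)) r (arcPoint Ψ α)
      (π / 2 + α - φ + π))
      (2 - if 2 * φ < α + Ψ then 1 - cos (2 * φ) else 1 + sin (α - 2 * φ)) := by
    have hit := fun β => hitsArc_second_iff (β := β) h0 hΨ hφ0 hφ1 hα
    split_ifs with h2
    · have e1 : sin (π / 2 + α - φ + π) = -cos (φ - α) := by
        rw [sin_add_pi, add_sub_assoc, add_comm, sin_add_pi_div_two, ← cos_neg, neg_sub]
      have e2 : cos (π / 2 + α - φ + π - (α - 2 * φ)) = sin φ := by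
        rw [← cos_pi_div_two_sub, ← cos_neg, ← cos_add_two_pi]; congr 1; ring
      have hlt := sin_lt_cos_sub hΨ hφ0 hα.2 h2
      -- The reflection rule produces the angle `-φ` only up to a full turn.
      refine hasSum_splinterSum_whole (ψ := -φ - 2 * π) ((hit _).2 ⟨rfl, h2⟩)
        (fun β hβ => ((hit β).1 hβ).1) ?_ ?_ ?_
      · rw [e1, if_neg (by linarith)]; ring
      · rw [e1, e2, abs_neg, abs_of_pos hcos]; exact not_lt.2 hlt.le
      · have hh : heading (-φ - 2 * π + π) = heading (-φ + π) := by
          rw [heading, heading, show -φ - 2 * π + π = -φ + π - 2 * π by ring, sin_sub_two_pi,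
            cos_sub_two_pi]
        convert hasSum_splinterSum_of_not_hits (fun ψ => 1 + cos (ψ - φ)) (fun β hβ =>
          not_hitsArc_third h0 hΨ hφ0 hα.2 h2 (hβ.congr hh)) using 1
        rw [show -φ - 2 * π + π - π - φ = -(2 * φ) - 2 * π by ring, cos_sub_two_pi, cos_neg]
        ring
    · convert hasSum_splinterSum_of_not_hits (fun ψ => 1 + cos (ψ - φ)) (fun β hβ =>
          h2 ((hit β).1 hβ).2) using 1
      rw [show π / 2 + α - φ + π - π - φ = α - 2 * φ + π / 2 by ring, cos_add_pi_div_two]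
      ring
  rw [limitDensity_eq_mul hcos hlo]
  by_cases hm : sin φ < cos (φ - α)
  · rw [if_pos hm]
    have hm' : |sin φ| < cos (φ - α) := by rwa [abs_of_pos hsin]
    have hS' := hasSum_splinterSum_of_not_hits (fun ψ => 1 + cos (ψ - φ)) (fun β =>
      not_hitsArc_back (β := β) h0 hΨ hφ0 hφ1 hα hlo)
    have := hasSum_splinterSum_split h hu hψ hm' hS hS'
    rwa [abs_of_pos hsin, add_sub_cancel_right, sub_self, cos_zero, one_add_one_eq_two] at this
  · rw [if_neg hm]
    exact hasSum_splinterSum_whole h hu hψ (by rwa [abs_of_pos hsin]) hS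

/-- The total of the splinters of a particle that moves to the left. -/
lemma hasSum_splinterSum_left (h0 : 0 < Ψ) (hΨ : Ψ ≤ π / 2) (hφ0 : 0 < φ) (hφ1 : φ < π / 2)
    (hlo : 2 * φ - π + Ψ < α) (h : HitsArc Ψ p φ α) (hu : ∀ β, HitsArc Ψ p φ β → β = α) :
    HasSum (fun r => splinterSum Ψ (fun ψ => 1 + cos (ψ - -φ)) r (flipPt p) (-φ))
      (2 - limitDensity Ψ φ α / cos (φ - α)) := by
  have hα := h.1
  have hs : sin Ψ ≠ 0 := (sin_pos_of_pos_of_lt_pi h0 (by linarith [pi_pos])).ne'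
  have hsin : 0 < sin φ := sin_pos_of_pos_of_lt_pi hφ0 (by linarith)
  have hcos : 0 < cos (φ - α) :=
    cos_pos_of_mem_Ioo ⟨by linarith [hα.2], by linarith [hα.1]⟩
  have h' := h.flip hs
  have hu' : ∀ β, HitsArc Ψ (flipPt p) (-φ) β → β = -α := fun β hβ => by
    linarith [hu _ (hβ.of_flip hs)]
  have hψ : (if 0 < sin (-φ) then π / 2 else -(π / 2)) + -α - -φ = -(π / 2 + α - φ) := by
    rw [sin_neg, if_neg (by linarith)]; ring
  have hcα : cos (-φ - -α) = cos (φ - α) := by rw [← cos_neg]; congr 1; ring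
  have hsα : |sin (-φ)| = sin φ := by rw [sin_neg, abs_neg, abs_of_pos hsin]
  have hback : ∀ ψ β : ℝ, HitsArc Ψ (arcPoint Ψ (-α)) (-ψ + π) β →
      HitsArc Ψ (arcPoint Ψ α) (ψ + π) (-β) := by
    intro ψ β hβ
    rw [← flipPt_arcPoint hs] at hβ
    refine (HitsArc.of_flip (θ := ψ + π) hs (hβ.congr ?_))
    rw [heading, heading, show -ψ + π = -(ψ + π) + 2 * π by ring, sin_add_two_pi, cos_add_two_pi]
  have hS : HasSum (fun r => splinterSum Ψ (fun ψ => 1 + cos (ψ - -φ)) r (arcPoint Ψ (-α))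
      (-(π / 2 + α - φ) + π))
      (2 - if 2 * φ < α + Ψ then 1 - cos (2 * φ) else 1 + sin (α - 2 * φ)) := by
    have hit := fun β => hitsArc_second_iff (β := β) h0 hΨ hφ0 hφ1 hα
    split_ifs with h2
    · have e1 : sin (-(π / 2 + α - φ) + π) = cos (φ - α) := by
        rw [← sin_pi_div_two_sub, ← sin_pi_sub]; congr 1; ring
      have e2 : cos (-(π / 2 + α - φ) + π - -(α - 2 * φ)) = sin φ := by
        rw [← cos_pi_div_two_sub]; congr 1; ring
      have hlt := sin_lt_cos_sub hΨ hφ0 hα.2 h2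
      have hh : HitsArc Ψ (arcPoint Ψ (-α)) (-(π / 2 + α - φ) + π) (-(α - 2 * φ)) := by
        rw [← flipPt_arcPoint hs]
        refine (((hit _).2 ⟨rfl, h2⟩).flip hs).congr ?_
        rw [heading, heading, show -(π / 2 + α - φ) + π = -(π / 2 + α - φ + π) + 2 * π by ring,
          sin_add_two_pi, cos_add_two_pi]
      -- In the mirrored motion the sine is positive at the second impact, and the rule gives `φ`
      -- without an additional turn.
      refine hasSum_splinterSum_whole (ψ := φ) hh
        (fun β hβ => by linarith [((hit _).1 (hback _ _ hβ)).1]) ?_ ?_ ?_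
      · rw [e1, if_pos hcos]; ring
      · rw [e1, e2, abs_of_pos hcos]; exact not_lt.2 hlt.le
      · convert hasSum_splinterSum_of_not_hits (fun ψ => 1 + cos (ψ - -φ)) (fun β hβ => ?_) using 1
        · rw [show φ + π - π - -φ = 2 * φ by ring]
          ring
        · rw [← flipPt_arcPoint hs] at hβ
          refine not_hitsArc_third (β := -β) h0 hΨ hφ0 hα.2 h2
            (HitsArc.of_flip (θ := -φ + π) hs (hβ.congr ?_))
          rw [heading, heading, show φ + π = -(-φ + π) + 2 * π by ring, sin_add_two_pi,
            cos_add_two_pi]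
    · convert hasSum_splinterSum_of_not_hits (fun ψ => 1 + cos (ψ - -φ)) (fun β hβ =>
          h2 ((hit _).1 (hback _ _ hβ)).2) using 1
      rw [show -(π / 2 + α - φ) + π - π - -φ = -(α - 2 * φ + π / 2) by ring, cos_neg,
        cos_add_pi_div_two]
      ring
  rw [limitDensity_eq_mul hcos hlo]
  by_cases hm : sin φ < cos (φ - α)
  · rw [if_pos hm]
    have hm' : |sin (-φ)| < cos (-φ - -α) := by rwa [hsα, hcα]
    have hS' := hasSum_splinterSum_of_not_hits (fun ψ => 1 + cos (ψ - -φ)) (fun β hβ =>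
      not_hitsArc_back h0 hΨ hφ0 hφ1 hα hlo (hback φ β hβ))
    have := hasSum_splinterSum_split h' hu' hψ hm' hS hS'
    rwa [hsα, hcα, add_sub_cancel_right, sub_self, cos_zero, one_add_one_eq_two] at this
  · rw [if_neg hm]
    exact hasSum_splinterSum_whole h' hu' hψ (by rwa [hsα, hcα]) hS

end PseudoBilliard

end
-- Integration over the arc in place of the axis.
noncomputable section
open Real MeasureTheory

section PseudoBilliard

variable {Ψ α β φ : ℝ}

/-- The starting point on the axis of the particle with heading `φ` that hits the arc at `α`. -/
def arcFoot (Ψ φ α : ℝ) : ℝ := (sin (α - φ) + sin (Ψ + φ)) / (2 * sin Ψ * cos φ)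

lemma hitsArc_arcFoot (h0 : 0 < Ψ) (hΨ : Ψ ≤ π / 2) (hφ : 0 < cos φ) (hα : α ∈ Set.Ioo (-Ψ) Ψ) :
    HitsArc Ψ (arcFoot Ψ φ α, 0) φ α := by
  have hs : 0 < sin Ψ := sin_pos_of_pos_of_lt_pi h0 (by linarith [pi_pos])
  refine ⟨hα, (cos α - cos Ψ) / (2 * sin Ψ * cos φ), div_pos (sub_pos.2 ?_) (by positivity), ?_⟩
  · refine cos_sub_cos_lt_of_abs ?_ ?_ <;> rw [abs_of_pos h0]
    · exact abs_lt.2 ⟨hα.1, hα.2⟩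
    · linarith [pi_pos]
  · ext
    · simp only [arcFoot, arcPoint, heading, Prod.fst_add, Prod.smul_fst, smul_eq_mul]
      rw [sin_sub, sin_add]
      field_simp
      ring
    · simp only [arcPoint, heading, Prod.snd_add, Prod.smul_snd, smul_eq_mul]
      field_simp
      ring

lemma eq_of_hitsArc_arcFoot (h0 : 0 < Ψ) (hΨ : Ψ ≤ π / 2) (hφ0 : 0 < φ) (hφ1 : φ < π / 2)
    (hα : α ∈ Set.Ioo (-Ψ) Ψ) (hlo : 2 * φ - π + Ψ < α)
    (h : HitsArc Ψ (arcFoot Ψ φ α, 0) φ β) : β = α := by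
  have hs : 0 < sin Ψ := sin_pos_of_pos_of_lt_pi h0 (by linarith [pi_pos])
  have hc : 0 < cos φ := cos_pos_of_mem_Ioo ⟨by linarith, hφ1⟩
  obtain ⟨hβ, t, -, ht⟩ := h
  have h1 : offset φ (arcFoot Ψ φ α, 0) = offset φ (arcPoint Ψ β) := by
    rw [← ht]; simp [offset, heading]; ring
  have h2 : 2 * sin Ψ * offset φ (arcFoot Ψ φ α, 0) = sin (α - φ) + sin (Ψ + φ) := by
    simp only [offset, arcFoot]
    field_simp
    ring
  rw [h1, offset_arcPoint hs.ne'] at h2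
  have h3 : sin ((β - α) / 2) * cos ((α + β) / 2 - φ) = 0 := by
    have := sin_sub_sin (β - φ) (α - φ)
    rw [show (β - φ - (α - φ)) / 2 = (β - α) / 2 by ring,
      show (β - φ + (α - φ)) / 2 = (α + β) / 2 - φ by ring] at this
    linarith
  have h4 : cos ((α + β) / 2 - φ) ≠ 0 :=
    (cos_pos_of_mem_Ioo ⟨by linarith [hβ.1], by linarith [hα.2, hβ.2]⟩).ne'
  have h5 := (mul_eq_zero.1 h3).resolve_right h4
  rw [sin_eq_zero_iff_of_lt_of_lt (by linarith [hα.2, hβ.1]) (by linarith [hα.1, hβ.2])] at h5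
  linarith

/-- The first point of the arc that can be seen from the axis in the direction `φ`. -/
def arcStart (Ψ φ : ℝ) : ℝ := max (-Ψ) (2 * φ - π + Ψ)

lemma neg_pi_div_two_le_arcStart_sub : -(π / 2) ≤ arcStart Ψ φ - φ := by
  have h1 := le_max_left (-Ψ) (2 * φ - π + Ψ)
  have h2 := le_max_right (-Ψ) (2 * φ - π + Ψ)
  rw [arcStart]
  linarith

lemma arcStart_lt (h0 : 0 < Ψ) (hφ1 : φ < π / 2) : arcStart Ψ φ < Ψ :=
  max_lt (by linarith) (by linarith)

lemma hasDerivAt_arcFoot (Ψ φ α : ℝ) :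
    HasDerivAt (arcFoot Ψ φ) (cos (α - φ) / (2 * sin Ψ * cos φ)) α := by
  have : HasDerivAt (fun x : ℝ => sin (x - φ)) (cos (α - φ)) α := by
    simpa using ((hasDerivAt_id α).sub_const φ).sin
  exact (this.add_const _).div_const _

lemma strictMonoOn_arcFoot (h0 : 0 < Ψ) (hΨ : Ψ ≤ π / 2) (hφ0 : 0 < φ) (hφ1 : φ < π / 2) :
    StrictMonoOn (arcFoot Ψ φ) (Set.Icc (arcStart Ψ φ) Ψ) := by
  have hs : 0 < sin Ψ := sin_pos_of_pos_of_lt_pi h0 (by linarith [pi_pos])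
  have hc : 0 < cos φ := cos_pos_of_mem_Ioo ⟨by linarith, hφ1⟩
  intro x hx y hy hxy
  have hlo := neg_pi_div_two_le_arcStart_sub (Ψ := Ψ) (φ := φ)
  refine div_lt_div_of_pos_right (add_lt_add_left (strictMonoOn_sin ⟨?_, ?_⟩ ⟨?_, ?_⟩ ?_) _)
    (by positivity) <;> linarith [hx.1, hx.2, hy.1, hy.2]

/-- Both candidates in the maximum lie on the line with heading `φ` through `(0, 0)`. -/
lemma arcFoot_arcStart : arcFoot Ψ φ (arcStart Ψ φ) = 0 := by
  rw [arcFoot, arcStart]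
  rcases max_choice (-Ψ) (2 * φ - π + Ψ) with h | h <;> rw [h]
  · rw [show -Ψ - φ = -(Ψ + φ) by ring, sin_neg, neg_add_cancel, zero_div]
  · rw [show 2 * φ - π + Ψ - φ = Ψ + φ - π by ring, sin_sub_pi, neg_add_cancel, zero_div]

lemma arcFoot_self (hs : sin Ψ ≠ 0) (hc : cos φ ≠ 0) : arcFoot Ψ φ Ψ = 1 := by
  rw [arcFoot, sin_sub, sin_add]
  field_simp
  ring

lemma image_arcFoot (h0 : 0 < Ψ) (hΨ : Ψ ≤ π / 2) (hφ0 : 0 < φ) (hφ1 : φ < π / 2) :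
    arcFoot Ψ φ '' Set.Ioo (arcStart Ψ φ) Ψ = Set.Ioo 0 1 := by
  have hs : 0 < sin Ψ := sin_pos_of_pos_of_lt_pi h0 (by linarith [pi_pos])
  have hc : 0 < cos φ := cos_pos_of_mem_Ioo ⟨by linarith, hφ1⟩
  have hlt := arcStart_lt h0 hφ1
  have hmono := strictMonoOn_arcFoot h0 hΨ hφ0 hφ1
  have hcont : ContinuousOn (arcFoot Ψ φ) (Set.Icc (arcStart Ψ φ) Ψ) := fun x _ =>
    (hasDerivAt_arcFoot Ψ φ x).continuousAt.continuousWithinAt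
  refine Set.Subset.antisymm ?_ ?_
  · rintro _ ⟨x, hx, rfl⟩
    rw [← arcFoot_arcStart (Ψ := Ψ) (φ := φ), ← arcFoot_self hs.ne' hc.ne']
    exact ⟨hmono ⟨le_rfl, hlt.le⟩ ⟨hx.1.le, hx.2.le⟩ hx.1,
      hmono ⟨hx.1.le, hx.2.le⟩ ⟨hlt.le, le_rfl⟩ hx.2⟩
  · have := intermediate_value_Ioo hlt.le hcont
    rwa [arcFoot_arcStart, arcFoot_self hs.ne' hc.ne'] at this

/-- Integration over the starting points, expressed through the points of the arc. -/
lemma integral_eq_of_arcFoot (h0 : 0 < Ψ) (hΨ : Ψ ≤ π / 2) (hφ0 : 0 < φ) (hφ1 : φ < π / 2)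
    {F : ℝ → ℝ} (hF : ∀ α ∈ Set.Ioo (arcStart Ψ φ) Ψ,
      F (arcFoot Ψ φ α) = 2 - limitDensity Ψ φ α / cos (φ - α)) :
    (∫ ξ in (0 : ℝ)..1, F ξ) * cos φ =
      2 * cos φ - 1 / (2 * sin Ψ) * ∫ α in (-Ψ)..Ψ, limitDensity Ψ φ α := by
  have hs : 0 < sin Ψ := sin_pos_of_pos_of_lt_pi h0 (by linarith [pi_pos])
  have hc : 0 < cos φ := cos_pos_of_mem_Ioo ⟨by linarith, hφ1⟩
  have hlt := arcStart_lt h0 hφ1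
  have hlo := neg_pi_div_two_le_arcStart_sub (Ψ := Ψ) (φ := φ)
  have hinj : Set.InjOn (arcFoot Ψ φ) (Set.Ioo (arcStart Ψ φ) Ψ) :=
    ((strictMonoOn_arcFoot h0 hΨ hφ0 hφ1).mono Set.Ioo_subset_Icc_self).injOn
  have hsub : ∀ G : ℝ → ℝ, ∫ ξ in (0 : ℝ)..1, G ξ = ∫ α in arcStart Ψ φ..Ψ,
      |cos (α - φ) / (2 * sin Ψ * cos φ)| * G (arcFoot Ψ φ α) := by
    intro G
    rw [intervalIntegral.integral_of_le zero_le_one, intervalIntegral.integral_of_le hlt.le,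
      integral_Ioc_eq_integral_Ioo, integral_Ioc_eq_integral_Ioo, ← image_arcFoot h0 hΨ hφ0 hφ1,
      integral_image_eq_integral_abs_deriv_smul measurableSet_Ioo
        (fun x _ => (hasDerivAt_arcFoot Ψ φ x).hasDerivWithinAt) hinj]
    rfl
  -- The substitution applied to a constant evaluates the integral of the Jacobian.
  have h2 := hsub fun _ => 2
  rw [intervalIntegral.integral_const, sub_zero, one_smul] at h2
  have hzero : ∫ α in (-Ψ)..(arcStart Ψ φ), limitDensity Ψ φ α = 0 := by
    rw [intervalIntegral.integral_congr_Ioo_of_le (g := fun _ => (0 : ℝ))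
      (show -Ψ ≤ arcStart Ψ φ from le_max_left _ _) fun α hα => ?_, intervalIntegral.integral_zero]
    rcases lt_max_iff.1 hα.2 with h | h
    · exact absurd h (not_lt.2 hα.1.le)
    · exact if_pos h.le
  rw [← intervalIntegral.integral_add_adjacent_intervals
    (intervalIntegrable_limitDensity Ψ φ (-Ψ) (arcStart Ψ φ))
    (intervalIntegrable_limitDensity Ψ φ _ Ψ), hzero, zero_add]
  have key : ∫ ξ in (0 : ℝ)..1, F ξ = ∫ α in arcStart Ψ φ..Ψ,
      (|cos (α - φ) / (2 * sin Ψ * cos φ)| * 2 -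
        1 / (2 * sin Ψ * cos φ) * limitDensity Ψ φ α) := by
    rw [hsub F]
    refine intervalIntegral.integral_congr_Ioo_of_le hlt.le fun α hα => ?_
    have hcα : 0 < cos (φ - α) :=
      cos_pos_of_mem_Ioo ⟨by linarith [hα.2], by linarith [hα.1]⟩
    rw [hF α hα, ← cos_neg (α - φ), neg_sub, abs_of_pos (by positivity)]
    field_simp
  rw [key, intervalIntegral.integral_sub (Continuous.intervalIntegrable (by fun_prop) _ _)
    ((intervalIntegrable_limitDensity Ψ φ _ _).const_mul _), ← h2,
    intervalIntegral.integral_const_mul]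
  field_simp

theorem pseudoResistance_eq (h0 : 0 < Ψ) (hΨ : Ψ ≤ π / 2) :
    pseudoResistance Ψ = 3 / 2 - 3 / (8 * sin Ψ) *
      ∫ φ in (0 : ℝ)..(π / 2), ∫ α in (-Ψ)..Ψ, limitDensity Ψ φ α := by
  set G : ℝ → ℝ := fun φ => ∫ ξ in (0 : ℝ)..1,
    (∑' r : ℕ, splinterSum Ψ (fun ψ => 1 + cos (ψ - φ)) r (ξ, 0) φ) * cos φ with hG
  set K : ℝ → ℝ := fun φ => 2 * cos φ - 1 / (2 * sin Ψ) * ∫ α in (-Ψ)..Ψ, limitDensity Ψ φ α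
    with hK
  have hmem : ∀ φ α : ℝ, α ∈ Set.Ioo (arcStart Ψ φ) Ψ →
      α ∈ Set.Ioo (-Ψ) Ψ ∧ 2 * φ - π + Ψ < α := fun φ α hα =>
    ⟨⟨(le_max_left _ _).trans_lt hα.1, hα.2⟩, (le_max_right _ _).trans_lt hα.1⟩
  have hright : ∀ φ ∈ Set.Ioo 0 (π / 2), G φ = K φ := by
    intro φ hφ
    have hc : 0 < cos φ := cos_pos_of_mem_Ioo ⟨by linarith [hφ.1], hφ.2⟩
    rw [hG, hK]
    simp only
    rw [intervalIntegral.integral_mul_const]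
    refine integral_eq_of_arcFoot h0 hΨ hφ.1 hφ.2 fun α hα => ?_
    obtain ⟨h1, h2⟩ := hmem φ α hα
    exact (hasSum_splinterSum_right h0 hΨ hφ.1 hφ.2 h2 (hitsArc_arcFoot h0 hΨ hc h1)
      fun β hβ => eq_of_hitsArc_arcFoot h0 hΨ hφ.1 hφ.2 h1 h2 hβ).tsum_eq
  have hleft : ∀ φ ∈ Set.Ioo 0 (π / 2), G (-φ) = K φ := by
    intro φ hφ
    have hc : 0 < cos φ := cos_pos_of_mem_Ioo ⟨by linarith [hφ.1], hφ.2⟩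
    rw [hG, hK]
    simp only
    rw [intervalIntegral.integral_mul_const, cos_neg]
    have := intervalIntegral.integral_comp_sub_left (a := 0) (b := 1)
      (fun ξ => ∑' r : ℕ, splinterSum Ψ (fun ψ => 1 + cos (ψ - -φ)) r (ξ, 0) (-φ)) 1
    rw [sub_self, sub_zero] at this
    rw [← this]
    refine integral_eq_of_arcFoot h0 hΨ hφ.1 hφ.2 fun α hα => ?_
    obtain ⟨h1, h2⟩ := hmem φ α hα
    exact (hasSum_splinterSum_left h0 hΨ hφ.1 hφ.2 h2 (hitsArc_arcFoot h0 hΨ hc h1)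
      fun β hβ => eq_of_hitsArc_arcFoot h0 hΨ hφ.1 hφ.2 h1 h2 hβ).tsum_eq
  have hpi : (0 : ℝ) ≤ π / 2 := by positivity
  have hV : IntervalIntegrable (fun φ => ∫ α in (-Ψ)..Ψ, limitDensity Ψ φ α) volume 0 (π / 2) :=
    intervalIntegrable_integral_of_measurable (measurable_limitDensity Ψ)
      (fun z => abs_limitDensity_le Ψ z.1 z.2) (-Ψ) Ψ 0 (π / 2)
  have hKint : IntervalIntegrable K volume 0 (π / 2) :=
    (Continuous.intervalIntegrable (by fun_prop) _ _).sub (hV.const_mul _)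
  -- Integrability of `G` is inherited from `K`, with which it agrees on the open interval; no
  -- measurability of the splinter sums is required.
  have hGr : IntervalIntegrable G volume 0 (π / 2) :=
    hKint.congr_uIoo fun φ hφ => by
      rw [Set.uIoo_of_le hpi] at hφ; exact (hright φ hφ).symm
  have hGl' : IntervalIntegrable (fun φ => G (-φ)) volume 0 (π / 2) :=
    hKint.congr_uIoo fun φ hφ => by
      rw [Set.uIoo_of_le hpi] at hφ; exact (hleft φ hφ).symm
  have hGl : IntervalIntegrable G volume (-(π / 2)) 0 := by
    have := (hGl'.comp_mul_left (c := -1)).symm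
    simpa [div_neg] using this
  have e1 : ∫ φ in (0 : ℝ)..(π / 2), G φ = ∫ φ in (0 : ℝ)..(π / 2), K φ :=
    intervalIntegral.integral_congr_Ioo_of_le hpi hright
  have e2 : ∫ φ in (-(π / 2))..0, G φ = ∫ φ in (0 : ℝ)..(π / 2), K φ := by
    have := intervalIntegral.integral_comp_neg (a := 0) (b := π / 2) G
    rw [neg_zero] at this
    rw [← this]
    exact intervalIntegral.integral_congr_Ioo_of_le hpi hleft
  have e3 : ∫ φ in (0 : ℝ)..(π / 2), K φ = 2 - 1 / (2 * sin Ψ) *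
      ∫ φ in (0 : ℝ)..(π / 2), ∫ α in (-Ψ)..Ψ, limitDensity Ψ φ α := by
    rw [hK, intervalIntegral.integral_sub (Continuous.intervalIntegrable (by fun_prop) _ _)
      (hV.const_mul _), intervalIntegral.integral_const_mul, intervalIntegral.integral_const_mul,
      integral_cos]
    simp
  have e : pseudoResistance Ψ = 3 / 8 * ∫ φ in (-(π / 2))..(π / 2), G φ := rfl
  rw [e, ← intervalIntegral.integral_add_adjacent_intervals hGl hGr, e1, e2, e3]
  have hs : sin Ψ ≠ 0 := (sin_pos_of_pos_of_lt_pi h0 (by linarith [pi_pos])).ne'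
  field_simp
  ring

end PseudoBilliard

end
noncomputable section
open Real MeasureTheory

/-! ### Canonical lines of the segment -/

section Flat

variable {n : ℕ} {t : ℕ → ℝ}

lemma IsPartition.isProfile (h : IsPartition 0 1 n t) : IsProfile n fun i => (t i, 0) :=
  ⟨fun i hi => h.2.2 i hi, fun _ _ => le_rfl⟩

lemma IsPartition.mono {lo hi : ℝ} (h : IsPartition lo hi n t) {i j : ℕ} (hij : i ≤ j)
    (hj : j ≤ n) : t i ≤ t j := by
  induction j, hij using Nat.le_induction with
  | base => exact le_rfl
  | succ j _ ih => exact (ih (by omega)).trans (h.2.2 j (by omega)).le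

lemma IsPartition.flipped (h : IsPartition 0 1 n t) : IsPartition 0 1 n fun i => 1 - t (n - i) := by
  refine ⟨?_, ?_, fun i hi => ?_⟩
  · simp [h.2.1]
  · simp [h.1]
  · have := h.2.2 (n - (i + 1)) (by omega)
    rw [show n - (i + 1) + 1 = n - i by omega] at this
    linarith

lemma isFlipped_flat (n : ℕ) (t : ℕ → ℝ) :
    IsFlipped n (fun i => (t i, 0)) fun i => (1 - t (n - i), 0) := fun _ _ => rfl

/-- The hypotenuses lie on the axis here, so the flight that reaches one ends there. For an arc the
flight has to be prolonged; phrasing `LeavesTo` through the incoming flight covers both situations.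
-/
lemma IsPartition.leavesTo (h : IsPartition 0 1 n t) {i : ℕ} (hi : i < n) {y : ℝ} (hy0 : 0 < y)
    (hy1 : y < 1) (v : ℝ × ℝ) : IsProfile.LeavesTo n (fun i => (t i, 0)) i y v v := by
  intro q s hf hq
  have h0 : 0 ≤ t i := h.1.symm.le.trans (h.mono i.zero_le hi.le)
  have h1 : t (i + 1) ≤ 1 := (h.mono hi le_rfl).trans h.2.1.le
  have hlt := h.2.2 i hi
  refine .arrive q v s hf ?_ ?_
  · rw [hq, triPoint_hypotenuse]; simp
  · rw [hq, triPoint_hypotenuse]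
    simp only [Prod.fst_add, Prod.smul_fst, smul_eq_mul]
    have := mul_pos hy0 (sub_pos.2 hlt)
    have := mul_pos (sub_pos.2 hy1) (sub_pos.2 hlt)
    constructor <;> linarith

lemma heading_eq_triVec_flat {a c : ℝ} (h : a < c) (φ : ℝ) : heading φ =
    triVec (a, 0) (c, 0) (-((sin φ + cos φ) / (c - a))) ((sin φ - cos φ) / (c - a)) := by
  have hL : hypot (a, 0) (c, 0) = c - a := by
    rw [hypot]
    simp only [sub_self, ne_eq, OfNat.ofNat_ne_zero, not_false_eq_true, zero_pow, add_zero]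
    exact sqrt_sq (by linarith)
  have : c - a ≠ 0 := by linarith
  ext
  · simp only [heading, triVec]
    field_simp
    ring
  · simp only [heading, triVec, hL]
    field_simp
    ring

/-- The particles that start on a given hypotenuse. -/
lemma IsPartition.integral_deficit (h : IsPartition 0 1 n t) {i : ℕ} (hi : i < n) {φ : ℝ}
    (hφ0 : 0 < φ) (hφ1 : φ < π / 2) :
    ∫ ξ in t i..t (i + 1), deficit (2 * n) (canonicalLine fun i => (t i, 0)) φ ξ =
      (t (i + 1) - t i) * (min 1 (tan φ) * (1 - sin (2 * φ))) := by
  have hlt := h.2.2 i hi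
  have hc : 0 < cos φ := cos_pos_of_mem_Ioo ⟨by linarith, hφ1⟩
  have hs : 0 < sin φ := sin_pos_of_pos_of_lt_pi hφ0 (by linarith [pi_pos])
  obtain ⟨L, hL⟩ : ∃ L, L = t (i + 1) - t i := ⟨_, rfl⟩
  have hL0 : 0 < L := by linarith
  have hL1 : 0 < 1 / L := by positivity
  have hprof := h.isProfile
  have hneg : triVec (t i, 0) (t (i + 1), 0) ((sin φ + cos φ) / L) ((sin φ - cos φ) / L) =
      -heading (π / 2 - φ) := by
    rw [heading_eq_triVec_flat hlt, ← hL, sin_pi_div_two_sub, cos_pi_div_two_sub, ← triVec_neg]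
    congr 1 <;> ring
  have hstart : ∀ ξ ∈ Set.Ioo (t i) (t (i + 1)), ∃ y, 0 < y ∧ y < 1 ∧ (1 - y) * L = t (i + 1) - ξ ∧
      (ξ, (0 : ℝ)) = triPoint (t i, 0) (t (i + 1), 0) (1 - y) y := by
    intro ξ hξ
    refine ⟨(ξ - t i) / L, div_pos (by linarith [hξ.1]) hL0,
      (div_lt_one hL0).2 (by linarith [hξ.2]), ?_, ?_⟩
    · field_simp; linarith
    · rw [triPoint_hypotenuse]
      ext
      · simp only [Prod.fst_add, Prod.smul_fst, smul_eq_mul]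
        field_simp
        rw [hL]; ring
      · simp
  -- Every particle that leaves a triangle is already back, so the deficit takes only two values and
  -- the error parameter is `0`.
  have key := abs_integral_sub_min_mul_le (f := deficit (2 * n) (canonicalLine fun i => (t i, 0)) φ)
    (l := t i) (r := t (i + 1)) (K := L * tan φ) (d := 1 - sin (2 * φ)) (η := 0)
    (E := {ξ | 0 - (t (i + 1) - ξ) * (2 * cos φ) = L * (-sin φ - cos φ)}) hlt.le ?_
    (countable_affine_eq _ _ _ (by positivity)) (hprof.intervalIntegrable_deficit φ) ?_ ?_
  · rw [mul_zero, abs_nonpos_iff, sub_eq_zero, ← hL] at key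
    rw [key, ← hL]
    nth_rewrite 1 [← mul_one L]
    rw [← mul_min_of_nonneg _ _ hL0.le, mul_assoc]
  · rw [tan_eq_sin_div_cos]; positivity
  · intro ξ hξ hξE hK
    obtain ⟨y, hy0, hy1, hy, he⟩ := hstart ξ hξ
    rw [hprof.deficit_eq (ψ := φ)]
    · simp
    · have hlt' : sin φ < (1 - y) * cos φ := by
        rw [← hy, tan_eq_sin_div_cos, mul_comm, mul_lt_mul_iff_left₀ hL0, div_lt_iff₀ hc] at hK
        exact hK
      have hdouble := hprof.double_reflection hi (a := -((sin φ + cos φ) / L))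
        (b := (sin φ - cos φ) / L) (y := y) (w := -heading φ) ?_ hy0 hy1 ?_ ?_ ?_ ?_
      · rw [he]
        rwa [hL, ← heading_eq_triVec_flat hlt] at hdouble
      · rw [← neg_div]; gcongr; linarith
      · have : 0 < (2 * ((1 - y) * cos φ - sin φ)) / L := by
          apply div_pos _ hL0; linarith
        have e : y * (-((sin φ + cos φ) / L) + (sin φ - cos φ) / L) -
          2 * ((sin φ - cos φ) / L) = (2 * ((1 - y) * cos φ - sin φ)) / L := by ring
        linarith
      · intro hne
        apply hξE
        rw [Set.mem_ofPred_eq, ← hy]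
        field_simp at hne
        linear_combination (-L) * hne
      · exact div_neg_of_neg_of_pos (by nlinarith) hL0
      · intro y' h0' h1'
        rw [triVec_neg, hL, ← heading_eq_triVec_flat hlt]
        exact h.leavesTo hi h0' h1' _
  · intro ξ hξ _ hK
    obtain ⟨y, hy0, hy1, hy, he⟩ := hstart ξ hξ
    rw [hprof.deficit_eq (ψ := π / 2 - φ)]
    · rw [show π / 2 - φ - φ = π / 2 - 2 * φ by ring, cos_pi_div_two_sub]; simp
    · have hlt' : (1 - y) * cos φ < sin φ := by
        rw [← hy, tan_eq_sin_div_cos, mul_comm L, mul_lt_mul_iff_left₀ hL0, lt_div_iff₀ hc] at hK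
        exact hK
      have hsingle := hprof.single_right hi (a := -((sin φ + cos φ) / L))
        (b := (sin φ - cos φ) / L) (y := y) (w := -heading (π / 2 - φ)) ?_ hy0 hy1 ?_ ?_
      · rw [he]
        rwa [hL, ← heading_eq_triVec_flat hlt] at hsingle
      · have e : -((sin φ + cos φ) / L) + (sin φ - cos φ) / L = -(2 * cos φ / L) := by ring
        rw [e, neg_lt_zero]; positivity
      · have : 0 < (2 * (sin φ - (1 - y) * cos φ)) / L := by
          apply div_pos _ hL0; linarith
        have e : 2 * ((sin φ - cos φ) / L) - y * (-((sin φ + cos φ) / L) + (sin φ - cos φ) / L) =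
          (2 * (sin φ - (1 - y) * cos φ)) / L := by ring
        linarith
      · intro y' h0' h1' _
        rw [neg_neg, hneg]
        exact h.leavesTo hi h0' h1' _

lemma IsPartition.meanDeficit_eq (h : IsPartition 0 1 n t) {φ : ℝ} (hφ0 : 0 < φ)
    (hφ1 : φ < π / 2) :
    meanDeficit (2 * n) (canonicalLine fun i => (t i, 0)) φ =
      min 1 (tan φ) * (1 - sin (2 * φ)) := by
  have hsum := intervalIntegral.sum_integral_adjacent_intervals (n := n) (a := t)
    (f := deficit (2 * n) (canonicalLine fun i => (t i, 0)) φ) (μ := volume)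
    fun k _ => h.isProfile.intervalIntegrable_deficit φ _ _
  rw [h.1, h.2.1] at hsum
  rw [meanDeficit, ← hsum, Finset.sum_congr rfl fun i hi =>
    h.integral_deficit (Finset.mem_range.1 hi) hφ0 hφ1, ← Finset.sum_mul, Finset.sum_range_sub,
    h.1, h.2.1, sub_zero, one_mul]

lemma integral_flat : ∫ φ in (0 : ℝ)..(π / 2), min (cos φ) (sin φ) * (1 - sin (2 * φ)) =
    2 - 4 * √2 / 3 := by
  have hpi := pi_pos
  have hcont : Continuous fun φ : ℝ => min (cos φ) (sin φ) * (1 - sin (2 * φ)) := by fun_prop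
  have hord : ∀ φ : ℝ, cos φ - sin φ = √2 * sin (π / 4 - φ) := fun φ => by
    rw [sin_sub, sin_pi_div_four, cos_pi_div_four]
    have := Real.mul_self_sqrt (show (0 : ℝ) ≤ 2 by norm_num)
    linear_combination (-(cos φ - sin φ) / 2) * this
  have hq : √2 ^ 3 = 2 * √2 := by
    rw [pow_succ, Real.sq_sqrt (by norm_num)]
  have i1 : ∫ φ in (0 : ℝ)..(π / 4), min (cos φ) (sin φ) * (1 - sin (2 * φ)) =
      ∫ φ in (0 : ℝ)..(π / 4), sin φ * (1 - 2 * sin φ * cos φ) := by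
    refine intervalIntegral.integral_congr_Ioo_of_le (by linarith) fun φ hφ => ?_
    have : 0 < √2 * sin (π / 4 - φ) := mul_pos (by positivity)
      (sin_pos_of_pos_of_lt_pi (by linarith [hφ.2]) (by linarith [hφ.1]))
    rw [min_eq_right (by linarith [hord φ]), sin_two_mul]
  have i2 : ∫ φ in (π / 4)..(π / 2), min (cos φ) (sin φ) * (1 - sin (2 * φ)) =
      ∫ φ in (π / 4)..(π / 2), cos φ * (1 - 2 * sin φ * cos φ) := by
    refine intervalIntegral.integral_congr_Ioo_of_le (by linarith) fun φ hφ => ?_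
    have : √2 * sin (π / 4 - φ) < 0 := mul_neg_of_pos_of_neg (by positivity)
      (sin_neg_of_neg_of_neg_pi_lt (by linarith [hφ.1]) (by linarith [hφ.2]))
    rw [min_eq_left (by linarith [hord φ]), sin_two_mul]
  rw [← intervalIntegral.integral_add_adjacent_intervals
    (hcont.intervalIntegrable 0 (π / 4)) (hcont.intervalIntegrable _ _), i1, i2,
    intervalIntegral.integral_eq_sub_of_hasDerivAt
      (f := fun x => -cos x - 2 / 3 * sin x ^ 3) (fun x _ => ?_)
      (Continuous.intervalIntegrable (by fun_prop) _ _),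
    intervalIntegral.integral_eq_sub_of_hasDerivAt
      (f := fun x => sin x + 2 / 3 * cos x ^ 3) (fun x _ => ?_)
      (Continuous.intervalIntegrable (by fun_prop) _ _)]
  · simp only [cos_pi_div_four, sin_pi_div_four, cos_zero, sin_zero, cos_pi_div_two,
      sin_pi_div_two]
    linear_combination (-1 / 6) * hq
  · refine HasDerivAt.congr_deriv ((hasDerivAt_sin x).add
      (((hasDerivAt_cos x).pow 3).const_mul (2 / 3))) ?_
    simp
    ring
  · refine HasDerivAt.congr_deriv ((hasDerivAt_cos x).neg.sub
      (((hasDerivAt_sin x).pow 3).const_mul (2 / 3))) ?_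
    simp
    ring

/-- The resistance of every canonical line of the segment is `√2`. -/
theorem IsPartition.resistance_eq (h : IsPartition 0 1 n t) :
    resistance (2 * n) (canonicalLine fun i => (t i, 0)) = √2 := by
  have key : ∀ s : ℕ → ℝ, IsPartition 0 1 n s → ∫ φ in (0 : ℝ)..(π / 2),
      cos φ * meanDeficit (2 * n) (canonicalLine fun i => (s i, 0)) φ = 2 - 4 * √2 / 3 := by
    intro s hs
    rw [← integral_flat]
    refine intervalIntegral.integral_congr_Ioo_of_le (by positivity) fun φ hφ => ?_
    have hc : 0 < cos φ := cos_pos_of_mem_Ioo ⟨by linarith [hφ.1, pi_pos], hφ.2⟩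
    have e : cos φ * tan φ = sin φ := by rw [mul_comm, tan_mul_cos hc.ne']
    rw [hs.meanDeficit_eq hφ.1 hφ.2, ← mul_assoc, mul_min_of_nonneg _ _ hc.le, mul_one, e]
  rw [h.isProfile.resistance_eq h.flipped.isProfile (isFlipped_flat n t), key t h,
    key _ h.flipped]
  ring

end Flat

end
noncomputable section
open Real

/-! ### The shape of the limit resistance -/

section Shape

variable {Ψ : ℝ}

/-- Cancelling `sin (Ψ / 2)` leaves `Ψ / sin Ψ` as the only indeterminate term at `0`. -/
lemma limitResistance_eq_of_mem (h0 : 0 < Ψ) (h1 : Ψ < π) :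
    limitResistance Ψ = 1 + sin Ψ ^ 2 / 6 + √2 / cos (Ψ / 2) - sin (Ψ / 2) ^ 3 / cos (Ψ / 2) -
      Ψ / sin Ψ := by
  have hs : 0 < sin (Ψ / 2) := sin_pos_of_pos_of_lt_pi (by linarith) (by linarith)
  have hc : 0 < cos (Ψ / 2) := cos_pos_of_mem_Ioo ⟨by linarith, by linarith⟩
  have e : sin Ψ = 2 * sin (Ψ / 2) * cos (Ψ / 2) := by
    rw [← sin_two_mul]; congr 1; ring
  rw [limitResistance, e]
  field_simp
  ring

lemma tendsto_limitResistance :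
    Filter.Tendsto limitResistance (nhdsWithin 0 (Set.Ioi 0)) (nhds √2) := by
  have h : Filter.Tendsto (fun Ψ => 1 + sin Ψ ^ 2 / 6 + √2 / cos (Ψ / 2) -
      sin (Ψ / 2) ^ 3 / cos (Ψ / 2) - (sinc Ψ)⁻¹) (nhds 0) (nhds √2) := by
    have : ContinuousAt (fun Ψ : ℝ => 1 + sin Ψ ^ 2 / 6 + √2 / cos (Ψ / 2) -
        sin (Ψ / 2) ^ 3 / cos (Ψ / 2) - (sinc Ψ)⁻¹) 0 := by
      have h1 : ContinuousAt (fun Ψ : ℝ => (sinc Ψ)⁻¹) 0 :=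
        continuous_sinc.continuousAt.inv₀ (by simp)
      have h2 : cos ((0 : ℝ) / 2) ≠ 0 := by simp
      fun_prop (disch := assumption)
    simpa [ContinuousAt] using this
  refine (h.mono_left nhdsWithin_le_nhds).congr' ?_
  filter_upwards [Ioo_mem_nhdsGT pi_pos] with Ψ hΨ
  rw [limitResistance_eq_of_mem hΨ.1 hΨ.2, sinc_of_ne_zero hΨ.1.ne', inv_div]

/-- The derivative of the limit resistance is the product of `sin Ψ` and this function. -/
def slopeFactor (Ψ : ℝ) : ℝ :=
  cos Ψ / 3 + √2 / 4 * (cos (Ψ / 2) ^ 3)⁻¹ - (3 * tan (Ψ / 2) + tan (Ψ / 2) ^ 3) / 4 -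
    (sin Ψ - Ψ * cos Ψ) / sin Ψ ^ 3

lemma hasDerivAt_limitResistance (h0 : 0 < Ψ) (h1 : Ψ < π) :
    HasDerivAt limitResistance (sin Ψ * slopeFactor Ψ) Ψ := by
  have hs : 0 < sin (Ψ / 2) := sin_pos_of_pos_of_lt_pi (by linarith) (by linarith)
  have hc : 0 < cos (Ψ / 2) := cos_pos_of_mem_Ioo ⟨by linarith, by linarith⟩
  have hS : 0 < sin Ψ := sin_pos_of_pos_of_lt_pi h0 h1
  have e : sin Ψ = 2 * sin (Ψ / 2) * cos (Ψ / 2) := by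
    rw [← sin_two_mul]; congr 1; ring
  have hd : HasDerivAt (fun x : ℝ => x / 2) (1 / 2) Ψ := (hasDerivAt_id Ψ).div_const 2
  have h := (((((hasDerivAt_sin Ψ).pow 2).div_const 6).const_add 1).add
    ((hasDerivAt_const Ψ √2).div hd.cos hc.ne')).sub ((hd.sin.pow 3).div hd.cos hc.ne') |>.sub
      ((hasDerivAt_id Ψ).div (hasDerivAt_sin Ψ) hS.ne')
  refine (h.congr_of_eventuallyEq ?_).congr_deriv ?_
  · filter_upwards [Ioo_mem_nhds h0 h1] with x hx
    exact limitResistance_eq_of_mem hx.1 hx.2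
  · have e1 : sin Ψ * slopeFactor Ψ = sin Ψ * cos Ψ / 3 + 2 * sin (Ψ / 2) * cos (Ψ / 2) *
        (√2 / 4 * (cos (Ψ / 2) ^ 3)⁻¹ - (3 * tan (Ψ / 2) + tan (Ψ / 2) ^ 3) / 4) -
          (sin Ψ - Ψ * cos Ψ) / sin Ψ ^ 2 := by
      rw [← e, slopeFactor]
      field_simp
      ring
    rw [e1, tan_eq_sin_div_cos]
    simp only [Pi.pow_apply, id_eq, Nat.cast_ofNat, Nat.add_one_sub_one, pow_one]
    field_simp
    ring

lemma sin_sub_mul_cos_nonneg {x : ℝ} (h0 : 0 ≤ x) (h1 : x ≤ π) : 0 ≤ sin x - x * cos x := by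
  have hd : ∀ x : ℝ, HasDerivAt (fun x : ℝ => sin x - x * cos x) (x * sin x) x := fun x => by
    refine ((hasDerivAt_sin x).sub ((hasDerivAt_id x).mul (hasDerivAt_cos x))).congr_deriv ?_
    simp
  have := monotoneOn_of_deriv_nonneg (convex_Icc 0 π)
    (fun y _ => (hd y).continuousAt.continuousWithinAt)
    (fun y _ => (hd y).differentiableAt.differentiableWithinAt) (fun y hy => by
      rw [interior_Icc] at hy
      rw [(hd y).deriv]
      exact mul_nonneg hy.1.le (sin_nonneg_of_nonneg_of_le_pi hy.1.le hy.2.le))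
    ⟨le_rfl, pi_pos.le⟩ ⟨h0, h1⟩ h0
  simpa using this

/-- The difference of the two sides has derivative `4 sin (x/2) (sin (x/2) - (x/2) cos (x/2))`,
which is nonnegative by `sin_sub_mul_cos_nonneg`. -/
lemma three_mul_sin_le {x : ℝ} (h0 : 0 ≤ x) (h1 : x ≤ π) : 3 * sin x ≤ x * (2 + cos x) := by
  have hd : ∀ x : ℝ, HasDerivAt (fun x : ℝ => x * (2 + cos x) - 3 * sin x)
      (2 - 2 * cos x - x * sin x) x := fun x => by
    refine (((hasDerivAt_id x).mul ((hasDerivAt_cos x).const_add 2)).sub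
      ((hasDerivAt_sin x).const_mul 3)).congr_deriv ?_
    simp
    ring
  have := monotoneOn_of_deriv_nonneg (convex_Icc 0 π)
    (fun y _ => (hd y).continuousAt.continuousWithinAt)
    (fun y _ => (hd y).differentiableAt.differentiableWithinAt) (fun y hy => by
      rw [interior_Icc] at hy
      rw [(hd y).deriv]
      have h2 := sin_sub_mul_cos_nonneg (x := y / 2) (by linarith [hy.1]) (by linarith [hy.1, hy.2])
      have h3 := sin_nonneg_of_nonneg_of_le_pi (x := y / 2) (by linarith [hy.1])
        (by linarith [hy.1, hy.2])
      have e1 : cos y = 1 - 2 * sin (y / 2) ^ 2 := by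
        have := cos_two_mul (y / 2)
        rw [mul_div_cancel₀ y two_ne_zero, cos_sq'] at this
        linarith
      have e2 : sin y = 2 * sin (y / 2) * cos (y / 2) := by rw [← sin_two_mul]; congr 1; ring
      rw [e1, e2]
      linarith [mul_nonneg h3 h2])
    ⟨le_rfl, pi_pos.le⟩ ⟨h0, h1⟩ h0
  simp only [zero_mul, sin_zero, mul_zero, sub_zero] at this
  linarith

/-- The derivative is arranged in three terms whose signs can be read off for `Ψ ≤ π / 2`. -/
lemma hasDerivAt_slopeFactor (h0 : 0 < Ψ) (h1 : Ψ < π) :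
    HasDerivAt slopeFactor (-sin Ψ / 3 + 3 / 8 * (√2 * sin (Ψ / 2) - 1) / cos (Ψ / 2) ^ 4 -
      (2 * Ψ * (2 + cos (2 * Ψ)) - 3 * sin (2 * Ψ)) / (2 * sin Ψ ^ 4)) Ψ := by
  have hc : 0 < cos (Ψ / 2) := cos_pos_of_mem_Ioo ⟨by linarith, by linarith⟩
  have hS : 0 < sin Ψ := sin_pos_of_pos_of_lt_pi h0 h1
  have hd : HasDerivAt (fun x : ℝ => x / 2) (1 / 2) Ψ := (hasDerivAt_id Ψ).div_const 2
  have ht : HasDerivAt (fun x : ℝ => tan (x / 2)) (1 / cos (Ψ / 2) ^ 2 * (1 / 2)) Ψ :=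
    (Real.hasDerivAt_tan hc.ne').comp (h := fun x : ℝ => x / 2) Ψ hd
  have h := ((((hasDerivAt_cos Ψ).div_const 3).add
    (((hd.cos.pow 3).inv (pow_ne_zero 3 hc.ne')).const_mul (√2 / 4))).sub
    (((ht.const_mul 3).add (ht.pow 3)).div_const 4)).sub
    (((hasDerivAt_sin Ψ).sub ((hasDerivAt_id Ψ).mul (hasDerivAt_cos Ψ))).div
      ((hasDerivAt_sin Ψ).pow 3) (pow_ne_zero 3 hS.ne'))
  refine h.congr_deriv ?_
  have e1 : (2 * Ψ * (2 + cos (2 * Ψ)) - 3 * sin (2 * Ψ)) / (2 * sin Ψ ^ 4) =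
      (Ψ * sin Ψ ^ 2 - 3 * sin Ψ * cos Ψ + 3 * Ψ * cos Ψ ^ 2) / sin Ψ ^ 4 := by
    rw [cos_two_mul, sin_two_mul]
    field_simp
    linear_combination (-Ψ) * sin_sq_add_cos_sq Ψ
  have e2 : 3 / 8 * (√2 * sin (Ψ / 2) - 1) / cos (Ψ / 2) ^ 4 =
      3 / 8 * √2 * sin (Ψ / 2) / cos (Ψ / 2) ^ 4 -
        3 / 8 * (1 + tan (Ψ / 2) ^ 2) / cos (Ψ / 2) ^ 2 := by
    rw [tan_eq_sin_div_cos]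
    field_simp
    linear_combination sin_sq_add_cos_sq (Ψ / 2)
  rw [e1, e2]
  simp only [Pi.pow_apply, Pi.sub_apply, Pi.mul_apply, id_eq, Nat.cast_ofNat,
    Nat.add_one_sub_one, one_mul]
  field_simp
  ring

/-- The range `Ψ ≤ π / 2` enters twice: `√2 * sin (Ψ / 2) ≤ 1` needs `Ψ / 2 ≤ π / 4`, and
`three_mul_sin_le` is applied at `2 * Ψ ≤ π`. -/
lemma strictAntiOn_slopeFactor : StrictAntiOn slopeFactor (Set.Ioc 0 (π / 2)) := by
  have hpi := pi_pos
  refine strictAntiOn_of_deriv_neg (convex_Ioc 0 (π / 2)) (fun x hx =>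
    (hasDerivAt_slopeFactor hx.1 (by linarith [hx.2])).continuousAt.continuousWithinAt) ?_
  intro x hx
  rw [interior_Ioc] at hx
  rw [(hasDerivAt_slopeFactor hx.1 (by linarith [hx.2])).deriv]
  have h1 : 0 < sin x := sin_pos_of_pos_of_lt_pi hx.1 (by linarith [hx.2])
  have h2 : √2 * sin (x / 2) ≤ 1 := by
    have : sin (x / 2) ≤ sin (π / 4) :=
      sin_le_sin_of_le_of_le_pi_div_two (by linarith [hx.1]) (by linarith) (by linarith [hx.2])
    rw [sin_pi_div_four] at this
    calc √2 * sin (x / 2) ≤ √2 * (√2 / 2) := by gcongr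
      _ = 1 := by rw [← mul_div_assoc, Real.mul_self_sqrt (by norm_num)]; norm_num
  have h3 : 3 / 8 * (√2 * sin (x / 2) - 1) / cos (x / 2) ^ 4 ≤ 0 :=
    div_nonpos_of_nonpos_of_nonneg (by linarith) (by positivity)
  have h4 : 0 ≤ (2 * x * (2 + cos (2 * x)) - 3 * sin (2 * x)) / (2 * sin x ^ 4) :=
    div_nonneg (sub_nonneg.2 (three_mul_sin_le (by linarith [hx.1]) (by linarith [hx.2])))
      (by positivity)
  linarith

lemma strictMonoOn_limitResistance {c : ℝ} (hc0 : 0 < c) (hc : c ≤ π / 2)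
    (h : slopeFactor c = 0) : StrictMonoOn limitResistance (Set.Ioc 0 c) := by
  have hpi := pi_pos
  refine strictMonoOn_of_deriv_pos (convex_Ioc 0 c) (fun x hx =>
    (hasDerivAt_limitResistance hx.1 (by linarith [hx.2])).continuousAt.continuousWithinAt) ?_
  intro x hx
  rw [interior_Ioc] at hx
  rw [(hasDerivAt_limitResistance hx.1 (by linarith [hx.2])).deriv]
  refine mul_pos (sin_pos_of_pos_of_lt_pi hx.1 (by linarith [hx.2])) ?_
  rw [← h]
  exact strictAntiOn_slopeFactor ⟨hx.1, by linarith [hx.2]⟩ ⟨hc0, hc⟩ hx.2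

lemma strictAntiOn_limitResistance {c : ℝ} (hc0 : 0 < c) (hc : c ≤ π / 2)
    (h : slopeFactor c = 0) : StrictAntiOn limitResistance (Set.Icc c (π / 2)) := by
  have hpi := pi_pos
  refine strictAntiOn_of_deriv_neg (convex_Icc c (π / 2)) (fun x hx =>
    (hasDerivAt_limitResistance (hc0.trans_le hx.1)
      (by linarith [hx.2])).continuousAt.continuousWithinAt) ?_
  intro x hx
  rw [interior_Icc] at hx
  have hx0 : 0 < x := hc0.trans hx.1
  rw [(hasDerivAt_limitResistance hx0 (by linarith [hx.2])).deriv]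
  refine mul_neg_of_pos_of_neg (sin_pos_of_pos_of_lt_pi hx0 (by linarith [hx.2])) ?_
  rw [← h]
  exact strictAntiOn_slopeFactor ⟨hc0, hc⟩ ⟨hx0, hx.2.le⟩ hx.1

end Shape

end
noncomputable section
open Real

/-! ### Numerical bounds -/

section Numerics

lemma abs_mul_sub_mul_le {x y a b d e : ℝ} (hx : |x - a| ≤ d) (hy : |y - b| ≤ e)
    (hx1 : |x| ≤ 1) (hb : |b| ≤ 1) : |x * y - a * b| ≤ d + e := by
  have h : x * y - a * b = (x - a) * b + x * (y - b) := by ring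
  rw [h]
  refine (abs_add_le _ _).trans (add_le_add ?_ ?_) <;> rw [abs_mul]
  · exact (mul_le_of_le_one_right (abs_nonneg _) hb).trans hx
  · exact (mul_le_of_le_one_left (abs_nonneg _) hx1).trans hy

/-- Both estimates are the real and imaginary parts of the remainder bound for `exp (i x)` with ten
terms; the constant is `11 / (10! * 10)`. -/
lemma exp_taylor_bound {x : ℝ} (hx : |x| ≤ 1) :
    |cos x - (1 - x ^ 2 / 2 + x ^ 4 / 24 - x ^ 6 / 720 + x ^ 8 / 40320)| ≤
        |x| ^ 10 * (11 / 36288000) ∧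
      |sin x - (x - x ^ 3 / 6 + x ^ 5 / 120 - x ^ 7 / 5040 + x ^ 9 / 362880)| ≤
        |x| ^ 10 * (11 / 36288000) := by
  have h := Complex.exp_bound (x := x * Complex.I) (by simpa using hx) (n := 10) (by norm_num)
  have hn : ‖(x : ℂ) * Complex.I‖ = |x| := by simp
  have hI4 : Complex.I ^ 4 = 1 := Complex.I_pow_four
  have e : Complex.exp (x * Complex.I) -
      ∑ m ∈ Finset.range 10, (x * Complex.I) ^ m / (m.factorial : ℂ) =
      ((cos x - (1 - x ^ 2 / 2 + x ^ 4 / 24 - x ^ 6 / 720 + x ^ 8 / 40320) : ℝ) : ℂ) +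
      ((sin x - (x - x ^ 3 / 6 + x ^ 5 / 120 - x ^ 7 / 5040 + x ^ 9 / 362880) : ℝ) : ℂ) *
        Complex.I := by
    rw [Complex.exp_mul_I]
    simp only [Finset.sum_range_succ, Finset.sum_range_zero, Nat.factorial, mul_pow]
    have p2 : Complex.I ^ 2 = -1 := Complex.I_sq
    have p3 : Complex.I ^ 3 = -Complex.I := by rw [pow_succ, p2]; ring
    have p5 : Complex.I ^ 5 = Complex.I := by rw [pow_succ, hI4]; ring
    have p6 : Complex.I ^ 6 = -1 := by rw [pow_succ, p5, ← sq, p2]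
    have p7 : Complex.I ^ 7 = -Complex.I := by rw [pow_succ, p6]; ring
    have p8 : Complex.I ^ 8 = 1 := by rw [pow_succ, p7]; linear_combination -p2
    have p9 : Complex.I ^ 9 = Complex.I := by rw [pow_succ, p8]; ring
    rw [p2, p3, hI4, p5, p6, p7, p8, p9]
    push_cast
    ring
  rw [e, hn] at h
  have hc : |x| ^ 10 * (((10 : ℕ).succ : ℝ) * (((10 : ℕ).factorial : ℝ) * (10 : ℕ))⁻¹) =
      |x| ^ 10 * (11 / 36288000) := by
    norm_num [Nat.factorial]
  rw [hc] at h
  constructor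
  · refine le_trans ?_ ((Complex.abs_re_le_norm _).trans h)
    simp [-Complex.ofReal_sub, -Complex.ofReal_add]
  · refine le_trans ?_ ((Complex.abs_im_le_norm _).trans h)
    simp [-Complex.ofReal_sub, -Complex.ofReal_add]

/-- The slope factor multiplied by `sin Ψ ^ 3`, where `r = √2 / 2`, `s = sin (Ψ / 2)` and
`c = cos (Ψ / 2)`. -/
def slopePoly (Ψ r s c : ℝ) : ℝ :=
  8 / 3 * (s * c * (s * c) * (s * c)) - 16 / 3 * (s * c * (s * c) * (s * c) * (s * s)) +
    4 * (r * (s * (s * s))) - 6 * (s * s * (s * c * (s * c))) - 2 * (s * s * (s * s) * (s * s)) -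
    2 * (s * c) + Ψ - 2 * Ψ * (s * s)

/-- The difference of the limit resistance and `v`, multiplied by `sin Ψ`. -/
def resistancePoly (v Ψ r s c : ℝ) : ℝ :=
  2 * (1 - v) * (s * c) + 4 / 3 * (s * c * (s * c) * (s * c)) + 4 * (r * s) -
    2 * (s * s * (s * s)) - Ψ

lemma slopePoly_eq {Ψ : ℝ} (h0 : 0 < Ψ) (h1 : Ψ < π) :
    slopePoly Ψ (√2 / 2) (sin (Ψ / 2)) (cos (Ψ / 2)) = sin Ψ ^ 3 * slopeFactor Ψ := by
  have hs : 0 < sin (Ψ / 2) := sin_pos_of_pos_of_lt_pi (by linarith) (by linarith)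
  have hc : 0 < cos (Ψ / 2) := cos_pos_of_mem_Ioo ⟨by linarith, by linarith⟩
  have e : sin Ψ = 2 * sin (Ψ / 2) * cos (Ψ / 2) := by
    rw [← sin_two_mul]; congr 1; ring
  have e' : cos Ψ = 1 - 2 * sin (Ψ / 2) ^ 2 := by
    have := cos_two_mul (Ψ / 2)
    rw [mul_div_cancel₀ Ψ two_ne_zero, cos_sq'] at this
    linarith
  rw [slopePoly, slopeFactor, e, e', tan_eq_sin_div_cos]
  field_simp
  ring

lemma resistancePoly_eq {v Ψ : ℝ} (h0 : 0 < Ψ) (h1 : Ψ < π) :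
    resistancePoly v Ψ (√2 / 2) (sin (Ψ / 2)) (cos (Ψ / 2)) =
      sin Ψ * (limitResistance Ψ - v) := by
  have hs : 0 < sin (Ψ / 2) := sin_pos_of_pos_of_lt_pi (by linarith) (by linarith)
  have hc : 0 < cos (Ψ / 2) := cos_pos_of_mem_Ioo ⟨by linarith, by linarith⟩
  have e : sin Ψ = 2 * sin (Ψ / 2) * cos (Ψ / 2) := by
    rw [← sin_two_mul]; congr 1; ring
  rw [resistancePoly, limitResistance, e]
  field_simp
  ring

/-- A product of `k` factors in `[-1, 1]`, each perturbed by at most `d`, changes by at most `k *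
d`. Adding these bounds with the coefficients of the polynomials gives the constants. -/
lemma abs_poly_sub_le {Ψ v r s c r' s' c' d : ℝ} (hΨ0 : 0 ≤ Ψ) (hΨ : Ψ ≤ 1) (hv : 1 ≤ v)
    (hv' : v ≤ 2)
    (hr : |r - r'| ≤ d) (hs : |s - s'| ≤ d) (hc : |c - c'| ≤ d) (hr1 : |r| ≤ 1) (hs1 : |s| ≤ 1)
    (hc1 : |c| ≤ 1) (hs1' : |s'| ≤ 1) (hc1' : |c'| ≤ 1) :
    |slopePoly Ψ r s c - slopePoly Ψ r' s' c'| ≤ 140 * d ∧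
      |resistancePoly v Ψ r s c - resistancePoly v Ψ r' s' c'| ≤ 28 * d ∧
      |s * c * (s * c) * (s * c) - s' * c' * (s' * c') * (s' * c')| ≤ 6 * d := by
  have hm : ∀ {x y : ℝ}, |x| ≤ 1 → |y| ≤ 1 → |x * y| ≤ 1 := fun hx hy => by
    rw [abs_mul]; exact mul_le_one₀ hx (abs_nonneg _) hy
  have b1 := abs_mul_sub_mul_le hs hc hs1 hc1'
  have n1 := hm hs1 hc1
  have n1' := hm hs1' hc1'
  have b2 := abs_mul_sub_mul_le hs hs hs1 hs1'
  have n2 := hm hs1 hs1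
  have n2' := hm hs1' hs1'
  have b3 := abs_mul_sub_mul_le b1 b1 n1 n1'
  have n3 := hm n1 n1
  have n3' := hm n1' n1'
  have b4 := abs_mul_sub_mul_le b3 b1 n3 n1'
  have n4 := hm n3 n1
  have b5 := abs_mul_sub_mul_le b4 b2 n4 n2'
  have b6 := abs_mul_sub_mul_le hs b2 hs1 n2'
  have n6' := hm hs1' n2'
  have b7 := abs_mul_sub_mul_le hr b6 hr1 n6'
  have b8 := abs_mul_sub_mul_le b2 b3 n2 n3'
  have b9 := abs_mul_sub_mul_le b2 b2 n2 n2'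
  have n9 := hm n2 n2
  have b10 := abs_mul_sub_mul_le b9 b2 n9 n2'
  have b11 := abs_mul_sub_mul_le hr hs hr1 hs1'
  have hΨ1 : |Ψ| ≤ 1 := abs_le.2 ⟨by linarith, hΨ⟩
  have b12 := abs_mul_sub_mul_le (x := Ψ) (a := Ψ) (d := 0) (by simp) b2 hΨ1 n2'
  have hv1 : |1 - v| ≤ 1 := abs_le.2 ⟨by linarith, by linarith⟩
  have b13 := abs_mul_sub_mul_le (x := 1 - v) (a := 1 - v) (d := 0) (by simp) b1 hv1 n1'
  rw [abs_le] at b1 b4 b5 b7 b8 b9 b10 b11 b12 b13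
  refine ⟨abs_le.2 ⟨?_, ?_⟩, abs_le.2 ⟨?_, ?_⟩, abs_le.2 ⟨by linarith, by linarith⟩⟩ <;>
  simp only [slopePoly, resistancePoly] <;>
  linarith

lemma abs_sqrt_two_div_two_sub_le :
    |√2 / 2 - 70710678118 / 100000000000| ≤ 1 / 10000000000 := by
  have h1 : 2 * (70710678118 / 100000000000) ≤ √2 := Real.le_sqrt_of_sq_le (by norm_num)
  have h2 : √2 ≤ 2 * (70710678119 / 100000000000) := Real.sqrt_le_iff.2 ⟨by norm_num, by norm_num⟩
  rw [abs_le]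
  constructor <;> linarith

lemma abs_sin_cos_sub_le {x s c : ℝ} (h0 : 0 ≤ x) (h1 : x ≤ 7 / 20)
    (hs : |x - x ^ 3 / 6 + x ^ 5 / 120 - x ^ 7 / 5040 + x ^ 9 / 362880 - s| ≤ 1 / 100000000000)
    (hc : |1 - x ^ 2 / 2 + x ^ 4 / 24 - x ^ 6 / 720 + x ^ 8 / 40320 - c| ≤ 1 / 100000000000) :
    |sin x - s| ≤ 1 / 10000000000 ∧ |cos x - c| ≤ 1 / 10000000000 := by
  obtain ⟨hc', hs'⟩ := exp_taylor_bound (x := x) (abs_le.2 ⟨by linarith, by linarith⟩)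
  have hx : |x| ^ 10 * (11 / 36288000) ≤ 1 / 100000000000 := by
    rw [abs_of_nonneg h0]
    calc x ^ 10 * (11 / 36288000) ≤ (7 / 20) ^ 10 * (11 / 36288000) := by gcongr
      _ ≤ 1 / 100000000000 := by norm_num
  rw [abs_le] at hs hc hs' hc' ⊢
  rw [abs_le]
  refine ⟨⟨?_, ?_⟩, ?_, ?_⟩ <;> linarith

lemma abs_sqrt_two_div_two_le_one : |√2 / 2| ≤ 1 := by
  have := abs_le.1 abs_sqrt_two_div_two_sub_le
  rw [abs_le]
  constructor <;> linarith

lemma numeric_bounds {Ψ v s c : ℝ} (h0 : 0 < Ψ) (h1 : Ψ ≤ 7 / 10) (hv : 1 ≤ v) (hv' : v ≤ 2)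
    (hsc : |sin (Ψ / 2) - s| ≤ 1 / 10000000000 ∧ |cos (Ψ / 2) - c| ≤ 1 / 10000000000)
    (hs1 : |s| ≤ 1) (hc1 : |c| ≤ 1) :
    |sin Ψ ^ 3 * slopeFactor Ψ - slopePoly Ψ (70710678118 / 100000000000) s c| ≤
        140 / 10000000000 ∧
      |sin Ψ * (limitResistance Ψ - v) - resistancePoly v Ψ (70710678118 / 100000000000) s c| ≤
        28 / 10000000000 ∧
      |sin Ψ ^ 3 - 8 * (s * c * (s * c) * (s * c))| ≤ 48 / 10000000000 := by
  have hpi := pi_gt_three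
  obtain ⟨k1, k2, k3⟩ := abs_poly_sub_le (v := v) h0.le (by linarith) hv hv'
    abs_sqrt_two_div_two_sub_le hsc.1 hsc.2 abs_sqrt_two_div_two_le_one (abs_sin_le_one _)
    (abs_cos_le_one _) hs1 hc1
  rw [slopePoly_eq h0 (by linarith)] at k1
  rw [resistancePoly_eq h0 (by linarith)] at k2
  refine ⟨k1.trans (by norm_num), k2.trans (by norm_num), ?_⟩
  have e : sin Ψ = 2 * sin (Ψ / 2) * cos (Ψ / 2) := by
    rw [← sin_two_mul]; congr 1; ring
  rw [e]
  rw [abs_le] at k3 ⊢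
  constructor <;> linarith

/-- The sign, with that in `slopeFactor_right`, brackets the zero; the size bounds the slope between
the two points. The decimals `s`, `c` approximate the sine and cosine of `0.3417`. -/
lemma slopeFactor_left : 0 < slopeFactor 0.6834 ∧ slopeFactor 0.6834 < 1 / 1000 := by
  obtain ⟨k1, -, k3⟩ := numeric_bounds (Ψ := 0.6834) (v := 1) (s := 335089292412 / 1000000000000)
    (c := 942186375471 / 1000000000000) (by norm_num) (by norm_num) (by norm_num) (by norm_num)
    (abs_sin_cos_sub_le (by norm_num) (by norm_num) (by norm_num [abs_le]) (by norm_num [abs_le]))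
    (by norm_num [abs_le]) (by norm_num [abs_le])
  rw [abs_le] at k1 k3
  norm_num [slopePoly] at k1 k3
  norm_num
  have h3 : 0 < sin (3417 / 5000) ^ 3 := by linarith [k3.1]
  constructor
  · exact pos_of_mul_pos_right (a := sin (3417 / 5000) ^ 3) (by linarith [k1.1]) h3.le
  · refine lt_of_mul_lt_mul_left (a := sin (3417 / 5000) ^ 3) ?_ h3.le
    linarith [k1.2, k3.1]

lemma slopeFactor_right : -(1 / 1000) < slopeFactor 0.6836 ∧ slopeFactor 0.6836 < 0 := by
  obtain ⟨k1, -, k3⟩ := numeric_bounds (Ψ := 0.6836) (v := 1) (s := 335183509374 / 1000000000000)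
    (c := 942152861830 / 1000000000000) (by norm_num) (by norm_num) (by norm_num) (by norm_num)
    (abs_sin_cos_sub_le (by norm_num) (by norm_num) (by norm_num [abs_le]) (by norm_num [abs_le]))
    (by norm_num [abs_le]) (by norm_num [abs_le])
  rw [abs_le] at k1 k3
  norm_num [slopePoly] at k1 k3
  norm_num
  have h3 : 0 < sin (1709 / 2500) ^ 3 := by linarith [k3.1]
  constructor
  · refine lt_of_mul_lt_mul_left (a := sin (1709 / 2500) ^ 3) ?_ h3.le
    linarith [k1.1, k3.1]
  · refine lt_of_mul_lt_mul_left (a := sin (1709 / 2500) ^ 3) ?_ h3.le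
    linarith [k1.2]

lemma limitResistance_middle :
    1.4452085 < limitResistance 0.6835 ∧ limitResistance 0.6835 < 1.4452092 := by
  have hsc : |sin ((0.6835 : ℝ) / 2) - 335136401312 / 1000000000000| ≤ 1 / 10000000000 ∧
      |cos ((0.6835 : ℝ) / 2) - 942169619828 / 1000000000000| ≤ 1 / 10000000000 :=
    abs_sin_cos_sub_le (by norm_num) (by norm_num) (by norm_num [abs_le]) (by norm_num [abs_le])
  have hpos : 0 < sin (0.6835 : ℝ) :=
    sin_pos_of_pos_of_lt_pi (by norm_num) (by linarith [pi_gt_three])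
  constructor
  · obtain ⟨-, k, -⟩ := numeric_bounds (v := 1.4452085) (by norm_num) (by norm_num) (by norm_num)
      (by norm_num) hsc (by norm_num [abs_le]) (by norm_num [abs_le])
    have k' := (abs_le.1 k).1
    have : 0 < sin (0.6835 : ℝ) * (limitResistance 0.6835 - 1.4452085) := by
      refine lt_of_lt_of_le ?_ (le_sub_iff_add_le.1 k')
      norm_num [resistancePoly]
    linarith [pos_of_mul_pos_right this hpos.le]
  · obtain ⟨-, k, -⟩ := numeric_bounds (v := 1.4452092) (by norm_num) (by norm_num) (by norm_num)
      (by norm_num) hsc (by norm_num [abs_le]) (by norm_num [abs_le])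
    have k' := (abs_le.1 k).2
    have : sin (0.6835 : ℝ) * (limitResistance 0.6835 - 1.4452092) < 0 := by
      refine lt_of_le_of_lt (sub_le_iff_le_add.1 k') ?_
      norm_num [resistancePoly]
    linarith [neg_of_mul_neg_right this hpos.le]

/-- The maximum of the limit resistance. -/
theorem exists_isMax_limitResistance : ∃ Ψ₀ : ℝ, 0 < Ψ₀ ∧ Ψ₀ ≤ π / 2 ∧ |Ψ₀ - 0.6835| < 0.0001 ∧
    |limitResistance Ψ₀ - 1.445209| < 0.0000005 ∧ √2 < limitResistance Ψ₀ ∧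
      ∀ Ψ : ℝ, 0 < Ψ → Ψ ≤ π / 2 → Ψ ≠ Ψ₀ → limitResistance Ψ < limitResistance Ψ₀ := by
  have hpi := pi_gt_three
  have hmid : (0.6834 : ℝ) < 0.6835 ∧ (0.6835 : ℝ) < 0.6836 := by norm_num
  have hpos : (0 : ℝ) < 0.6834 := by norm_num
  have hone : (0.6836 : ℝ) < 1 := by norm_num
  obtain ⟨c, hc, hc0⟩ := intermediate_value_Ioo' (hmid.1.trans hmid.2).le (f := slopeFactor)
    (fun x hx => (hasDerivAt_slopeFactor (by linarith [hx.1])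
      (by linarith [hx.2])).continuousAt.continuousWithinAt)
    ⟨slopeFactor_right.2, slopeFactor_left.1⟩
  have hcpos : 0 < c := hpos.trans hc.1
  have hcle : c ≤ π / 2 := by linarith [hc.2]
  have hmax : ∀ Ψ : ℝ, 0 < Ψ → Ψ ≤ π / 2 → Ψ ≠ c → limitResistance Ψ < limitResistance c := by
    intro Ψ h0 h1 hne
    rcases hne.lt_or_gt with hlt | hgt
    · exact strictMonoOn_limitResistance hcpos hcle hc0 ⟨h0, hlt.le⟩ ⟨hcpos, le_rfl⟩ hlt
    · exact strictAntiOn_limitResistance hcpos hcle hc0 ⟨le_rfl, hcle⟩ ⟨hgt.le, h1⟩ hgt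
  have hlow : 1.4452085 < limitResistance c := by
    rcases eq_or_ne 0.6835 c with h | h
    · rw [← h]; exact limitResistance_middle.1
    · exact limitResistance_middle.1.trans (hmax _ (by norm_num) (by linarith) h)
  -- By monotonicity the end values bound `slopeFactor` by `1/1000` throughout, so the maximum
  -- differs from the value at `0.6835` by at most `10⁻⁷`.
  have hdiff : |limitResistance c - limitResistance 0.6835| ≤ 1 / 1000 * |c - 0.6835| := by
    have := Convex.norm_image_sub_le_of_norm_hasDerivWithin_le (f := limitResistance)
      (f' := fun x => sin x * slopeFactor x) (s := Set.Icc 0.6834 0.6836) (C := 1 / 1000)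
      (x := 0.6835) (y := c) (fun x hx => (hasDerivAt_limitResistance (by linarith [hx.1])
        (by linarith [hx.2])).hasDerivWithinAt) (fun x hx => ?_) (convex_Icc _ _)
      ⟨hmid.1.le, hmid.2.le⟩ ⟨hc.1.le, hc.2.le⟩
    · simpa only [norm_eq_abs] using this
    · rw [norm_eq_abs, abs_mul]
      have hanti := strictAntiOn_slopeFactor.antitoneOn
      have m1 : (0.6834 : ℝ) ∈ Set.Ioc 0 (π / 2) := ⟨hpos, by linarith⟩
      have m2 : (0.6836 : ℝ) ∈ Set.Ioc 0 (π / 2) := ⟨by linarith, by linarith⟩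
      have m : x ∈ Set.Ioc 0 (π / 2) := ⟨by linarith [hx.1], by linarith [hx.2]⟩
      have h1 := hanti m1 m hx.1
      have h2 := hanti m m2 hx.2
      refine (mul_le_of_le_one_left (abs_nonneg _) (abs_sin_le_one x)).trans (abs_le.2 ⟨?_, ?_⟩)
      · linarith [slopeFactor_right.1]
      · linarith [slopeFactor_left.2]
  have hclose : |c - 0.6835| < 0.0001 := by
    have h1 := hc.1
    have h2 := hc.2
    rw [abs_lt]
    norm_num at h1 h2 ⊢
    constructor <;> linarith
  refine ⟨c, hcpos, hcle, hclose, ?_, ?_, hmax⟩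
  · have h1 := (abs_le.1 hdiff).2
    have h2 := limitResistance_middle.2
    rw [abs_lt]
    norm_num at hlow h1 h2 hclose ⊢
    constructor <;> linarith
  · refine lt_trans ?_ hlow
    rw [Real.sqrt_lt' (by norm_num)]
    norm_num

end Numerics

end
noncomputable section
open Real

/-! ### The limit of the resistances of canonical lines -/

section Limit

variable {Ψ : ℝ} {n : ℕ} {a : ℕ → ℝ}

/-- A single step would be `2 * Ψ`, but the steps are less than `sin Ψ < Ψ`; so there are at least
two small arcs. -/
lemma IsPartition.isArcPartition (h : IsPartition (-Ψ) Ψ n a) (h0 : 0 < Ψ) (hΨ : Ψ ≤ π / 2)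
    {δ : ℝ} (hδ : δ < 1 / 2) (hmesh : ∀ i < n, a (i + 1) - a i ≤ 2 * sin Ψ * δ) :
    IsArcPartition Ψ n a := by
  refine ⟨h0, hΨ, ?_, h⟩
  by_contra hn
  have hs : 0 < sin Ψ := sin_pos_of_pos_of_lt_pi h0 (by linarith [pi_pos])
  obtain rfl | rfl : n = 0 ∨ n = 1 := by omega
  · linarith [h.1, h.2.1]
  · have h1 := hmesh 0 one_pos
    rw [zero_add, h.1, h.2.1] at h1
    have h2 := mul_lt_mul_of_pos_left hδ (mul_pos two_pos hs)
    linarith [sin_lt h0]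

/-- Measured by arc length instead of angle, the factor `1 / sin Ψ` cancels and the constant becomes
independent of `Ψ`. -/
lemma IsPartition.abs_resistance_sub_limit_le (h : IsPartition (-Ψ) Ψ n a) (h0 : 0 < Ψ)
    (hΨ : Ψ ≤ π / 2) {δ : ℝ} (hδ : δ < 1 / 2)
    (hmesh : ∀ i < n, a (i + 1) - a i ≤ 2 * sin Ψ * δ) :
    |resistance (2 * n) (canonicalLine fun i => arcPoint Ψ (a i)) - limitResistance Ψ| ≤
      100 * δ := by
  have hs : 0 < sin Ψ := sin_pos_of_pos_of_lt_pi h0 (by linarith [pi_pos])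
  have key := (h.isArcPartition h0 hΨ hδ hmesh).abs_resistance_sub_le hmesh
    (by nlinarith [sin_le_one Ψ])
  rw [← limitResistance_eq h0 hΨ] at key
  refine key.trans (le_of_eq ?_)
  field_simp
  ring

/-- Near `±π/2` the arc is almost vertical and its first coordinate varies only quadratically with
the angle. The square is what a mesh condition on first coordinates can control uniformly. -/
lemma two_mul_sq_le_sin_sub_sin {x y : ℝ} (hx : -(π / 2) ≤ x) (hxy : x ≤ y) (hy : y ≤ π / 2) :
    2 * ((y - x) / π) ^ 2 ≤ sin y - sin x := by
  have hpi := pi_pos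
  have h1 : (y - x) / π ≤ sin ((y - x) / 2) := by
    have := mul_le_sin (x := (y - x) / 2) (by linarith) (by linarith)
    refine le_trans (le_of_eq ?_) this
    field_simp
  have h2 : sin ((y - x) / 2) ≤ cos ((y + x) / 2) := by
    rw [← cos_pi_div_two_sub, ← cos_abs ((y + x) / 2)]
    exact cos_le_cos_of_nonneg_of_le_pi (abs_nonneg _) (by linarith)
      (abs_le.2 ⟨by linarith, by linarith⟩)
  have h0 : 0 ≤ (y - x) / π := div_nonneg (by linarith) hpi.le
  rw [sin_sub_sin]
  have := mul_le_mul h1 (h1.trans h2) h0 (h0.trans h1)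
  linarith

lemma IsPartition.step_le (h : IsPartition (-Ψ) Ψ n a) (h0 : 0 < Ψ) (hΨ : Ψ ≤ π / 2)
    {D : ℝ} (hD : 0 < D) {i : ℕ} (hi : i < n)
    (hx : (arcPoint Ψ (a (i + 1))).1 - (arcPoint Ψ (a i)).1 < (D / π) ^ 2 / sin Ψ) :
    a (i + 1) - a i ≤ D := by
  have hs : 0 < sin Ψ := sin_pos_of_pos_of_lt_pi h0 (by linarith [pi_pos])
  by_contra! hcon
  have h1 := h.mono i.zero_le hi.le
  have h2 := h.mono (i := i + 1) hi le_rfl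
  rw [h.1] at h1
  rw [h.2.1] at h2
  have h3 := two_mul_sq_le_sin_sub_sin (x := a i) (y := a (i + 1)) (by linarith) (by linarith)
    (by linarith)
  have h4 : (D / π) ^ 2 ≤ ((a (i + 1) - a i) / π) ^ 2 := by gcongr
  refine absurd hx (not_lt.2 ?_)
  simp only [arcPoint]
  rw [← sub_div, add_sub_add_left_eq_sub, div_le_div_iff₀ hs (by positivity)]
  nlinarith

end Limit

end
theorem mainTheorem4 :
    -- for every arc: the pseudo-billiard value, the limit of the billiard values, and its rate
    (∀ Ψ : ℝ, 0 < Ψ → Ψ ≤ Real.pi / 2 →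
      pseudoResistance Ψ = limitResistance Ψ ∧
      (∀ ε : ℝ, 0 < ε → ∃ η : ℝ, 0 < η ∧ ∀ (n : ℕ) (a : ℕ → ℝ), IsPartition (-Ψ) Ψ n a →
        (∀ i < n, (arcPoint Ψ (a (i + 1))).1 - (arcPoint Ψ (a i)).1 < η) →
        |resistance (2 * n) (canonicalLine fun i => arcPoint Ψ (a i)) - limitResistance Ψ| < ε) ∧
      (∃ C δ₀ : ℝ, 0 < δ₀ ∧ ∀ δ : ℝ, 0 < δ → δ < δ₀ →
        ∀ (n : ℕ) (a : ℕ → ℝ), IsPartition (-Ψ) Ψ n a →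
        (∀ i < n, (a (i + 1) - a i) / (2 * Real.sin Ψ) ≤ δ) →
        |resistance (2 * n) (canonicalLine fun i => arcPoint Ψ (a i)) - limitResistance Ψ|
          ≤ C * δ)) ∧
    -- the degenerate arc `Ψ = 0`, that is, the segment from `(0, 0)` to `(1, 0)`
    (∀ ε : ℝ, 0 < ε → ∃ η : ℝ, 0 < η ∧ ∀ (n : ℕ) (t : ℕ → ℝ), IsPartition 0 1 n t →
      (∀ i < n, t (i + 1) - t i < η) →
      |resistance (2 * n) (canonicalLine fun i => (t i, 0)) - Real.sqrt 2| < ε) ∧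
    Filter.Tendsto limitResistance (nhdsWithin 0 (Set.Ioi 0)) (nhds (Real.sqrt 2)) ∧
    -- the maximum over `0 ≤ Ψ ≤ π/2`
    (∃ Ψ₀ : ℝ, 0 < Ψ₀ ∧ Ψ₀ ≤ Real.pi / 2 ∧ |Ψ₀ - 0.6835| < 0.0001 ∧
      |limitResistance Ψ₀ - 1.445209| < 0.0000005 ∧
      Real.sqrt 2 < limitResistance Ψ₀ ∧
      ∀ Ψ : ℝ, 0 < Ψ → Ψ ≤ Real.pi / 2 → Ψ ≠ Ψ₀ →
        limitResistance Ψ < limitResistance Ψ₀) := by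
  refine ⟨fun Ψ h0 hΨ => ⟨?_, fun ε hε => ?_, 100, 1 / 2, by norm_num,
    fun δ _ hδ n a h hmesh => ?_⟩,
    fun ε hε => ⟨1, one_pos, fun n t h _ => ?_⟩, tendsto_limitResistance,
    exists_isMax_limitResistance⟩
  · rw [pseudoResistance_eq h0 hΨ, limitResistance_eq h0 hΨ]
  · have hs : 0 < Real.sin Ψ := Real.sin_pos_of_pos_of_lt_pi h0 (by linarith [Real.pi_pos])
    obtain ⟨δ, hδ0, hδ, hδε⟩ : ∃ δ : ℝ, 0 < δ ∧ δ < 1 / 2 ∧ 100 * δ < ε :=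
      ⟨min (1 / 4) (ε / 200), by positivity, (min_le_left _ _).trans_lt (by norm_num), by
        linarith [min_le_right (1 / 4) (ε / 200)]⟩
    -- The threshold from `step_le` for the angular step `D = 2 * sin Ψ * δ`, which corresponds to
    -- arc length `δ`.
    refine ⟨(2 * Real.sin Ψ * δ / Real.pi) ^ 2 / Real.sin Ψ, by positivity, fun n a h hmesh => ?_⟩
    exact (h.abs_resistance_sub_limit_le h0 hΨ hδ fun i hi =>
      h.step_le h0 hΨ (by positivity) hi (hmesh i hi)).trans_lt hδε
  · have hs : 0 < Real.sin Ψ := Real.sin_pos_of_pos_of_lt_pi h0 (by linarith [Real.pi_pos])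
    refine h.abs_resistance_sub_limit_le h0 hΨ hδ fun i hi => ?_
    have := hmesh i hi
    rwa [div_le_iff₀ (by positivity), mul_comm] at this
  -- The value is exactly `√2`, so the mesh bound `1` chosen above is arbitrary.
  · rwa [h.resistance_eq, sub_self, abs_zero]
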